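/- **Setting.** Put $\sigma=\begin{pmatrix}0&1\\1&0\end{pmatrix}$. Let $\zeta\in(-1,0)\cup(0,1)$ and let $\Sigma\subset\mathbb C$ consist of finitely many smooth oriented curves of finite length with at most finitely many (self-)intersections, all of them transversal. Assume $0,\zeta\notin\Sigma$, that $\Sigma$ is invariant under $z\mapsto z^{-1}$, and that this map sends the positive (left) side of $\Sigma$ to the negative side. Jump data $w=(w_+,w_-)$ are $2\times2$ matrix functions continuous on $\Sigma$ with $b_-=\mathbb I-w_-$ invertible on $\Sigma$ and $w_\pm(z^{-1})=-\sigma w_\mp(z)\sigma$ for $z\in\Sigma$; put $b_+=\mathbb I+w_+$, $v=b_-^{-1}b_+$ and $\|w\|_\infty=\|w_+\|_{L^\infty(\Sigma)}+\|w_-\|_{L^\infty(\Sigma)}$. Let $L^2_s(\Sigma)$ be the space of row-vector valued $f\in L^2(\Sigma)$ with $f(z^{-1})=f(z)\sigma$, let $$(Cf)(z)=\frac1{2\pi\mathrm i}\int_\Sigma f(s)\,\Omega_\zeta(s,z),\qquad \Omega_\zeta(s,z)=\begin{pmatrix}\frac1{s-z}-\frac1{s-\zeta^{-1}}&0\\0&\frac1{s-z}-\frac1{s-\zeta}\end{pmatrix}ds,$$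 let $C_\pm f$ be the boundary values of $Cf$ (in the $L^2$ sense) from the positive and negative side, and $C_wf=C_+(fw_-)+C_-(fw_+)$. For $\gamma\ge0$ let $m_0(z)=(f(z),f(1/z))$ with $f(z)=\frac1{1-\zeta^2+\gamma}\bigl(\gamma\zeta^2\frac{z-\zeta^{-1}}{z-\zeta}+1-\zeta^2\bigr)$. If $\tilde\mu\in L^2_s(\Sigma)$ solves $(\mathbb I-C_w)\tilde\mu=m_0$, put $F=C(\tilde\mu(w_++w_-))$ and $\tilde c_0=(F(0))_1$ (first component). If $\tilde c_0\neq-1$, the associated solution is $m(z)=(1+\tilde c_0)^{-1}(m_0(z)+F(z))$. The Riemann–Hilbert problem with data $\zeta,\gamma,w$ asks for $m$, holomorphic off $\Sigma\cup\{\zeta,\zeta^{-1}\}$, such that $m_+=m_-v$ on $\Sigma$ (boundary values in the $L^2$ sense), $\operatorname{Res}_\zeta m=\lim_{z\to\zeta}m(z)\begin{pmatrix}0&0\\-\zeta\gamma&0\end{pmatrix}$, $\operatorname{Res}_{\zeta^{-1}}m=\lim_{z\to\zeta^{-1}}m(z)\begin{pmatrix}0&\zeta^{-1}\gamma\\0&0\end{pmatrix}$,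 $m(z^{-1})=m(z)\sigma$ and $(m(0))_1=1$. **Theorem.** Let $\Sigma$ and $\zeta$ be as above and, for $t\ge t_0$, let $\gamma^t\ge0$ and let $w_0^t$, $w^t$ be jump data. Assume that $\mathbb I-C_{w_0^t}:L^2_s(\Sigma)\to L^2_s(\Sigma)$ has a bounded inverse with a bound independent of $t$, that the constants $\tilde c_{0,0}^t$ belonging to $\zeta,\gamma^t,w_0^t$ stay away from $-1$ uniformly in $t$, and that $\|w^t-w_0^t\|_\infty\le\alpha(t)$ with $\alpha(t)\to0$ as $t\to\infty$. Then: 1. For all sufficiently large $t$ the operator $\mathbb I-C_{w^t}:L^2_s(\Sigma)\to L^2_s(\Sigma)$ has a bounded inverse, with a bound independent of $t$. 2. If in addition $\sup_{t\ge t_0}\|w_0^t\|_\infty<\infty$, then for all sufficiently large $t$ both $\tilde c_0^t$ and $\tilde c_{0,0}^t$ differ from $-1$, the associated solutions $m^t$ (data $\zeta,\gamma^t,w^t$) and $m_0^t$ (data $\zeta,\gamma^t,w_0^t$) solve their Riemann–Hilbert problems, and $m^t(z)-m_0^t(z)=O(\alpha(t))$ uniformly for $z$ away from $\Sigma\cup\{\zeta,\zeta^{-1}\}$;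 that is, there is $T$ such that for every $\varepsilon>0$ there is a constant $B$ with $|m^t(z)-m_0^t(z)|\le B\,\alpha(t)$ for all $t\ge T$ and all $z$ at distance at least $\varepsilon$ from $\Sigma\cup\{\zeta,\zeta^{-1}\}$. -/

import Mathlib

open MeasureTheory Filter Topology Set
open scoped ENNReal NNReal Matrix ContDiff

noncomputable section

/-- A contour made of `n` smooth oriented curves of finite length in the plane. The `i`-th curve is
`curve i` restricted to `[0, 1]`, oriented by increasing parameter; a smooth arc (smooth up to its
end points) is the restriction of a smooth map on the line, and a smooth closed curve is given by a
`1`-periodic map. -/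
structure OrientedContour (n : ℕ) where
  /-- the parametrizations -/
  curve : Fin n → ℝ → ℂ
  smooth : ∀ i, ContDiff ℝ ∞ (curve i)
  regular : ∀ i, ∀ x ∈ Icc (0 : ℝ) 1, deriv (curve i) x ≠ 0
  /-- the (self-)intersections are finite in number -/
  finite_crossings :
    {z : ℂ | ∃ i j : Fin n, ∃ x ∈ Icc (0 : ℝ) 1, ∃ y ∈ Icc (0 : ℝ) 1,
      (Function.Periodic (curve i) 1 → x ≠ 1) ∧ (Function.Periodic (curve j) 1 → y ≠ 1) ∧
      (i, x) ≠ (j, y) ∧ curve i x = z ∧ curve j y = z}.Finite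
  /-- the (self-)intersections are transversal; on a closed curve the parameter `1` is identified
  with the parameter `0` and therefore left out -/
  transversal : ∀ i j : Fin n, ∀ x ∈ Icc (0 : ℝ) 1, ∀ y ∈ Icc (0 : ℝ) 1,
    (Function.Periodic (curve i) 1 → x ≠ 1) → (Function.Periodic (curve j) 1 → y ≠ 1) →
    (i, x) ≠ (j, y) → curve i x = curve j y →
    LinearIndependent ℝ ![deriv (curve i) x, deriv (curve j) y]

namespace OrientedContour

variable {n : ℕ} (Γ : OrientedContour n)

/-- The contour as a subset of the plane. -/
def carrier : Set ℂ := ⋃ i, Γ.curve i '' Icc (0 : ℝ) 1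

/-- Arc length on the contour, as a measure on the plane. -/
def arcLength : Measure ℂ :=
  ∑ i, Measure.map (Γ.curve i)
    ((volume.restrict (Icc (0 : ℝ) 1)).withDensity fun x => ENNReal.ofReal ‖deriv (Γ.curve i) x‖)

/-- The contour avoids `0` and `ζ`, is invariant under `z ↦ z⁻¹`, and this map exchanges the
positive (left) and the negative (right) side. As `z ↦ z⁻¹` is conformal, the latter means that it
reverses the orientation: the image `-γ' / γ ^ 2` of a tangent vector `γ'` is a negative multiple of
the tangent vector at the image point. -/
structure IsSymmetric (ζ : ℝ) : Prop where
  zero_notMem : (0 : ℂ) ∉ Γ.carrier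
  zeta_notMem : (ζ : ℂ) ∉ Γ.carrier
  inversion : ∀ i, ∀ x ∈ Icc (0 : ℝ) 1, ∃ j, ∃ y ∈ Icc (0 : ℝ) 1,
    Γ.curve j y = (Γ.curve i x)⁻¹ ∧
    ∃ c : ℝ, 0 < c ∧ deriv (Γ.curve j) y = c * (deriv (Γ.curve i) x / Γ.curve i x ^ 2)

/-- The line integral `∫_Σ g(s) ds` of a function with values in row vectors. -/
def lineIntegral (g : ℂ → Fin 2 → ℂ) : Fin 2 → ℂ :=
  ∑ i, ∫ x in (0 : ℝ)..1, deriv (Γ.curve i) x • g (Γ.curve i x)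

/-- `L²(Σ)` with values in row vectors of length two. -/
abbrev L2 := Lp (Fin 2 → ℂ) 2 Γ.arcLength

end OrientedContour

/-- The matrix that exchanges the two components. -/
def swapMatrix : Matrix (Fin 2) (Fin 2) ℂ := !![0, 1; 1, 0]

/-- The Cauchy kernel `Ω_ζ(s, z)` (without the factor `ds`). -/
def cauchyKernel (ζ : ℝ) (s z : ℂ) : Matrix (Fin 2) (Fin 2) ℂ :=
  Matrix.diagonal ![1 / (s - z) - 1 / (s - (ζ : ℂ)⁻¹), 1 / (s - z) - 1 / (s - (ζ : ℂ))]

/-- The pair `(w_+, w_-)`. -/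
structure JumpData where
  /-- the matrix `w_+` -/
  plus : ℂ → Matrix (Fin 2) (Fin 2) ℂ
  /-- the matrix `w_-` -/
  minus : ℂ → Matrix (Fin 2) (Fin 2) ℂ

namespace JumpData

instance : Sub JumpData := ⟨fun w w' => ⟨w.plus - w'.plus, w.minus - w'.minus⟩⟩

/-- The jump matrix `v = b_-⁻¹ b_+ = (1 - w_-)⁻¹ (1 + w_+)`. -/
def jump (w : JumpData) (z : ℂ) : Matrix (Fin 2) (Fin 2) ℂ := (1 - w.minus z)⁻¹ * (1 + w.plus z)

end JumpData

namespace OrientedContour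

variable {n : ℕ} (Γ : OrientedContour n)

/-- The factors `w_±` are continuous on the contour, `b_- = 1 - w_-` is invertible, and
`b_± = 1 ± w_±` satisfy `b_±(z⁻¹) = σ b_∓(z) σ` where `σ` exchanges the components, that is,
`w_±(z⁻¹) = - σ w_∓(z) σ`. -/
structure IsJumpData (w : JumpData) : Prop where
  continuousOn_plus : ContinuousOn w.plus Γ.carrier
  continuousOn_minus : ContinuousOn w.minus Γ.carrier
  isUnit : ∀ z ∈ Γ.carrier, IsUnit (1 - w.minus z)
  plus_inv : ∀ z ∈ Γ.carrier, w.plus z⁻¹ = -(swapMatrix * w.minus z * swapMatrix)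
  minus_inv : ∀ z ∈ Γ.carrier, w.minus z⁻¹ = -(swapMatrix * w.plus z * swapMatrix)

/-- The norm `‖w‖_∞ = ‖w_+‖_{L^∞(Σ)} + ‖w_-‖_{L^∞(Σ)}`, where a matrix is measured by its largest
entry. -/
def supNorm (w : JumpData) : ℝ≥0∞ :=
  eLpNorm (fun z => Matrix.of.symm (w.plus z)) ∞ Γ.arcLength +
    eLpNorm (fun z => Matrix.of.symm (w.minus z)) ∞ Γ.arcLength

/-- The subspace `L²_s(Σ)` of all `f` in `L²(Σ)` with `f(z⁻¹) = f(z) σ`. -/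
def L2s : Set Γ.L2 := {f | ∀ᵐ z ∂Γ.arcLength, f z⁻¹ = f z ᵥ* swapMatrix}

/-- The Cauchy operator `(C f)(z) = (2πi)⁻¹ ∫_Σ f(s) Ω_ζ(s, z)` for `z` off the contour. -/
def cauchyOp (ζ : ℝ) (f : ℂ → Fin 2 → ℂ) (z : ℂ) : Fin 2 → ℂ :=
  (2 * Real.pi * Complex.I)⁻¹ • Γ.lineIntegral fun s => f s ᵥ* cauchyKernel ζ s z

/-- The function `h` on the contour is the boundary value in the `L²` sense of the function `F` off
the contour, from the positive (left) side if `side = 1`, from the negative (right) side if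
`side = -1`: along every curve `γ` the functions `F(γ ± ε i γ')` converge to `h(γ)` in `L²` as `ε`
decreases to `0`. -/
def HasBoundaryValue (side : ℝ) (F : ℂ → Fin 2 → ℂ) (h : Γ.L2) : Prop :=
  ∀ i, Tendsto
    (fun ε : ℝ => eLpNorm
      (fun x : ℝ => F (Γ.curve i x + side * ε * Complex.I * deriv (Γ.curve i) x) - h (Γ.curve i x))
      2 (volume.restrict (Icc (0 : ℝ) 1)))
    (𝓝[>] 0) (𝓝 0)

open scoped Classical in
/-- The boundary value from the given side, as an element of `L²(Σ)` (by convention `0` where there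
is none). -/
def boundaryValue (side : ℝ) (F : ℂ → Fin 2 → ℂ) : Γ.L2 :=
  if h : ∃ g : Γ.L2, Γ.HasBoundaryValue side F g then h.choose else 0

/-- The operator `C_w f = C_+(f w_-) + C_-(f w_+)`. -/
def cauchyW (ζ : ℝ) (w : JumpData) (f : Γ.L2) : Γ.L2 :=
  Γ.boundaryValue 1 (Γ.cauchyOp ζ fun s => f s ᵥ* w.minus s) +
    Γ.boundaryValue (-1) (Γ.cauchyOp ζ fun s => f s ᵥ* w.plus s)

/-- `1 - C_w` is a bijection of `L²_s(Σ)` onto itself whose inverse is bounded by `K`. -/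
def HasInverseBound (ζ : ℝ) (w : JumpData) (K : ℝ) : Prop :=
  BijOn (fun f : Γ.L2 => f - Γ.cauchyW ζ w f) Γ.L2s Γ.L2s ∧
    ∀ f ∈ Γ.L2s, ‖f‖ ≤ K * ‖f - Γ.cauchyW ζ w f‖

end OrientedContour

/-- The one soliton solution `m₀(z) = (f(z), f(1/z))` with
`f(z) = (γ ζ² (z - ζ⁻¹) / (z - ζ) + 1 - ζ²) / (1 - ζ² + γ)`. The second component is written so that
its value at `z = 0` is `f(∞)`. -/
def soliton (ζ γ : ℝ) (z : ℂ) : Fin 2 → ℂ :=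
  ![(γ * ζ ^ 2 * ((z - (ζ : ℂ)⁻¹) / (z - ζ)) + 1 - ζ ^ 2) / (1 - ζ ^ 2 + γ),
    (γ * ζ ^ 2 * ((1 - (ζ : ℂ)⁻¹ * z) / (1 - ζ * z)) + 1 - ζ ^ 2) / (1 - ζ ^ 2 + γ)]

namespace OrientedContour

variable {n : ℕ} (Γ : OrientedContour n)

/-- `m` solves the meromorphic vector Riemann--Hilbert problem with jump `v = b_-⁻¹ b_+` on the
contour and simple poles at `ζ`, `ζ⁻¹` (boundary values in the `L²` sense). -/
structure IsRHPSolution (ζ γ : ℝ) (w : JumpData) (m : ℂ → Fin 2 → ℂ) : Prop where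
  holomorphic : DifferentiableOn ℂ m (Γ.carrier ∪ {(ζ : ℂ), (ζ : ℂ)⁻¹})ᶜ
  jump : ∃ mp mm : Γ.L2, Γ.HasBoundaryValue 1 m mp ∧ Γ.HasBoundaryValue (-1) m mm ∧
    ∀ᵐ z ∂Γ.arcLength, mp z = mm z ᵥ* w.jump z
  residue_zeta : ∃ r : Fin 2 → ℂ,
    Tendsto (fun z => (z - (ζ : ℂ)) • m z) (𝓝[≠] (ζ : ℂ)) (𝓝 r) ∧
    Tendsto (fun z => m z ᵥ* !![0, 0; -((ζ : ℂ) * γ), 0]) (𝓝[≠] (ζ : ℂ)) (𝓝 r)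
  residue_zeta_inv : ∃ r : Fin 2 → ℂ,
    Tendsto (fun z => (z - (ζ : ℂ)⁻¹) • m z) (𝓝[≠] (ζ : ℂ)⁻¹) (𝓝 r) ∧
    Tendsto (fun z => m z ᵥ* !![0, (ζ : ℂ)⁻¹ * γ; 0, 0]) (𝓝[≠] (ζ : ℂ)⁻¹) (𝓝 r)
  symmetric : ∀ z ∉ Γ.carrier ∪ {0, (ζ : ℂ), (ζ : ℂ)⁻¹}, m z⁻¹ = m z ᵥ* swapMatrix
  normalized : m 0 0 = 1

/-- `μ` is a solution in `L²_s(Σ)` of `(1 - C_w) μ = m₀`. -/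
def IsMuTilde (ζ γ : ℝ) (w : JumpData) (μ : Γ.L2) : Prop :=
  μ ∈ Γ.L2s ∧ ∀ᵐ z ∂Γ.arcLength, (μ - Γ.cauchyW ζ w μ : Γ.L2) z = soliton ζ γ z

/-- The function `(2πi)⁻¹ ∫_Σ μ(s) (w_+(s) + w_-(s)) Ω_ζ(s, z)`. -/
def cauchyPart (ζ : ℝ) (w : JumpData) (μ : Γ.L2) : ℂ → Fin 2 → ℂ :=
  Γ.cauchyOp ζ fun s => μ s ᵥ* (w.plus s + w.minus s)

/-- The constant `c̃₀`, the first component of the function above at `z = 0`. -/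
def cTilde (ζ : ℝ) (w : JumpData) (μ : Γ.L2) : ℂ := Γ.cauchyPart ζ w μ 0 0

/-- The solution of the Riemann--Hilbert problem associated with a solution `μ` of
`(1 - C_w) μ = m₀`. -/
def associatedSolution (ζ γ : ℝ) (w : JumpData) (μ : Γ.L2) (z : ℂ) : Fin 2 → ℂ :=
  (1 + Γ.cTilde ζ w μ)⁻¹ • (soliton ζ γ z + Γ.cauchyPart ζ w μ z)

end OrientedContour

end

/-! ### The Fourier transform on `L¹ ∩ L²` -/

section FourierSquareIntegrable

open FourierTransform SchwartzMap

/-! The perturbation argument is short. The operator `C_w` is linear in `w`, and its norm on `L²(Σ)`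
is at most a constant times `‖w‖_∞` (`exists_norm_cauchyW_le`). Hence `1 - C_{w^t}` differs from `1
- C_{w_0^t}` by `O(α(t))`, and a contraction argument inverts it with twice the old bound
(`HasInverseBound.of_small`). The identity `(1 - C_w)(μ - μ₀) = C_{w - w₀} μ₀` then gives `μ - μ₀ =
O(α)` (`norm_isMuTilde_sub_le`). Away from `Σ` the Cauchy kernel is bounded, so the two Cauchy
integrals differ by `O(α)` as well. At `z = 0`, which is off `Σ`, this compares the constants `c̃₀`:
the perturbed one inherits the distance from `-1`, and the normalizing factor can be divided out. No
bound on `γ^t` is needed, since `m₀` is a convex combination with weights depending on `γ`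
(`norm_soliton_le`).

The substance is that `C_w` is a bounded operator at all, on a contour with crossings and end points
and with boundary values defined as `L²` limits along the normals. In curve parameters the Cauchy
kernel from a curve to itself is the kernel `1 / (y - x ∓ iε)` of the line plus a remainder; between
different curves there is only a remainder. The line kernel is a Fourier multiplier, so Plancherel
gives its limits, bounds and jump (`exists_boundary_integral_div_sub`). The remainder is bounded
except near crossings and near the junction of a closed curve. There, thanks to transversality, it
is dominated by Hilbert kernels `1 / (|x - a| + |y - b|)`, whose `L²` norms do not depend on the
centre `(a, b)` by Schur's test. A uniform bound together with convergence on a dense class gives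
the limit of the remainder, the same from both sides (`exists_tendsto_kernelOp`). The outcome is
`exists_boundaryValue_cauchyOp`: boundary values exist, are bounded, and satisfy `C_+ - C_- = 1`.

The inverse is taken on `L²_s(Σ)`, so `C_w` has to respect the symmetry. The substitution `s ↦ 1/s`
turns a Cauchy integral into a reflected one and exchanges the sides, hence swaps `C_+(f w_-)` and
`C_-(f w_+)` (`cauchyW_mem_L2s`). The difficulty is that inversion does not carry normals to
normals. For Lipschitz densities the Cauchy integrals along a normal and along the image of a normal
are compared pointwise (`tendsto_cauchySum_sub`); density extends this to `L²`.

That the associated solutions solve their Riemann–Hilbert problems is algebra: `C_+ - C_- = 1` gives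
`m_± = (1 + c̃₀)⁻¹ μ b_±`, the zeros of `Ω_ζ` at `ζ` and `ζ⁻¹` leave the residue conditions to `m₀`,
and the symmetry of the density gives that of `m`. -/

theorem MeasureTheory.Lp.ae_eq_of_integral_schwartz {f g : ℝ → ℂ} (hf : LocallyIntegrable f)
    (hg : LocallyIntegrable g) (h : ∀ φ : 𝓢(ℝ, ℂ), ∫ x, φ x * f x = ∫ x, φ x * g x) :
    f =ᵐ[volume] g := by
  refine ae_eq_of_integral_contDiff_smul_eq hf hg fun φ hφ hc => ?_
  have hφ' : ContDiff ℝ ∞ (fun x => (φ x : ℂ)) := Complex.ofRealCLM.contDiff.comp hφ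
  have hc' : HasCompactSupport (fun x => (φ x : ℂ)) := hc.comp_left (g := Complex.ofReal) rfl
  simpa using h (hc'.toSchwartzMap hφ')

/-- The transform on `L²` is an abstract extension. Both it and the integral define the same
tempered distribution, because each can be moved onto the test function. -/
theorem MeasureTheory.MemLp.fourier_toLp_ae_eq {u : ℝ → ℂ} (hu : MemLp u 2) (hi : Integrable u) :
    (𝓕 (hu.toLp u) : Lp ℂ 2 (volume : Measure ℝ)) =ᵐ[volume] 𝓕 u := by
  have hcont : Continuous (𝓕 u) :=
    VectorFourier.fourierIntegral_continuous Real.continuous_fourierChar (by fun_prop) hi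
  refine Lp.ae_eq_of_integral_schwartz
    ((Lp.memLp _).locallyIntegrable (by norm_num)) hcont.locallyIntegrable fun φ => ?_
  have h1 := congrArg (fun T => T φ) (Lp.fourier_toTemperedDistribution_eq (hu.toLp u))
  simp only [TemperedDistribution.fourier_apply, Lp.toTemperedDistribution_apply, smul_eq_mul] at h1
  rw [← h1]
  have h2 := VectorFourier.integral_fourierIntegral_smul_eq_flip (L := innerₗ ℝ) (μ := volume)
    (ν := volume) (f := u) (g := φ) Real.continuous_fourierChar (by fun_prop) hi φ.integrable
  have h3 : ∀ x, 𝓕 φ x * (hu.toLp u) x = (hu.toLp u) x * 𝓕 φ x := fun x => mul_comm _ _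
  rw [integral_congr_ae (g := fun x => u x * 𝓕 φ x)]
  · rw [flip_innerₗ] at h2
    refine Eq.trans h2.symm (integral_congr_ae (Eventually.of_forall fun x => ?_))
    simp only [smul_eq_mul]
    exact mul_comm _ _
  · filter_upwards [hu.coeFn_toLp] with x hx
    rw [hx, mul_comm]

theorem MeasureTheory.MemLp.fourierInv_toLp_ae_eq {u : ℝ → ℂ} (hu : MemLp u 2)
    (hi : Integrable u) :
    (𝓕⁻ (hu.toLp u) : Lp ℂ 2 (volume : Measure ℝ)) =ᵐ[volume] 𝓕⁻ u := by
  have hcont : Continuous (𝓕⁻ u) := by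
    have : Continuous (𝓕 u) :=
      VectorFourier.fourierIntegral_continuous Real.continuous_fourierChar (by fun_prop) hi
    have h2 : 𝓕⁻ u = fun x => 𝓕 u (-x) := by
      ext x; exact Real.fourierInv_eq_fourier_neg u x
    rw [h2]; fun_prop
  refine Lp.ae_eq_of_integral_schwartz
    ((Lp.memLp _).locallyIntegrable (by norm_num)) hcont.locallyIntegrable fun φ => ?_
  have h1 := congrArg (fun T => T φ) (Lp.fourierInv_toTemperedDistribution_eq (hu.toLp u))
  simp only [TemperedDistribution.fourierInv_apply, Lp.toTemperedDistribution_apply,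
    smul_eq_mul] at h1
  rw [← h1]
  -- The inverse transform is the Fourier integral for the negated bilinear form, which is again
  -- symmetric.
  have h2 := VectorFourier.integral_fourierIntegral_smul_eq_flip (L := -innerₗ ℝ) (μ := volume)
    (ν := volume) (f := u) (g := φ) Real.continuous_fourierChar (by
      simp only [LinearMap.neg_apply]; fun_prop) hi φ.integrable
  rw [integral_congr_ae (g := fun x => u x * 𝓕⁻ φ x)]
  · have hfl : (-innerₗ ℝ).flip = -innerₗ ℝ := by
      ext; simp
    rw [hfl] at h2
    rw [SchwartzMap.fourierInv_coe]
    refine Eq.trans h2.symm (integral_congr_ae (Eventually.of_forall fun x => ?_))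
    simp only [smul_eq_mul]
    exact mul_comm _ _
  · filter_upwards [hu.coeFn_toLp] with x hx
    rw [hx, mul_comm]

end FourierSquareIntegrable

/-! ### The Cauchy integral on the real line as a Fourier multiplier -/

section FlatCauchy

open FourierTransform

/-- The multiplier `1_{sξ > 0} exp(-2πε|ξ|)` of the Cauchy integral at height `ε`. -/
noncomputable def cauchyMultiplier (s ε ξ : ℝ) : ℂ :=
  if 0 < s * ξ then Real.exp (-(2 * Real.pi * ε * |ξ|)) else 0

theorem measurable_cauchyMultiplier (s ε : ℝ) : Measurable (cauchyMultiplier s ε) := by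
  refine Measurable.ite (measurableSet_lt measurable_const (by fun_prop)) (by fun_prop) (by fun_prop)

theorem norm_cauchyMultiplier_le (s : ℝ) {ε : ℝ} (hε : 0 ≤ ε) (ξ : ℝ) :
    ‖cauchyMultiplier s ε ξ‖ ≤ 1 := by
  unfold cauchyMultiplier
  split_ifs
  · rw [Complex.norm_real, Real.norm_eq_abs, Real.abs_exp, Real.exp_le_one_iff]
    have := Real.pi_pos
    have : 0 ≤ 2 * Real.pi * ε * |ξ| := by positivity
    linarith
  · simp

theorem tendsto_cauchyMultiplier (s ξ : ℝ) :
    Tendsto (fun ε => cauchyMultiplier s ε ξ) (𝓝[>] 0) (𝓝 (cauchyMultiplier s 0 ξ)) := by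
  have : Continuous fun ε => cauchyMultiplier s ε ξ := by
    unfold cauchyMultiplier
    split_ifs <;> fun_prop
  exact this.continuousAt.tendsto.mono_left nhdsWithin_le_nhds

theorem integrable_cauchyMultiplier {s ε : ℝ} (hε : 0 < ε) :
    Integrable (cauchyMultiplier s ε) := by
  have h : Integrable fun ξ : ℝ => Real.exp (-(2 * Real.pi * ε * |ξ|)) := by
    rw [← integrableOn_univ, ← Iic_union_Ioi (a := (0 : ℝ)), integrableOn_union]
    have hpi := Real.pi_pos
    constructor
    · refine (integrableOn_exp_mul_Iic (a := 2 * Real.pi * ε) (by positivity) 0).congr_fun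
        (fun ξ hξ => ?_) measurableSet_Iic
      simp [abs_of_nonpos (mem_Iic.1 hξ)]
    · refine (integrableOn_exp_mul_Ioi (a := -(2 * Real.pi * ε)) (by simp; positivity) 0).congr_fun
        (fun ξ hξ => ?_) measurableSet_Ioi
      simp [abs_of_pos (mem_Ioi.1 hξ)]
  refine h.mono (measurable_cauchyMultiplier s ε).aestronglyMeasurable
    (Eventually.of_forall fun ξ => ?_)
  unfold cauchyMultiplier
  split_ifs
  · rw [Complex.norm_real]
  · simp; positivity

/-- The multiplier lives on one half line, where the integrand is the exponential of a linear
function. The damping `ε > 0` makes it integrable and becomes the distance of the pole from the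
line. -/
theorem integral_cauchyMultiplier {s ε : ℝ} (hs : s = 1 ∨ s = -1) (hε : 0 < ε) (a : ℝ) :
    ∫ ξ : ℝ, cauchyMultiplier s ε ξ * Complex.exp (-(2 * Real.pi * a * ξ * Complex.I)) =
      1 / (s * (2 * Real.pi * Complex.I) * (a - Complex.I * s * ε)) := by
  have hpi := Real.pi_pos
  have hne : (a - Complex.I * s * ε : ℂ) ≠ 0 := by
    intro h
    have := congrArg Complex.im h
    rcases hs with rfl | rfl <;> simp at this <;> linarith
  rcases hs with rfl | rfl
  · have h1 : (fun ξ : ℝ => cauchyMultiplier 1 ε ξ *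
        Complex.exp (-(2 * Real.pi * a * ξ * Complex.I))) = (Ioi (0 : ℝ)).indicator
        fun ξ : ℝ => Complex.exp ((-(2 * Real.pi * ε) - 2 * Real.pi * a * Complex.I) * ξ) := by
      ext ξ
      by_cases h : 0 < ξ
      · simp only [cauchyMultiplier, one_mul, h, if_true, mem_Ioi, indicator_of_mem,
          Complex.ofReal_exp, ← Complex.exp_add, abs_of_pos h]
        congr 1; push_cast; ring
      · simp [cauchyMultiplier, h]
    rw [h1, integral_indicator measurableSet_Ioi, integral_exp_mul_complex_Ioi (by simp; positivity)]
    simp only [Complex.ofReal_zero, mul_zero, Complex.exp_zero, Complex.ofReal_one, mul_one, one_mul]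
      at hne ⊢
    rw [neg_div, ← div_neg]
    congr 1
    linear_combination (2 * Real.pi * ε : ℂ) * Complex.I_sq
  · have h1 : (fun ξ : ℝ => cauchyMultiplier (-1) ε ξ *
        Complex.exp (-(2 * Real.pi * a * ξ * Complex.I))) = (Iio (0 : ℝ)).indicator
        fun ξ : ℝ => Complex.exp ((2 * Real.pi * ε - 2 * Real.pi * a * Complex.I) * ξ) := by
      ext ξ
      by_cases h : ξ < 0
      · have h' : 0 < (-1) * ξ := by linarith
        simp only [cauchyMultiplier, h', if_true, mem_Iio, h, indicator_of_mem,
          Complex.ofReal_exp, ← Complex.exp_add, abs_of_neg h]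
        congr 1; push_cast; ring
      · have h' : ¬ 0 < (-1) * ξ := by linarith
        simp only [cauchyMultiplier, h', if_false, mem_Iio, h, not_false_eq_true,
          indicator_of_notMem, zero_mul]
    rw [h1, integral_indicator measurableSet_Iio, ← integral_Iic_eq_integral_Iio,
      integral_exp_mul_complex_Iic (by simp; positivity)]
    simp only [Complex.ofReal_zero, mul_zero, Complex.exp_zero, Complex.ofReal_neg,
      Complex.ofReal_one]
    congr 1
    linear_combination (2 * Real.pi * ε : ℂ) * Complex.I_sq

/-- The Cauchy kernel at the point `x + isε` is the Fourier transform of the damped half-line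
exponential, so the multiplication formula transfers the transform from the kernel to `u`. -/
theorem integral_div_sub_eq_fourierInv {u : ℝ → ℂ} (hi : Integrable u) {s ε : ℝ}
    (hs : s = 1 ∨ s = -1) (hε : 0 < ε) (x : ℝ) :
    ∫ y : ℝ, u y / (y - x - Complex.I * s * ε) =
      s * (2 * Real.pi * Complex.I) * 𝓕⁻ (fun ξ => cauchyMultiplier s ε ξ * 𝓕 u ξ) x := by
  have hg : Integrable fun ξ : ℝ =>
      cauchyMultiplier s ε ξ * Complex.exp (2 * Real.pi * x * ξ * Complex.I) := by
    refine (integrable_cauchyMultiplier (s := s) hε).mono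
      ((measurable_cauchyMultiplier s ε).mul (by fun_prop)).aestronglyMeasurable
      (Eventually.of_forall fun ξ => ?_)
    have : (2 * Real.pi * x * ξ * Complex.I : ℂ) = ((2 * Real.pi * x * ξ : ℝ) : ℂ) * Complex.I := by
      push_cast; ring
    rw [norm_mul, this, Complex.norm_exp_ofReal_mul_I, mul_one]
  have h2 := VectorFourier.integral_fourierIntegral_smul_eq_flip (L := innerₗ ℝ) (μ := volume)
    (ν := volume) (f := u) Real.continuous_fourierChar (by fun_prop) hi hg
  rw [flip_innerₗ] at h2
  have h3 : 𝓕⁻ (fun ξ => cauchyMultiplier s ε ξ * 𝓕 u ξ) x =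
      ∫ y : ℝ, u y * (1 / (s * (2 * Real.pi * Complex.I) * (y - x - Complex.I * s * ε))) := by
    rw [Real.fourierInv_eq']
    refine Eq.trans (integral_congr_ae (Eventually.of_forall fun ξ => ?_))
      (h2.trans (integral_congr_ae (Eventually.of_forall fun y => ?_)))
    · simp only [smul_eq_mul, RCLike.inner_apply, conj_trivial]
      rw [mul_comm, mul_comm (cauchyMultiplier s ε ξ), mul_assoc]
      congr 2
      congr 1; push_cast; ring
    · simp only [smul_eq_mul]
      congr 1
      have h4 := integral_cauchyMultiplier hs hε (y - x)
      rw [Complex.ofReal_sub] at h4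
      rw [← h4]
      refine Eq.trans (Real.fourier_eq' _ y) (integral_congr_ae (Eventually.of_forall fun ξ => ?_))
      simp only [smul_eq_mul, RCLike.inner_apply, conj_trivial]
      rw [mul_comm, mul_assoc, ← Complex.exp_add]
      congr 2; push_cast; ring
  rw [h3, ← integral_const_mul]
  refine integral_congr_ae (Eventually.of_forall fun y => ?_)
  have hpi : (Real.pi : ℂ) ≠ 0 := by exact_mod_cast Real.pi_ne_zero
  have hs0 : (s : ℂ) ≠ 0 := by rcases hs with rfl | rfl <;> simp
  have hne : (y - x - Complex.I * s * ε : ℂ) ≠ 0 := by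
    intro h
    have := congrArg Complex.im h
    rcases hs with rfl | rfl <;> simp at this <;> linarith
  have := Complex.I_ne_zero
  simp only
  field_simp

end FlatCauchy

theorem MeasureTheory.tendsto_eLpNorm_two_of_dominated {α ι E : Type*} [MeasurableSpace α]
    {μ : Measure α} [NormedAddCommGroup E] {l : Filter ι} [l.IsCountablyGenerated]
    {F : ι → α → E} {f : α → E} (g : α → ℝ) (hF : ∀ᶠ i in l, AEStronglyMeasurable (F i) μ)
    (hf : AEStronglyMeasurable f μ) (hg : MemLp g 2 μ)
    (hb : ∀ᶠ i in l, ∀ᵐ x ∂μ, ‖F i x - f x‖ ≤ g x)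
    (hlim : ∀ᵐ x ∂μ, Tendsto (fun i => F i x) l (𝓝 (f x))) :
    Tendsto (fun i => eLpNorm (fun x => F i x - f x) 2 μ) l (𝓝 0) := by
  have key : Tendsto (fun i => ∫⁻ x, ‖F i x - f x‖ₑ ^ (2 : ℝ) ∂μ) l (𝓝 (∫⁻ _, 0 ∂μ)) := by
    refine tendsto_lintegral_filter_of_dominated_convergence' (fun x => ‖g x‖ₑ ^ (2 : ℝ)) ?_ ?_ ?_ ?_
    · filter_upwards [hF] with i hi
      exact (hi.sub hf).enorm.pow_const _
    · filter_upwards [hb] with i hi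
      filter_upwards [hi] with x hx
      gcongr
      exact enorm_le_iff_norm_le.2 (hx.trans (le_abs_self _))
    · have := hg.eLpNorm_ne_top
      rw [eLpNorm_eq_lintegral_rpow_enorm_toReal (by norm_num) (by norm_num)] at this
      simp only [ENNReal.toReal_ofNat] at this
      intro h
      rw [h] at this
      simp at this
    · filter_upwards [hlim] with x hx
      have h1 : Tendsto (fun i => ‖F i x - f x‖ₑ) l (𝓝 0) := by
        have := (hx.sub_const (f x)).enorm
        simpa using this
      have := h1.ennrpow_const (2 : ℝ)
      simpa using this
  have h2 := key.ennrpow_const (1 / 2 : ℝ)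
  simp only [lintegral_const, zero_mul] at h2
  rw [ENNReal.zero_rpow_of_pos (by norm_num)] at h2
  refine h2.congr fun i => ?_
  rw [eLpNorm_eq_lintegral_rpow_enorm_toReal (by norm_num) (by norm_num)]
  simp

/-! ### Boundary values of the Cauchy integral on the line -/

section FlatCauchyBoundary

open FourierTransform

/-- Under Plancherel the limit `ε → 0` is dominated convergence of multipliers bounded by one. The
limits are `±2πi` times the projections onto positive and negative frequencies, hence the bound
`2π`. -/
theorem exists_boundary_integral_div_sub {u : ℝ → ℂ} (hu : MemLp u 2) (hi : Integrable u) :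
    ∃ v : ℝ → ℝ → ℂ, (∀ s : ℝ, s = 1 ∨ s = -1 → MemLp (v s) 2 ∧
        eLpNorm (v s) 2 ≤ ENNReal.ofReal (2 * Real.pi) * eLpNorm u 2 ∧
        Tendsto (fun ε : ℝ => eLpNorm
          (fun x : ℝ => (∫ y : ℝ, u y / (y - x - Complex.I * s * ε)) - v s x) 2) (𝓝[>] 0) (𝓝 0)) ∧
      ∀ᵐ x, v 1 x - v (-1) x = 2 * Real.pi * Complex.I * u x := by
  have hU : MemLp (𝓕 u) 2 := (Lp.memLp (𝓕 (hu.toLp u) : Lp ℂ 2 (volume : Measure ℝ))).ae_eq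
    (hu.fourier_toLp_ae_eq hi)
  have hUnorm : eLpNorm (𝓕 u) 2 = eLpNorm u 2 := by
    rw [← eLpNorm_congr_ae (hu.fourier_toLp_ae_eq hi), ← Lp.enorm_def, ← eLpNorm_congr_ae hu.coeFn_toLp,
      ← Lp.enorm_def, enorm_eq_iff_norm_eq, Lp.norm_fourier_eq]
  have hle : ∀ s ε : ℝ, 0 ≤ ε → ∀ ξ, ‖cauchyMultiplier s ε ξ * 𝓕 u ξ‖ ≤ ‖𝓕 u ξ‖ := by
    intro s ε hε ξ
    rw [norm_mul]
    exact mul_le_of_le_one_left (norm_nonneg _) (norm_cauchyMultiplier_le s hε ξ)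
  have hG : ∀ s ε : ℝ, 0 ≤ ε → MemLp (fun ξ => cauchyMultiplier s ε ξ * 𝓕 u ξ) 2 := fun s ε hε =>
    hU.mono ((measurable_cauchyMultiplier s ε).aestronglyMeasurable.mul hU.1)
      (Eventually.of_forall (hle s ε hε))
  set V : ℝ → Lp ℂ 2 (volume : Measure ℝ) := fun s =>
    ((s : ℂ) * (2 * Real.pi * Complex.I)) • 𝓕⁻ ((hG s 0 le_rfl).toLp _) with hV
  have hpi := Real.pi_pos
  have hc : ∀ s : ℝ, s = 1 ∨ s = -1 →
      ‖(s : ℂ) * (2 * Real.pi * Complex.I)‖ₑ = ENNReal.ofReal (2 * Real.pi) := by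
    intro s hs
    rw [← ofReal_norm]
    congr 1
    rcases hs with rfl | rfl <;> simp [abs_of_pos hpi]
  refine ⟨fun s => V s, fun s hs => ⟨Lp.memLp _, ?_, ?_⟩, ?_⟩
  · rw [← Lp.enorm_def, hV]
    simp only [enorm_smul, hc s hs]
    gcongr
    rw [← hUnorm]
    have : ‖𝓕⁻ ((hG s 0 le_rfl).toLp _)‖ₑ = ‖(hG s 0 le_rfl).toLp _‖ₑ :=
      enorm_eq_iff_norm_eq.2 ((Lp.fourierTransformₗᵢ ℝ ℂ).symm.norm_map _)
    rw [this, Lp.enorm_toLp]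
    exact eLpNorm_mono (hle s 0 le_rfl)
  · have hlim : Tendsto (fun ε : ℝ => ENNReal.ofReal (2 * Real.pi) * eLpNorm (fun ξ =>
        cauchyMultiplier s ε ξ * 𝓕 u ξ - cauchyMultiplier s 0 ξ * 𝓕 u ξ) 2) (𝓝[>] 0) (𝓝 0) := by
      rw [← mul_zero (ENNReal.ofReal (2 * Real.pi))]
      refine ENNReal.Tendsto.const_mul ?_ (Or.inr ENNReal.ofReal_ne_top)
      refine tendsto_eLpNorm_two_of_dominated (fun ξ => 2 * ‖𝓕 u ξ‖) ?_ (hG s 0 le_rfl).1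
        (hU.norm.const_mul 2) ?_ ?_
      · filter_upwards [self_mem_nhdsWithin] with ε hε
        exact (hG s ε (le_of_lt hε)).1
      · filter_upwards [self_mem_nhdsWithin] with ε hε
        refine Eventually.of_forall fun ξ => (norm_sub_le _ _).trans ?_
        linarith [hle s ε (le_of_lt hε) ξ, hle s 0 le_rfl ξ]
      · exact Eventually.of_forall fun ξ => (tendsto_cauchyMultiplier s ξ).mul_const _
    refine hlim.congr' ?_
    filter_upwards [self_mem_nhdsWithin] with ε (hε : 0 < ε)
    -- For `ε > 0` the multiplier is integrable and bounded by one, hence square integrable. Its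
    -- product with an `L²` function is therefore integrable, and the inverse transform is a genuine
    -- integral.
    have hint : Integrable fun ξ => cauchyMultiplier s ε ξ * 𝓕 u ξ := by
      have hm : MemLp (cauchyMultiplier s ε) 2 := by
        refine (memLp_two_iff_integrable_sq_norm
          (measurable_cauchyMultiplier s ε).aestronglyMeasurable).2 ?_
        refine (integrable_cauchyMultiplier (s := s) hε).norm.mono
          ((measurable_cauchyMultiplier s ε).norm.pow_const 2).aestronglyMeasurable
          (Eventually.of_forall fun ξ => ?_)
        have := norm_cauchyMultiplier_le s hε.le ξ
        rw [Real.norm_eq_abs, Real.norm_eq_abs, abs_of_nonneg (by positivity), abs_norm]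
        nlinarith [norm_nonneg (cauchyMultiplier s ε ξ)]
      exact hm.integrable_mul hU
    have heq : (fun x : ℝ => (∫ y : ℝ, u y / (y - x - Complex.I * s * ε)) - V s x) =ᵐ[volume]
        ((s : ℂ) * (2 * Real.pi * Complex.I)) •
          (𝓕⁻ ((hG s ε hε.le).toLp _ - (hG s 0 le_rfl).toLp _) : Lp ℂ 2 (volume : Measure ℝ)) := by
      have h1 := (hG s ε hε.le).fourierInv_toLp_ae_eq hint
      have h2 : (𝓕⁻ ((hG s ε hε.le).toLp _ - (hG s 0 le_rfl).toLp _) : Lp ℂ 2 (volume : Measure ℝ))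
          = 𝓕⁻ ((hG s ε hε.le).toLp _) - 𝓕⁻ ((hG s 0 le_rfl).toLp _) :=
        (Lp.fourierTransformₗᵢ ℝ ℂ).symm.map_sub _ _
      rw [h2]
      filter_upwards [h1, Lp.coeFn_sub (𝓕⁻ ((hG s ε hε.le).toLp _))
        (𝓕⁻ ((hG s 0 le_rfl).toLp _)), Lp.coeFn_smul ((s : ℂ) * (2 * Real.pi * Complex.I))
        (𝓕⁻ ((hG s 0 le_rfl).toLp _) : Lp ℂ 2 (volume : Measure ℝ))] with x hx1 hx2 hx3
      rw [integral_div_sub_eq_fourierInv hi hs hε, hV]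
      simp only [Pi.smul_apply] at hx3 ⊢
      rw [hx3, hx2, ← hx1]
      simp only [Pi.sub_apply, smul_eq_mul]
      ring
    rw [eLpNorm_congr_ae heq, eLpNorm_const_smul, hc s hs, ← Lp.enorm_def]
    congr 1
    have : ‖𝓕⁻ ((hG s ε hε.le).toLp _ - (hG s 0 le_rfl).toLp _)‖ₑ
        = ‖(hG s ε hε.le).toLp _ - (hG s 0 le_rfl).toLp _‖ₑ :=
      enorm_eq_iff_norm_eq.2 ((Lp.fourierTransformₗᵢ ℝ ℂ).symm.norm_map _)
    rw [this, ← MemLp.toLp_sub, Lp.enorm_toLp]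
    rfl
  -- The two frequency projections add up to the identity, since the single frequency `0` is
  -- negligible. With the factors `±2πi` this sum becomes the jump.
  · have hsum : (hG 1 0 le_rfl).toLp _ + (hG (-1) 0 le_rfl).toLp _ = 𝓕 (hu.toLp u) := by
      rw [← MemLp.toLp_add]
      refine Lp.ext ?_
      have h0 : ∀ᵐ ξ : ℝ, ξ ≠ 0 := by simp [ae_iff]
      filter_upwards [MemLp.coeFn_toLp ((hG 1 0 le_rfl).add (hG (-1) 0 le_rfl)),
        hu.fourier_toLp_ae_eq hi, h0] with ξ h1 h2 h3
      rw [h1, h2]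
      rcases lt_or_gt_of_ne h3 with h | h
      · simp [cauchyMultiplier, h, not_lt.2 h.le]
      · simp [cauchyMultiplier, h, not_lt.2 h.le]
    have hdiff : V 1 - V (-1) = (2 * Real.pi * Complex.I : ℂ) • hu.toLp u := by
      have h1 : hu.toLp u = 𝓕⁻ (𝓕 (hu.toLp u)) := (FourierPair.fourierInv_fourier_eq _).symm
      have h2 : 𝓕⁻ ((hG 1 0 le_rfl).toLp _ + (hG (-1) 0 le_rfl).toLp _)
          = 𝓕⁻ ((hG 1 0 le_rfl).toLp _) + 𝓕⁻ ((hG (-1) 0 le_rfl).toLp _) :=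
        (Lp.fourierTransformₗᵢ ℝ ℂ).symm.map_add _ _
      rw [h1, ← hsum, h2, hV]
      simp only [Complex.ofReal_one, Complex.ofReal_neg]
      module
    filter_upwards [Lp.coeFn_sub (V 1) (V (-1)), hu.coeFn_toLp,
      Lp.coeFn_smul (2 * Real.pi * Complex.I : ℂ) (hu.toLp u)] with x h1 h2 h3
    rw [hdiff] at h1
    rw [← Pi.sub_apply, ← h1, h3, Pi.smul_apply, h2, smul_eq_mul]

end FlatCauchyBoundary

/-! ### Schur's test and Hilbert's inequality -/

section SchurTest

variable {α β : Type*} [MeasurableSpace α] [MeasurableSpace β] {μ : Measure α} {ν : Measure β}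

/-- Factor `K u = (K q)^(1/2) (K u² / q)^(1/2)` and apply Cauchy–Schwarz. The first factor is
controlled by the bound on `K q`; after exchanging the integrals the second is controlled by the
bound on the adjoint applied to `p`. -/
theorem lintegral_sq_lintegral_mul_le_of_schur [SFinite μ] [SFinite ν] {K : α → β → ℝ≥0∞}
    (hK : Measurable (Function.uncurry K)) {p : α → ℝ≥0∞} {q : β → ℝ≥0∞} (hp : Measurable p)
    (hq : Measurable q) (hq0 : ∀ᵐ y ∂ν, q y ≠ 0 ∧ q y ≠ ⊤) {A B : ℝ≥0∞}
    (hA : ∀ᵐ x ∂μ, ∫⁻ y, K x y * q y ∂ν ≤ A * p x) (hB : ∀ᵐ y ∂ν, ∫⁻ x, K x y * p x ∂μ ≤ B * q y)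
    {u : β → ℝ≥0∞} (hu : AEMeasurable u ν) :
    ∫⁻ x, (∫⁻ y, K x y * u y ∂ν) ^ 2 ∂μ ≤ A * B * ∫⁻ y, u y ^ 2 ∂ν := by
  wlog hu' : Measurable u generalizing u
  · have h1 : ∀ x, ∫⁻ y, K x y * u y ∂ν = ∫⁻ y, K x y * hu.mk u y ∂ν := fun x =>
      lintegral_congr_ae (by filter_upwards [hu.ae_eq_mk] with y hy; rw [hy])
    have h2 : ∫⁻ y, u y ^ 2 ∂ν = ∫⁻ y, hu.mk u y ^ 2 ∂ν :=
      lintegral_congr_ae (by filter_upwards [hu.ae_eq_mk] with y hy; rw [hy])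
    simp_rw [h1, h2]
    exact this hu.measurable_mk.aemeasurable hu.measurable_mk
  have hKx : ∀ x, Measurable (K x) := fun x => hK.of_uncurry_left
  have hKy : ∀ y, Measurable fun x => K x y := fun y => hK.of_uncurry_right
  have step : ∀ x, (∫⁻ y, K x y * u y ∂ν) ^ 2 ≤
      (∫⁻ y, K x y * q y ∂ν) * ∫⁻ y, K x y * (u y ^ 2 * (q y)⁻¹) ∂ν := by
    intro x
    have h1 : ∫⁻ y, K x y * u y ∂ν =
        ∫⁻ y, (K x y * q y) ^ (1 / 2 : ℝ) * (K x y * (u y ^ 2 * (q y)⁻¹)) ^ (1 / 2 : ℝ) ∂ν := by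
      refine lintegral_congr_ae ?_
      filter_upwards [hq0] with y hy
      rw [← ENNReal.mul_rpow_of_nonneg _ _ (by norm_num : (0 : ℝ) ≤ 1 / 2)]
      have : K x y * q y * (K x y * (u y ^ 2 * (q y)⁻¹)) = (K x y * u y) ^ (2 : ℝ) := by
        rw [ENNReal.rpow_two]
        calc _ = (K x y * u y) ^ 2 * (q y * (q y)⁻¹) := by ring
          _ = _ := by rw [ENNReal.mul_inv_cancel hy.1 hy.2, mul_one]
      rw [this, ← ENNReal.rpow_mul]
      norm_num
    have h2 := ENNReal.lintegral_mul_norm_pow_le (μ := ν) (f := fun y => K x y * q y)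
      (g := fun y => K x y * (u y ^ 2 * (q y)⁻¹)) ((hKx x).mul hq).aemeasurable
      ((hKx x).mul ((hu'.pow_const 2).mul hq.inv)).aemeasurable
      (by norm_num : (0 : ℝ) ≤ 1 / 2) (by norm_num : (0 : ℝ) ≤ 1 / 2) (by norm_num)
    rw [← h1] at h2
    calc _ ≤ ((∫⁻ y, K x y * q y ∂ν) ^ (1 / 2 : ℝ) *
          (∫⁻ y, K x y * (u y ^ 2 * (q y)⁻¹) ∂ν) ^ (1 / 2 : ℝ)) ^ 2 := by gcongr
      _ = _ := by
        rw [mul_pow, ← ENNReal.rpow_two, ← ENNReal.rpow_two, ← ENNReal.rpow_mul,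
          ← ENNReal.rpow_mul]
        norm_num
  have hmeas : Measurable fun z : α × β => p z.1 * (K z.1 z.2 * (u z.2 ^ 2 * (q z.2)⁻¹)) :=
    (hp.comp measurable_fst).mul (hK.mul (((hu'.pow_const 2).mul hq.inv).comp measurable_snd))
  calc ∫⁻ x, (∫⁻ y, K x y * u y ∂ν) ^ 2 ∂μ
      ≤ ∫⁻ x, A * ∫⁻ y, p x * (K x y * (u y ^ 2 * (q y)⁻¹)) ∂ν ∂μ := by
        refine lintegral_mono_ae ?_
        filter_upwards [hA] with x hx
        refine (step x).trans ?_
        rw [lintegral_const_mul (p x) (f := fun y => K x y * (u y ^ 2 * (q y)⁻¹))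
          ((hKx x).mul ((hu'.pow_const 2).mul hq.inv)), ← mul_assoc]
        gcongr
    _ = A * ∫⁻ x, ∫⁻ y, p x * (K x y * (u y ^ 2 * (q y)⁻¹)) ∂ν ∂μ :=
        lintegral_const_mul _ hmeas.lintegral_prod_right'
    _ = A * ∫⁻ y, ∫⁻ x, p x * (K x y * (u y ^ 2 * (q y)⁻¹)) ∂μ ∂ν := by
        rw [lintegral_lintegral_swap hmeas.aemeasurable]
    _ ≤ A * ∫⁻ y, B * u y ^ 2 ∂ν := by
        refine mul_le_mul_right (lintegral_mono_ae ?_) _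
        filter_upwards [hB, hq0] with y hy hqy
        calc ∫⁻ x, p x * (K x y * (u y ^ 2 * (q y)⁻¹)) ∂μ
            = ∫⁻ x, (u y ^ 2 * (q y)⁻¹) * (K x y * p x) ∂μ := by
              congr 1; ext x; ring
          _ = (u y ^ 2 * (q y)⁻¹) * ∫⁻ x, K x y * p x ∂μ :=
              lintegral_const_mul _ ((hKy y).mul hp)
          _ ≤ (u y ^ 2 * (q y)⁻¹) * (B * q y) := by gcongr
          _ = B * u y ^ 2 * (q y * (q y)⁻¹) := by ring
          _ = _ := by rw [ENNReal.mul_inv_cancel hqy.1 hqy.2, mul_one]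
    _ = _ := by rw [lintegral_const_mul _ (hu'.pow_const 2), mul_assoc]

end SchurTest

section HilbertKernel

/-- Split at `y = c`: bound `1 / (c + y)` by `1 / c` below and by `1 / y` above. Each part
contributes `2 c^(-1/2)`. -/
theorem lintegral_Ioi_inv_add_mul_rpow_le {c : ℝ} (hc : 0 < c) :
    ∫⁻ y in Ioi (0 : ℝ), (ENNReal.ofReal (c + y))⁻¹ * ENNReal.ofReal (y ^ (-1 / 2 : ℝ)) ≤
      ENNReal.ofReal (4 * c ^ (-1 / 2 : ℝ)) := by
  have hle : ∀ y : ℝ, 0 < y → ∀ d : ℝ, 0 < d → d ≤ c + y →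
      (ENNReal.ofReal (c + y))⁻¹ * ENNReal.ofReal (y ^ (-1 / 2 : ℝ)) ≤
        ENNReal.ofReal (d⁻¹ * y ^ (-1 / 2 : ℝ)) := by
    intro y hy d hd hdy
    rw [ENNReal.ofReal_mul (by positivity), ENNReal.ofReal_inv_of_pos hd]
    gcongr
  have h1 : ∫⁻ y in Ioc 0 c, (ENNReal.ofReal (c + y))⁻¹ * ENNReal.ofReal (y ^ (-1 / 2 : ℝ)) ≤
      ENNReal.ofReal (2 * c ^ (-1 / 2 : ℝ)) := by
    refine (setLIntegral_mono' measurableSet_Ioc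
      (fun y hy => hle y hy.1 c hc (by linarith [hy.1]))).trans ?_
    have hint : IntegrableOn (fun y : ℝ => c⁻¹ * y ^ (-1 / 2 : ℝ)) (Ioc 0 c) :=
      ((intervalIntegral.intervalIntegrable_rpow' (by norm_num)).1).const_mul _
    rw [← ofReal_integral_eq_lintegral_ofReal hint]
    · apply ENNReal.ofReal_le_ofReal
      rw [← intervalIntegral.integral_of_le hc.le, intervalIntegral.integral_const_mul,
        integral_rpow (Or.inl (by norm_num)), Real.zero_rpow (by norm_num)]
      have : c ^ (-1 / 2 + 1 : ℝ) = c ^ (-1 / 2 : ℝ) * c := by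
        rw [Real.rpow_add hc, Real.rpow_one]
      rw [this]
      apply le_of_eq
      field_simp
      norm_num
    · filter_upwards [ae_restrict_mem measurableSet_Ioc] with y hy
      have := hy.1
      positivity
  have h2 : ∫⁻ y in Ioi c, (ENNReal.ofReal (c + y))⁻¹ * ENNReal.ofReal (y ^ (-1 / 2 : ℝ)) ≤
      ENNReal.ofReal (2 * c ^ (-1 / 2 : ℝ)) := by
    have : ∀ y ∈ Ioi c, (ENNReal.ofReal (c + y))⁻¹ * ENNReal.ofReal (y ^ (-1 / 2 : ℝ)) ≤
        ENNReal.ofReal (y ^ (-3 / 2 : ℝ)) := by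
      intro y hy
      have hy0 : 0 < y := hc.trans hy
      refine (hle y hy0 y hy0 (by linarith)).trans (le_of_eq ?_)
      rw [← Real.rpow_neg_one, ← Real.rpow_add hy0]
      norm_num
    refine (setLIntegral_mono' measurableSet_Ioi this).trans ?_
    rw [← ofReal_integral_eq_lintegral_ofReal (integrableOn_Ioi_rpow_of_lt (by norm_num) hc)]
    · rw [integral_Ioi_rpow_of_lt (by norm_num) hc]
      apply ENNReal.ofReal_le_ofReal
      norm_num
      linarith
    · filter_upwards [ae_restrict_mem measurableSet_Ioi] with y hy
      have := hc.trans hy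
      positivity
  rw [← Ioc_union_Ioi_eq_Ioi hc.le, lintegral_union measurableSet_Ioi
    (Ioc_disjoint_Ioi le_rfl)]
  refine (add_le_add h1 h2).trans ?_
  rw [← ENNReal.ofReal_add (by positivity) (by positivity)]
  apply ENNReal.ofReal_le_ofReal
  linarith

theorem lintegral_inv_add_abs_mul_rpow_le {c : ℝ} (hc : 0 < c) :
    ∫⁻ y : ℝ, (ENNReal.ofReal (c + |y|))⁻¹ * ENNReal.ofReal (|y| ^ (-1 / 2 : ℝ)) ≤
      8 * ENNReal.ofReal (c ^ (-1 / 2 : ℝ)) := by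
  set f : ℝ → ℝ≥0∞ := fun y => (ENNReal.ofReal (c + y))⁻¹ * ENNReal.ofReal (y ^ (-1 / 2 : ℝ))
  have hpos : ∫⁻ y in Ioi (0 : ℝ), f |y| ≤ ENNReal.ofReal (4 * c ^ (-1 / 2 : ℝ)) := by
    refine le_trans (le_of_eq ?_) (lintegral_Ioi_inv_add_mul_rpow_le hc)
    exact setLIntegral_congr_fun measurableSet_Ioi fun y hy => by
      simp only [f, abs_of_pos (mem_Ioi.1 hy)]
  have hneg : ∫⁻ y in Iio (0 : ℝ), f |y| = ∫⁻ y in Ioi (0 : ℝ), f |y| := by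
    have := (Measure.measurePreserving_neg (volume : Measure ℝ)).setLIntegral_comp_preimage_emb
      (MeasurableEquiv.neg ℝ).measurableEmbedding (fun y => f |y|) (Ioi 0)
    simpa using this
  calc ∫⁻ y, f |y| = (∫⁻ y in Iio (0 : ℝ), f |y|) + ∫⁻ y in Ioi (0 : ℝ), f |y| := by
        rw [← lintegral_add_compl _ (measurableSet_Iio (a := (0 : ℝ))), compl_Iio,
          setLIntegral_congr Ioi_ae_eq_Ici]
    _ ≤ ENNReal.ofReal (4 * c ^ (-1 / 2 : ℝ)) + ENNReal.ofReal (4 * c ^ (-1 / 2 : ℝ)) := by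
        rw [hneg]; gcongr
    _ = _ := by
        rw [← ENNReal.ofReal_add (by positivity) (by positivity)]
        rw [show (8 : ℝ≥0∞) = ENNReal.ofReal 8 by norm_num, ← ENNReal.ofReal_mul (by norm_num)]
        congr 1; ring

/-- Hilbert's inequality for the kernel `1 / (|x - a| + |y - b|)`. -/
theorem lintegral_sq_hilbert_le (a b : ℝ) {u : ℝ → ℝ≥0∞} (hu : AEMeasurable u) :
    ∫⁻ x, (∫⁻ y, (ENNReal.ofReal (|x - a| + |y - b|))⁻¹ * u y) ^ 2 ≤ 64 * ∫⁻ y, u y ^ 2 := by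
  have hne : ∀ b : ℝ, ∀ᵐ y : ℝ, 0 < |y - b| := by
    intro b
    have : ∀ᵐ y : ℝ, y ≠ b := by simp [ae_iff]
    filter_upwards [this] with y hy
    exact abs_pos.2 (sub_ne_zero.2 hy)
  have key : ∀ c b : ℝ, 0 < c → ∫⁻ y : ℝ, (ENNReal.ofReal (c + |y - b|))⁻¹ *
      ENNReal.ofReal (|y - b| ^ (-1 / 2 : ℝ)) ≤ 8 * ENNReal.ofReal (c ^ (-1 / 2 : ℝ)) := by
    intro c b hc
    refine le_trans (le_of_eq ?_) (lintegral_inv_add_abs_mul_rpow_le hc)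
    exact lintegral_sub_right_eq_self (fun y : ℝ => (ENNReal.ofReal (c + |y|))⁻¹ *
      ENNReal.ofReal (|y| ^ (-1 / 2 : ℝ))) b
  -- The weights are the inverse square roots of the distances to the centres. They reproduce
  -- themselves with constant `8` in either variable, and `64 = 8 * 8`.
  have := lintegral_sq_lintegral_mul_le_of_schur (μ := (volume : Measure ℝ))
    (ν := (volume : Measure ℝ)) (K := fun x y => (ENNReal.ofReal (|x - a| + |y - b|))⁻¹)
    (by unfold Function.uncurry; fun_prop) (p := fun x => ENNReal.ofReal (|x - a| ^ (-1 / 2 : ℝ)))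
    (q := fun y => ENNReal.ofReal (|y - b| ^ (-1 / 2 : ℝ))) (by fun_prop) (by fun_prop)
    (by
      filter_upwards [hne b] with y hy
      exact ⟨by simpa using Real.rpow_pos_of_pos hy _, ENNReal.ofReal_ne_top⟩)
    (A := 8) (B := 8)
    (by filter_upwards [hne a] with x hx using key _ b hx)
    (by
      filter_upwards [hne b] with y hy
      simpa only [add_comm] using key _ a hy) hu
  refine this.trans (le_of_eq ?_)
  norm_num

end HilbertKernel

/-! ### Families of kernels on the unit interval -/

/-- Lebesgue measure on the parameter interval `[0, 1]`. -/
noncomputable abbrev unitMeasure : Measure ℝ := volume.restrict (Icc (0 : ℝ) 1)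

/-- The constant `8 = √64` is independent of the centre `(a, b)`, so the centre may move with `ε`
without harming uniform bounds. -/
theorem eLpNorm_hilbert_le (a b : ℝ) {u : ℝ → ℂ} (hu : AEStronglyMeasurable u unitMeasure) :
    eLpNorm (fun x => ∫⁻ y, (ENNReal.ofReal (|x - a| + |y - b|))⁻¹ * ‖u y‖ₑ ∂unitMeasure) 2
      unitMeasure ≤ 8 * eLpNorm u 2 unitMeasure := by
  have h1 := lintegral_sq_hilbert_le a b (u := (Icc (0 : ℝ) 1).indicator fun y => ‖u y‖ₑ)
    ((aemeasurable_indicator_iff measurableSet_Icc).2 hu.enorm)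
  have h2 : ∀ x, ∫⁻ y, (ENNReal.ofReal (|x - a| + |y - b|))⁻¹ *
      (Icc (0 : ℝ) 1).indicator (fun y => ‖u y‖ₑ) y =
      ∫⁻ y, (ENNReal.ofReal (|x - a| + |y - b|))⁻¹ * ‖u y‖ₑ ∂unitMeasure := by
    intro x
    rw [← lintegral_indicator measurableSet_Icc]
    congr 1; ext y
    by_cases hy : y ∈ Icc (0 : ℝ) 1 <;> simp [hy]
  have h3 : ∫⁻ y, (Icc (0 : ℝ) 1).indicator (fun y => ‖u y‖ₑ) y ^ 2 =
      ∫⁻ y, ‖u y‖ₑ ^ 2 ∂unitMeasure := by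
    rw [← lintegral_indicator measurableSet_Icc]
    congr 1; ext y
    by_cases hy : y ∈ Icc (0 : ℝ) 1 <;> simp [hy]
  simp_rw [h2, h3] at h1
  have h4 : ∫⁻ x, (∫⁻ y, (ENNReal.ofReal (|x - a| + |y - b|))⁻¹ * ‖u y‖ₑ ∂unitMeasure) ^ 2
      ∂unitMeasure ≤ 8 ^ (2 : ℝ) * ∫⁻ y, ‖u y‖ₑ ^ 2 ∂unitMeasure := by
    refine (setLIntegral_le_lintegral _ _).trans (h1.trans (le_of_eq ?_))
    norm_num
  rw [eLpNorm_eq_lintegral_rpow_enorm_toReal (by norm_num) (by norm_num),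
    eLpNorm_eq_lintegral_rpow_enorm_toReal (by norm_num) (by norm_num)]
  simp only [enorm_eq_self, ENNReal.toReal_ofNat, ENNReal.rpow_two]
  refine (ENNReal.rpow_le_rpow h4 (by norm_num : (0 : ℝ) ≤ 1 / 2)).trans (le_of_eq ?_)
  rw [ENNReal.mul_rpow_of_nonneg _ _ (by norm_num), ← ENNReal.rpow_mul]
  norm_num

/-- On `V`, the kernels `R ε` are dominated by a bounded number of kernels of Hilbert type,
uniformly for small `ε ≥ 0`. -/
def HilbertBoundOn (R : ℝ → ℝ → ℝ → ℂ) (V : Set (ℝ × ℝ)) : Prop :=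
  ∃ (C : ℝ) (N : ℕ), ∃ r > 0, ∀ ε, 0 ≤ ε → ε < r → ∃ p : Fin N → ℝ × ℝ, ∀ z ∈ V, ∃ k,
    ‖R ε z.1 z.2‖ * (|z.1 - (p k).1| + |z.2 - (p k).2|) ≤ C

namespace HilbertBoundOn

variable {R : ℝ → ℝ → ℝ → ℂ} {V W : Set (ℝ × ℝ)}

theorem union (hV : HilbertBoundOn R V) (hW : HilbertBoundOn R W) : HilbertBoundOn R (V ∪ W) := by
  obtain ⟨C, N, r, hr, h⟩ := hV
  obtain ⟨C', N', r', hr', h'⟩ := hW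
  refine ⟨max C C', N + N', min r r', lt_min hr hr', fun ε h0 hε => ?_⟩
  obtain ⟨p, hp⟩ := h ε h0 (hε.trans_le (min_le_left _ _))
  obtain ⟨p', hp'⟩ := h' ε h0 (hε.trans_le (min_le_right _ _))
  refine ⟨Fin.append p p', fun z hz => ?_⟩
  rcases hz with hz | hz
  · obtain ⟨k, hk⟩ := hp z hz
    exact ⟨Fin.castAdd N' k, by simpa using Or.inl hk⟩
  · obtain ⟨k, hk⟩ := hp' z hz
    exact ⟨Fin.natAdd N k, by simpa using Or.inr hk⟩

/-- The property passes to subsets and finite unions, so on a compact set it is local. Only the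
number of centres is fixed; their positions may depend on `ε`. -/
theorem of_isCompact {S : Set (ℝ × ℝ)} (hS : IsCompact S)
    (h : ∀ z ∈ S, ∃ U ∈ 𝓝 z, HilbertBoundOn R (U ∩ S)) : HilbertBoundOn R S := by
  refine hS.induction_on (p := HilbertBoundOn R) ⟨0, 0, 1, one_pos, fun _ _ _ => ⟨Fin.elim0, by simp⟩⟩
    ?_ (fun _ _ => union) fun z hz => ?_
  · rintro s t hst ⟨C, N, r, hr, h⟩
    exact ⟨C, N, r, hr, fun ε h0 hε => (h ε h0 hε).imp fun p hp z hz => hp z (hst hz)⟩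
  · obtain ⟨U, hU, hb⟩ := h z hz
    exact ⟨U ∩ S, inter_mem (mem_nhdsWithin_of_mem_nhds hU) self_mem_nhdsWithin, hb⟩

end HilbertBoundOn

/-- The integral operator on `[0, 1]` with a given kernel. -/
noncomputable def kernelOp (k : ℝ → ℝ → ℂ) (u : ℝ → ℂ) (x : ℝ) : ℂ := ∫ y, k x y * u y ∂unitMeasure

/-- Pointwise the kernel is at most a multiple of the sum of `N` Hilbert kernels, each of norm at
most `8` wherever its centre lies. -/
theorem HilbertBoundOn.exists_bound {R : ℝ → ℝ → ℝ → ℂ}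
    (hR : HilbertBoundOn R (Icc 0 1 ×ˢ Icc 0 1)) :
    ∃ B : ℝ≥0, ∃ r > 0, ∀ ε, 0 ≤ ε → ε < r → ∀ u, AEStronglyMeasurable u unitMeasure →
      eLpNorm (fun x => ∫⁻ y, ‖R ε x y * u y‖ₑ ∂unitMeasure) 2 unitMeasure ≤
        B * eLpNorm u 2 unitMeasure := by
  obtain ⟨C, N, r, hr, h⟩ := hR
  refine ⟨N * (8 * (max C 1).toNNReal), r, hr, fun ε h0 hε u hu => ?_⟩
  obtain ⟨p, hp⟩ := h ε h0 hε
  have hC : 0 < max C 1 := lt_max_of_lt_right one_pos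
  have hpt : ∀ x ∈ Icc (0 : ℝ) 1, ∀ y ∈ Icc (0 : ℝ) 1, ‖R ε x y * u y‖ₑ ≤
      ∑ k, ENNReal.ofReal (max C 1) *
        ((ENNReal.ofReal (|x - (p k).1| + |y - (p k).2|))⁻¹ * ‖u y‖ₑ) := by
    intro x hx y hy
    obtain ⟨k, hk⟩ := hp (x, y) ⟨hx, hy⟩
    refine le_trans ?_ (Finset.single_le_sum (fun _ _ => zero_le) (Finset.mem_univ k))
    rw [enorm_mul, ← mul_assoc]
    gcongr
    rw [← div_eq_mul_inv, ENNReal.le_div_iff_mul_le (Or.inr (by simp))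
      (Or.inr ENNReal.ofReal_ne_top), ← ofReal_norm, ← ENNReal.ofReal_mul (norm_nonneg _)]
    exact ENNReal.ofReal_le_ofReal (hk.trans (le_max_left _ _))
  have hm : ∀ k, AEStronglyMeasurable (fun x => ENNReal.ofReal (max C 1) *
      ∫⁻ y, (ENNReal.ofReal (|x - (p k).1| + |y - (p k).2|))⁻¹ * ‖u y‖ₑ ∂unitMeasure)
      unitMeasure := by
    intro k
    refine AEMeasurable.aestronglyMeasurable (AEMeasurable.const_mul ?_ _)
    refine AEMeasurable.lintegral_prod_right' (f := fun z : ℝ × ℝ =>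
      (ENNReal.ofReal (|z.1 - (p k).1| + |z.2 - (p k).2|))⁻¹ * ‖u z.2‖ₑ) ?_
    exact AEMeasurable.mul (by fun_prop) hu.comp_snd.enorm
  calc eLpNorm (fun x => ∫⁻ y, ‖R ε x y * u y‖ₑ ∂unitMeasure) 2 unitMeasure
      ≤ eLpNorm (∑ k, fun x => ENNReal.ofReal (max C 1) *
        ∫⁻ y, (ENNReal.ofReal (|x - (p k).1| + |y - (p k).2|))⁻¹ * ‖u y‖ₑ ∂unitMeasure) 2
          unitMeasure := by
        refine eLpNorm_mono_enorm_ae ?_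
        filter_upwards [ae_restrict_mem measurableSet_Icc] with x hx
        simp only [enorm_eq_self, Finset.sum_apply]
        calc _ ≤ ∫⁻ y, ∑ k, ENNReal.ofReal (max C 1) *
              ((ENNReal.ofReal (|x - (p k).1| + |y - (p k).2|))⁻¹ * ‖u y‖ₑ) ∂unitMeasure := by
              refine lintegral_mono_ae ?_
              filter_upwards [ae_restrict_mem measurableSet_Icc] with y hy using hpt x hx y hy
          _ = _ := by
              rw [lintegral_finsetSum']
              · refine Finset.sum_congr rfl fun k _ => lintegral_const_mul' _ _ ENNReal.ofReal_ne_top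
              · intro k _
                exact (AEMeasurable.mul (by fun_prop) hu.enorm).const_mul _
    _ ≤ ∑ k : Fin N, eLpNorm (fun x => ENNReal.ofReal (max C 1) *
        ∫⁻ y, (ENNReal.ofReal (|x - (p k).1| + |y - (p k).2|))⁻¹ * ‖u y‖ₑ ∂unitMeasure) 2
          unitMeasure := eLpNorm_sum_le (fun k _ => hm k) (by norm_num)
    _ ≤ ∑ k : Fin N, ENNReal.ofReal (max C 1) * (8 * eLpNorm u 2 unitMeasure) := by
        refine Finset.sum_le_sum fun k _ => ?_
        refine (eLpNorm_le_nnreal_smul_eLpNorm_of_ae_le_mul' (c := (max C 1).toNNReal)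
          (g := fun x => ∫⁻ y, (ENNReal.ofReal (|x - (p k).1| + |y - (p k).2|))⁻¹ * ‖u y‖ₑ
            ∂unitMeasure) (Eventually.of_forall fun x => le_rfl) 2).trans ?_
        exact mul_le_mul_right (eLpNorm_hilbert_le _ _ hu) _
    _ = _ := by
        rw [Finset.sum_const, Finset.card_univ, Fintype.card_fin, nsmul_eq_mul]
        push_cast
        rw [ENNReal.ofReal]
        ring

theorem aestronglyMeasurable_kernelOp {k : ℝ → ℝ → ℂ} (hk : Measurable (Function.uncurry k))
    {u : ℝ → ℂ} (hu : AEStronglyMeasurable u unitMeasure) :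
    AEStronglyMeasurable (kernelOp k u) unitMeasure :=
  AEStronglyMeasurable.integral_prod_right' (f := fun z : ℝ × ℝ => k z.1 z.2 * u z.2)
    (hk.aestronglyMeasurable.mul hu.comp_snd)

theorem ae_integrable_kernel {k : ℝ → ℝ → ℂ} (hk : Measurable (Function.uncurry k)) {u : ℝ → ℂ}
    (hu : AEStronglyMeasurable u unitMeasure)
    (h : eLpNorm (fun x => ∫⁻ y, ‖k x y * u y‖ₑ ∂unitMeasure) 2 unitMeasure ≠ ⊤) :
    ∀ᵐ x ∂unitMeasure, Integrable (fun y => k x y * u y) unitMeasure := by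
  have hm : AEMeasurable (fun x => (∫⁻ y, ‖k x y * u y‖ₑ ∂unitMeasure) ^ (2 : ℝ)) unitMeasure :=
    (AEMeasurable.lintegral_prod_right' (f := fun z : ℝ × ℝ => ‖k z.1 z.2 * u z.2‖ₑ)
      (hk.aestronglyMeasurable.mul hu.comp_snd).enorm).pow_const _
  rw [eLpNorm_eq_lintegral_rpow_enorm_toReal (by norm_num) (by norm_num)] at h
  simp only [enorm_eq_self, ENNReal.toReal_ofNat] at h
  have h2 : ∫⁻ x, (∫⁻ y, ‖k x y * u y‖ₑ ∂unitMeasure) ^ (2 : ℝ) ∂unitMeasure ≠ ⊤ := by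
    intro h3
    rw [h3] at h
    simp at h
  filter_upwards [ae_lt_top' hm h2] with x hx
  refine ⟨(hk.of_uncurry_left.aestronglyMeasurable.mul hu), ?_⟩
  rw [hasFiniteIntegral_iff_enorm]
  by_contra h4
  rw [not_lt_top_iff.1 h4] at hx
  simp at hx

theorem eLpNorm_kernelOp_le (k : ℝ → ℝ → ℂ) (u : ℝ → ℂ) :
    eLpNorm (kernelOp k u) 2 unitMeasure ≤
      eLpNorm (fun x => ∫⁻ y, ‖k x y * u y‖ₑ ∂unitMeasure) 2 unitMeasure :=
  eLpNorm_mono_enorm fun _ => (enorm_integral_le_lintegral_enorm _)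

/-- Cutting off near a closed null set supplies the dense class on which convergence of singular
operators can be checked by hand. -/
theorem tendsto_eLpNorm_sub_indicator {Y : Set ℝ} (hY : IsClosed Y) (hY0 : volume Y = 0)
    (hne : Y.Nonempty) {u : ℝ → ℂ} (hu : MemLp u 2 unitMeasure) :
    Tendsto (fun m : ℕ => eLpNorm (fun x =>
      ({y | 1 / ((m : ℝ) + 1) ≤ Metric.infDist y Y}.indicator u x) - u x) 2 unitMeasure)
      atTop (𝓝 0) := by
  have hmeas : ∀ m : ℕ, MeasurableSet {y | 1 / ((m : ℝ) + 1) ≤ Metric.infDist y Y} := fun m =>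
    (isClosed_le continuous_const (Metric.continuous_infDist_pt Y)).measurableSet
  refine tendsto_eLpNorm_two_of_dominated (fun x => ‖u x‖)
    (Eventually.of_forall fun m => hu.1.indicator (hmeas m)) hu.1 hu.norm
    (Eventually.of_forall fun m => Eventually.of_forall fun x => ?_) ?_
  · by_cases hx : x ∈ {y | 1 / ((m : ℝ) + 1) ≤ Metric.infDist y Y}
    · rw [indicator_of_mem hx, sub_self, norm_zero]
      exact norm_nonneg _
    · rw [indicator_of_notMem hx, zero_sub, norm_neg]
  · have : ∀ᵐ x ∂unitMeasure, x ∉ Y := ae_restrict_of_ae (measure_eq_zero_iff_ae_notMem.1 hY0)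
    filter_upwards [this] with x hx
    have hpos : 0 < Metric.infDist x Y := (hY.notMem_iff_infDist_pos hne).1 hx
    refine tendsto_const_nhds.congr' ?_
    filter_upwards [tendsto_one_div_add_atTop_nhds_zero_nat.eventually (gt_mem_nhds hpos)] with m hm
    rw [indicator_of_mem]
    exact hm.le

/-- A uniform `L²` bound plus convergence on a dense class. The dense class consists of the
functions vanishing near the null set `Y`, the parameters where the kernels may be unbounded; for
those the kernels are uniformly bounded and dominated convergence applies twice, first in `y` and
then in `x`. -/
theorem exists_tendsto_kernelOp {R : ℝ → ℝ → ℝ → ℂ} (hm : ∀ ε, Measurable (Function.uncurry (R ε)))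
    (hR : HilbertBoundOn R (Icc 0 1 ×ˢ Icc 0 1)) {Y : Set ℝ} (hY : IsClosed Y)
    (hY0 : volume Y = 0) (hne : Y.Nonempty)
    (hloc : ∀ K ⊆ Icc (0 : ℝ) 1, IsCompact K → Disjoint K Y → ∃ C, ∃ r > 0, ∀ ε, 0 ≤ ε → ε < r →
      ∀ x ∈ Icc (0 : ℝ) 1, ∀ y ∈ K, ‖R ε x y‖ ≤ C)
    (hlim : ∀ x ∈ Icc (0 : ℝ) 1, ∀ y ∈ Icc (0 : ℝ) 1, y ∉ Y → y ≠ x →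
      Tendsto (fun ε => R ε x y) (𝓝[>] 0) (𝓝 (R 0 x y))) :
    ∃ B : ℝ≥0, (∀ u, MemLp u 2 unitMeasure → MemLp (kernelOp (R 0) u) 2 unitMeasure ∧
      eLpNorm (kernelOp (R 0) u) 2 unitMeasure ≤ B * eLpNorm u 2 unitMeasure ∧
      Tendsto (fun ε => eLpNorm (fun x => kernelOp (R ε) u x - kernelOp (R 0) u x) 2 unitMeasure)
        (𝓝[>] 0) (𝓝 0)) ∧
      ∀ᶠ ε in 𝓝[>] 0, ∀ u, MemLp u 2 unitMeasure →
        ∀ᵐ x ∂unitMeasure, Integrable (fun y => R ε x y * u y) unitMeasure := by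
  obtain ⟨B, r, hr, hB⟩ := hR.exists_bound
  have hint : ∀ ε, 0 ≤ ε → ε < r → ∀ u, MemLp u 2 unitMeasure →
      ∀ᵐ x ∂unitMeasure, Integrable (fun y => R ε x y * u y) unitMeasure := by
    intro ε h0 hε u hu
    exact ae_integrable_kernel (hm ε) hu.1
      (ne_top_of_le_ne_top (ENNReal.mul_ne_top ENNReal.coe_ne_top hu.eLpNorm_ne_top)
        (hB ε h0 hε u hu.1))
  have hop : ∀ ε, 0 ≤ ε → ε < r → ∀ u, MemLp u 2 unitMeasure →
      eLpNorm (kernelOp (R ε) u) 2 unitMeasure ≤ B * eLpNorm u 2 unitMeasure :=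
    fun ε h0 hε u hu => (eLpNorm_kernelOp_le _ _).trans (hB ε h0 hε u hu.1)
  have hev : ∀ᶠ ε : ℝ in 𝓝[>] 0, 0 ≤ ε ∧ ε < r := by
    filter_upwards [Ioo_mem_nhdsGT hr] with ε hε using ⟨hε.1.le, hε.2⟩
  refine ⟨B, fun u hu => ⟨⟨aestronglyMeasurable_kernelOp (hm 0) hu.1, ?_⟩, hop 0 le_rfl hr u hu, ?_⟩,
    by filter_upwards [hev] with ε hε using hint ε hε.1 hε.2⟩
  · exact (hop 0 le_rfl hr u hu).trans_lt
      (ENNReal.mul_lt_top ENNReal.coe_lt_top hu.eLpNorm_lt_top)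
  rw [ENNReal.tendsto_nhds_zero]
  intro δ hδ
  have hδ3 : 0 < δ / 3 := ENNReal.div_pos hδ.ne' (by norm_num)
  have h1 : Tendsto (fun m : ℕ => (B : ℝ≥0∞) * eLpNorm (fun x =>
      ({y | 1 / ((m : ℝ) + 1) ≤ Metric.infDist y Y}.indicator u x) - u x) 2 unitMeasure)
      atTop (𝓝 0) := by
    have := ENNReal.Tendsto.const_mul (a := (B : ℝ≥0∞)) (tendsto_eLpNorm_sub_indicator hY hY0 hne hu)
      (Or.inr ENNReal.coe_ne_top)
    simpa using this
  obtain ⟨m, hmδ⟩ := ((ENNReal.tendsto_nhds_zero.1 h1) (δ / 3) hδ3).exists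
  set A : Set ℝ := {y | 1 / ((m : ℝ) + 1) ≤ Metric.infDist y Y} with hA
  have hAc : IsClosed A := isClosed_le continuous_const (Metric.continuous_infDist_pt Y)
  have hu' : MemLp (A.indicator u) 2 unitMeasure := hu.indicator hAc.measurableSet
  have hdu : MemLp (fun x => A.indicator u x - u x) 2 unitMeasure := hu'.sub hu
  have hu1 : Integrable u unitMeasure := hu.integrable (by norm_num)
  obtain ⟨C₀, r', hr', hC⟩ := hloc (Icc 0 1 ∩ A) inter_subset_left (isCompact_Icc.inter_right hAc) (by
    rw [Set.disjoint_left]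
    rintro y ⟨-, hy⟩ hyY
    have h0 : Metric.infDist y Y = 0 := Metric.infDist_zero_of_mem hyY
    have : 0 < 1 / ((m : ℝ) + 1) := by positivity
    simp only [hA, mem_ofPred_eq, h0] at hy
    linarith)
  set C := max C₀ 0
  have hbd : ∀ ε, 0 ≤ ε → ε < r' → ∀ x ∈ Icc (0 : ℝ) 1, ∀ y ∈ Icc (0 : ℝ) 1,
      ‖R ε x y * A.indicator u y‖ ≤ C * ‖u y‖ := by
    intro ε h0 hε x hx y hy
    by_cases hyA : y ∈ A
    · rw [indicator_of_mem hyA, norm_mul]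
      exact mul_le_mul_of_nonneg_right ((hC ε h0 hε x hx y ⟨hy, hyA⟩).trans (le_max_left _ _)) (norm_nonneg _)
    · rw [indicator_of_notMem hyA, mul_zero, norm_zero]
      exact mul_nonneg (le_max_right _ _) (norm_nonneg _)
  have hev' : ∀ᶠ ε : ℝ in 𝓝[>] 0, 0 ≤ ε ∧ ε < r' := by
    filter_upwards [Ioo_mem_nhdsGT hr'] with ε hε using ⟨hε.1.le, hε.2⟩
  have hpt : ∀ x ∈ Icc (0 : ℝ) 1, Tendsto (fun ε => kernelOp (R ε) (A.indicator u) x) (𝓝[>] 0)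
      (𝓝 (kernelOp (R 0) (A.indicator u) x)) := by
    intro x hx
    refine tendsto_integral_filter_of_dominated_convergence (fun y => C * ‖u y‖) ?_ ?_
      (hu1.norm.const_mul C) ?_
    · exact Eventually.of_forall fun ε => (hm ε).of_uncurry_left.aestronglyMeasurable.mul hu'.1
    · filter_upwards [hev'] with ε hε
      filter_upwards [ae_restrict_mem measurableSet_Icc] with y hy using hbd ε hε.1 hε.2 x hx y hy
    · have hnx : ∀ᵐ y ∂unitMeasure, y ≠ x := ae_restrict_of_ae (by simp [ae_iff])
      have hnY : ∀ᵐ y ∂unitMeasure, y ∉ Y := ae_restrict_of_ae (measure_eq_zero_iff_ae_notMem.1 hY0)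
      filter_upwards [ae_restrict_mem measurableSet_Icc, hnx, hnY] with y hy hyx hyY
      exact (hlim x hx y hy hyY hyx).mul_const _
  have hmid : Tendsto (fun ε => eLpNorm (fun x => kernelOp (R ε) (A.indicator u) x -
      kernelOp (R 0) (A.indicator u) x) 2 unitMeasure) (𝓝[>] 0) (𝓝 0) := by
    have hker : ∀ ε, 0 ≤ ε → ε < r' → ∀ x ∈ Icc (0 : ℝ) 1,
        ‖kernelOp (R ε) (A.indicator u) x‖ ≤ ∫ y, C * ‖u y‖ ∂unitMeasure := by
      intro ε h0 hε x hx
      refine norm_integral_le_of_norm_le (hu1.norm.const_mul C) ?_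
      filter_upwards [ae_restrict_mem measurableSet_Icc] with y hy using hbd ε h0 hε x hx y hy
    refine tendsto_eLpNorm_two_of_dominated (fun _ => 2 * ∫ y, C * ‖u y‖ ∂unitMeasure)
      (Eventually.of_forall fun ε => aestronglyMeasurable_kernelOp (hm ε) hu'.1)
      (aestronglyMeasurable_kernelOp (hm 0) hu'.1) (memLp_const _) ?_ ?_
    · filter_upwards [hev'] with ε hε
      filter_upwards [ae_restrict_mem measurableSet_Icc] with x hx
      refine (norm_sub_le _ _).trans ?_
      linarith [hker ε hε.1 hε.2 x hx, hker 0 le_rfl hr' x hx]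
    · filter_upwards [ae_restrict_mem measurableSet_Icc] with x hx using hpt x hx
  filter_upwards [hev, (ENNReal.tendsto_nhds_zero.1 hmid) (δ / 3) hδ3] with ε hε hεδ
  -- The splitting of `u` may be carried through the integral only where both parts are integrable,
  -- that is, for almost every `x`.
  have hsplit : ∀ ε, 0 ≤ ε → ε < r → ∀ᵐ x ∂unitMeasure, kernelOp (R ε) u x =
      kernelOp (R ε) (A.indicator u) x - kernelOp (R ε) (fun x => A.indicator u x - u x) x := by
    intro ε h0 hε
    filter_upwards [hint ε h0 hε _ hu', hint ε h0 hε _ hdu] with x h1 h2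
    rw [kernelOp, kernelOp, kernelOp, ← integral_sub h1 h2]
    congr 1; ext y; ring
  have heq : (fun x => kernelOp (R ε) u x - kernelOp (R 0) u x) =ᵐ[unitMeasure]
      (fun x => kernelOp (R ε) (A.indicator u) x - kernelOp (R 0) (A.indicator u) x) +
      (kernelOp (R 0) (fun x => A.indicator u x - u x) -
        kernelOp (R ε) (fun x => A.indicator u x - u x)) := by
    filter_upwards [hsplit ε hε.1 hε.2, hsplit 0 le_rfl hr] with x h1 h2
    rw [h1, h2]
    simp only [Pi.add_apply, Pi.sub_apply]
    ring
  have hms : ∀ ε w, AEStronglyMeasurable w unitMeasure →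
      AEStronglyMeasurable (kernelOp (R ε) w) unitMeasure := fun ε w hw =>
    aestronglyMeasurable_kernelOp (hm ε) hw
  rw [eLpNorm_congr_ae heq]
  calc _ ≤ δ / 3 + (δ / 3 + δ / 3) := by
        refine (eLpNorm_add_le ((hms ε _ hu'.1).sub (hms 0 _ hu'.1))
          ((hms 0 _ hdu.1).sub (hms ε _ hdu.1)) (by norm_num)).trans ?_
        refine add_le_add hεδ ((eLpNorm_sub_le (hms 0 _ hdu.1) (hms ε _ hdu.1)
          (by norm_num)).trans (add_le_add ?_ ?_))
        · exact (hop 0 le_rfl hr _ hdu).trans hmδ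
        · exact (hop ε hε.1 hε.2 _ hdu).trans hmδ
    _ = δ := by rw [← add_assoc, ENNReal.add_thirds]

/-! ### Local estimates of the Cauchy kernel between curves -/

/-- The curve `g`, shifted by `ε` in the direction of its left normal if `s = 1`, of its right normal
if `s = -1`. -/
noncomputable def normalShift (g : ℝ → ℂ) (s ε x : ℝ) : ℂ := g x + s * ε * Complex.I * deriv g x

theorem continuous_normalShift {g : ℝ → ℂ} (hg : ContDiff ℝ ∞ g) (s : ℝ) :
    Continuous fun p : ℝ × ℝ => normalShift g s p.1 p.2 := by
  have h1 := hg.continuous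
  have h2 := hg.continuous_deriv (by simp)
  unfold normalShift
  fun_prop

theorem normalShift_zero (g : ℝ → ℂ) (s x : ℝ) : normalShift g s 0 x = g x := by
  simp [normalShift]

/-- This is strict differentiability of `(ε, x, y) ↦ h y - normalShift g s ε x` at `(0, x₀, y₀)`.
The strict form is needed because two arbitrary nearby points are compared, neither of them the base
point. -/
theorem eventually_norm_sub_normalShift_le {g h : ℝ → ℂ} (hg : ContDiff ℝ ∞ g)
    (hh : ContDiff ℝ ∞ h) (s x₀ y₀ : ℝ) {η : ℝ} (hη : 0 < η) :
    ∃ r > 0, ∀ ε x y ε' x' y' : ℝ, |ε| < r → |x - x₀| < r → |y - y₀| < r →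
      |ε'| < r → |x' - x₀| < r → |y' - y₀| < r →
      ‖(h y - normalShift g s ε x) - (h y' - normalShift g s ε' x') -
        (deriv h y₀ * (y - y') - deriv g x₀ * (x - x') -
          s * Complex.I * deriv g x₀ * (ε - ε'))‖ ≤ η * (|ε - ε'| + |x - x'| + |y - y'|) := by
  have hg' : ContDiff ℝ ∞ (deriv g) := ((contDiff_infty_iff_deriv (𝕜 := ℝ)).1 hg).2
  have sg : HasStrictDerivAt g (deriv g x₀) x₀ := hg.contDiffAt.hasStrictDerivAt (by simp)
  have sh : HasStrictDerivAt h (deriv h y₀) y₀ := hh.contDiffAt.hasStrictDerivAt (by simp)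
  have sg' : HasStrictDerivAt (deriv g) (deriv (deriv g) x₀) x₀ :=
    hg'.contDiffAt.hasStrictDerivAt (by simp)
  have d1 : HasStrictFDerivAt (fun p : ℝ × ℝ × ℝ => p.1) (ContinuousLinearMap.fst ℝ ℝ (ℝ × ℝ))
      (0, x₀, y₀) := hasStrictFDerivAt_fst
  have d2 : HasStrictFDerivAt (fun p : ℝ × ℝ × ℝ => p.2.1)
      ((ContinuousLinearMap.fst ℝ ℝ ℝ).comp (ContinuousLinearMap.snd ℝ ℝ (ℝ × ℝ)))
      (0, x₀, y₀) := hasStrictFDerivAt_fst.comp _ hasStrictFDerivAt_snd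
  have d3 : HasStrictFDerivAt (fun p : ℝ × ℝ × ℝ => p.2.2)
      ((ContinuousLinearMap.snd ℝ ℝ ℝ).comp (ContinuousLinearMap.snd ℝ ℝ (ℝ × ℝ)))
      (0, x₀, y₀) := hasStrictFDerivAt_snd.comp _ hasStrictFDerivAt_snd
  have e3 := sh.hasStrictFDerivAt.comp (0, x₀, y₀) d3
  have e2 := sg.hasStrictFDerivAt.comp (0, x₀, y₀) d2
  have e2' := sg'.hasStrictFDerivAt.comp (0, x₀, y₀) d2
  have e1 := Complex.ofRealCLM.hasStrictFDerivAt.comp (0, x₀, y₀) d1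
  have key := e3.sub (e2.add ((e1.mul e2').const_mul ((s : ℂ) * Complex.I)))
  have := (key.isLittleO.bound hη)
  rw [Metric.eventually_nhds_iff] at this
  obtain ⟨r, hr, H⟩ := this
  refine ⟨r, hr, fun ε x y ε' x' y' h1 h2 h3 h4 h5 h6 => ?_⟩
  have hH := @H ((ε, x, y), (ε', x', y')) (by simp [Prod.dist_eq, Real.dist_eq, *])
  refine le_trans (le_of_eq ?_) (hH.trans ?_)
  · congr 1
    simp [normalShift]
    ring
  · gcongr
    simp only [Prod.mk_sub_mk, Prod.norm_mk, Real.norm_eq_abs, sup_le_iff]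
    refine ⟨?_, ?_, ?_⟩ <;> linarith [abs_nonneg (ε - ε'), abs_nonneg (x - x'), abs_nonneg (y - y')]

theorem LinearIndependent.exists_norm_sub_ge {a b : ℂ} (h : LinearIndependent ℝ ![a, b]) :
    ∃ c > 0, ∀ α β : ℝ, c * (|α| + |β|) ≤ ‖b * β - a * α‖ := by
  rw [LinearIndependent.pair_iff] at h
  -- The oriented area spanned by `a` and `b`. Multiplying `b β - a α` by the conjugate of `a` or of
  -- `b` and taking imaginary parts isolates `D β` or `D α`.
  set D : ℝ := ((starRingEnd ℂ) a * b).im with hD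
  have hD0 : D ≠ 0 := by
    intro h0
    have hre : (starRingEnd ℂ) a * b = (((starRingEnd ℂ) a * b).re : ℂ) :=
      Complex.ext (by simp) (by rw [Complex.ofReal_im]; exact h0)
    have h1 : (-((starRingEnd ℂ) a * b).re) • a + (Complex.normSq a) • b = 0 := by
      simp only [Complex.real_smul, Complex.ofReal_neg]
      rw [← hre, ← Complex.mul_conj]
      ring
    have h2 := (h _ _ h1).2
    rw [Complex.normSq_eq_zero] at h2
    have := (h 1 0 (by simp [h2])).1
    norm_num at this
  have ha : 0 < ‖a‖ := by
    rw [norm_pos_iff]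
    rintro rfl
    simp [hD] at hD0
  have key : ∀ α β : ℝ, |D| * (|α| + |β|) ≤ (‖a‖ + ‖b‖) * ‖b * β - a * α‖ := by
    intro α β
    have h1 : |D| * |β| ≤ ‖a‖ * ‖b * β - a * α‖ := by
      have : ((starRingEnd ℂ) a * (b * β - a * α)).im = D * β := by
        simp [hD]; ring
      rw [← abs_mul, ← this, ← Complex.norm_conj a, ← norm_mul]
      exact Complex.abs_im_le_norm _
    have h2 : |D| * |α| ≤ ‖b‖ * ‖b * β - a * α‖ := by
      have : ((starRingEnd ℂ) b * (b * β - a * α)).im = D * α := by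
        simp [hD]; ring
      rw [← abs_mul, ← this, ← Complex.norm_conj b, ← norm_mul]
      exact Complex.abs_im_le_norm _
    linarith
  have hab : 0 < ‖a‖ + ‖b‖ := by positivity
  refine ⟨|D| / (‖a‖ + ‖b‖), div_pos (abs_pos.2 hD0) hab, fun α β => ?_⟩
  rw [div_mul_eq_mul_div, div_le_iff₀ hab, mul_comm ‖_‖]
  exact key α β

/-- For fixed `ε`, take as centre the point `p` near the crossing that minimizes the modulus of `A =
h y - normalShift g s ε x`. Then `‖A z - A p‖ ≤ 2 ‖A z‖`, while transversality and linearization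
bound `‖A z - A p‖` below by `c / 2` times the distance from `z` to `p`. The centre is thus a
nearest approach of the shifted curve, which moves with `ε`. -/
theorem exists_hilbertBoundOn_of_transversal {g h : ℝ → ℂ} (hg : ContDiff ℝ ∞ g)
    (hh : ContDiff ℝ ∞ h) (s : ℝ) {x₀ y₀ : ℝ}
    (hind : LinearIndependent ℝ ![deriv g x₀, deriv h y₀]) {S : Set (ℝ × ℝ)} (hS : IsClosed S)
    (hmem : (x₀, y₀) ∈ S) :
    ∃ U ∈ 𝓝 (x₀, y₀), HilbertBoundOn
      (fun ε x y => deriv h y / (h y - normalShift g s ε x)) (U ∩ S) := by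
  obtain ⟨c, hc, hcb⟩ := hind.exists_norm_sub_ge
  obtain ⟨r, hr, H⟩ := eventually_norm_sub_normalShift_le hg hh s x₀ y₀ (half_pos hc)
  have hcont := continuous_normalShift hg s
  have hh0 := hh.continuous
  have hK : IsCompact (Metric.closedBall ((x₀, y₀) : ℝ × ℝ) (r / 2) ∩ S) :=
    (isCompact_closedBall _ _).inter_right hS
  have hin : ∀ z ∈ Metric.closedBall ((x₀, y₀) : ℝ × ℝ) (r / 2), |z.1 - x₀| < r ∧ |z.2 - y₀| < r := by
    intro z hz
    rw [Metric.mem_closedBall, Prod.dist_eq, sup_le_iff, Real.dist_eq, Real.dist_eq] at hz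
    exact ⟨by linarith [hz.1], by linarith [hz.2]⟩
  obtain ⟨M, hM⟩ := hK.exists_bound_of_continuousOn (f := fun z : ℝ × ℝ => deriv h z.2)
    ((hh.continuous_deriv (by simp)).comp continuous_snd).continuousOn
  refine ⟨_, Metric.closedBall_mem_nhds _ (half_pos hr), 4 * M / c, 1, r, hr, fun ε h0 hε => ?_⟩
  obtain ⟨p, hp, hmin⟩ := hK.exists_isMinOn
    ⟨(x₀, y₀), Metric.mem_closedBall_self (half_pos hr).le, hmem⟩
    (f := fun z : ℝ × ℝ => ‖h z.2 - normalShift g s ε z.1‖)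
    (by
      have : Continuous fun z : ℝ × ℝ => normalShift g s ε z.1 :=
        hcont.comp (continuous_const.prodMk continuous_fst)
      exact ((hh0.comp continuous_snd).sub this).norm.continuousOn)
  refine ⟨fun _ => p, fun z hz => ⟨0, ?_⟩⟩
  have hz' := hin z hz.1
  have hp' := hin p hp.1
  have hε' : |ε| < r := by rwa [abs_of_nonneg h0]
  have h1 := H ε z.1 z.2 ε p.1 p.2 hε' hz'.1 hz'.2 hε' hp'.1 hp'.2
  have h2 := hcb (z.1 - p.1) (z.2 - p.2)
  have h3 : ‖h p.2 - normalShift g s ε p.1‖ ≤ ‖h z.2 - normalShift g s ε z.1‖ := hmin hz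
  set A := h z.2 - normalShift g s ε z.1
  set A' := h p.2 - normalShift g s ε p.1
  simp only [sub_self, abs_zero, zero_add, mul_zero, sub_zero] at h1
  push_cast at h2
  have h4 : ‖deriv h y₀ * ((z.2 : ℂ) - p.2) - deriv g x₀ * ((z.1 : ℂ) - p.1)‖ ≤
      ‖A - A'‖ + c / 2 * (|z.1 - p.1| + |z.2 - p.2|) := by
    refine le_trans ?_ (add_le_add le_rfl h1)
    rw [← norm_neg (A - A' - _)]
    refine le_trans (le_of_eq ?_) (norm_add_le _ _)
    congr 1; ring
  have h5 : c / 4 * (|z.1 - p.1| + |z.2 - p.2|) ≤ ‖A‖ := by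
    have := norm_sub_le A A'
    linarith
  have hM0 := hM z hz
  simp only at hM0 ⊢
  rw [norm_div]
  rcases (norm_nonneg A).eq_or_lt with hA | hA
  -- Where the two curves meet, division by zero makes the kernel `0`.
  · rw [← hA, div_zero, zero_mul]
    have := (norm_nonneg _).trans hM0
    positivity
  · rw [div_mul_eq_mul_div, div_le_div_iff₀ hA hc]
    calc ‖deriv h z.2‖ * (|z.1 - p.1| + |z.2 - p.2|) * c
        = 4 * (‖deriv h z.2‖ * (c / 4 * (|z.1 - p.1| + |z.2 - p.2|))) := by ring
      _ ≤ 4 * (M * ‖A‖) := by gcongr; exact (norm_nonneg _).trans hM0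
      _ = _ := by ring

/-- To first order the difference is `g' ((y - x) - isε)`, whose tangential and normal parts are
orthogonal and cannot cancel. Half of the resulting lower bound absorbs the linearization error. -/
theorem exists_norm_sub_normalShift_ge {g : ℝ → ℂ} (hg : ContDiff ℝ ∞ g) {s : ℝ}
    (hs : s = 1 ∨ s = -1) {p : ℝ} (hp : deriv g p ≠ 0) :
    ∃ c > 0, ∃ r > 0, ∀ ε x y : ℝ, |ε| < r → |x - p| < r → |y - p| < r →
      c * (|y - x| + |ε|) ≤ ‖g y - normalShift g s ε x‖ := by
  have hd : 0 < ‖deriv g p‖ := norm_pos_iff.2 hp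
  obtain ⟨r, hr, H⟩ := eventually_norm_sub_normalShift_le hg hg s p p
    (η := ‖deriv g p‖ / 4) (by positivity)
  refine ⟨‖deriv g p‖ / 4, by positivity, r, hr, fun ε x y h1 h2 h3 => ?_⟩
  have h4 := H ε x y 0 x x h1 h2 h3 (by simpa using hr) h2 h2
  rw [normalShift_zero] at h4
  simp only [sub_self, sub_zero, abs_zero, add_zero, mul_zero, Complex.ofReal_zero] at h4
  have h5 : ‖deriv g p‖ / 2 * (|y - x| + |ε|) ≤
      ‖deriv g p * ((y : ℂ) - x) - s * Complex.I * deriv g p * ε‖ := by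
    have e1 : deriv g p * ((y : ℂ) - x) - s * Complex.I * deriv g p * ε =
        deriv g p * (((y - x : ℝ) : ℂ) - (s * ε : ℝ) * Complex.I) := by push_cast; ring
    rw [e1, norm_mul]
    have e2 := Complex.abs_re_le_norm (((y - x : ℝ) : ℂ) - (s * ε : ℝ) * Complex.I)
    have e3 := Complex.abs_im_le_norm (((y - x : ℝ) : ℂ) - (s * ε : ℝ) * Complex.I)
    have e4 : |s * ε| = |ε| := by rcases hs with rfl | rfl <;> simp
    simp only [Complex.sub_re, Complex.ofReal_re, Complex.mul_re, Complex.I_re, mul_zero,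
      Complex.ofReal_im, Complex.I_im, sub_zero, Complex.sub_im, Complex.mul_im, mul_one,
      add_zero, zero_sub, abs_neg, e4] at e2 e3
    calc _ = ‖deriv g p‖ * ((|y - x| + |ε|) / 2) := by ring
      _ ≤ _ := by gcongr; linarith
  have h6 := norm_sub_le (g y - normalShift g s ε x) (g y - normalShift g s ε x -
    (deriv g p * ((y : ℂ) - x) - s * Complex.I * deriv g p * ε))
  rw [sub_sub_cancel] at h6
  linarith

namespace HilbertBoundOn

variable {R R' : ℝ → ℝ → ℝ → ℂ} {V : Set (ℝ × ℝ)}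

theorem add (hR : HilbertBoundOn R V) (hR' : HilbertBoundOn R' V) :
    HilbertBoundOn (fun ε x y => R ε x y + R' ε x y) V := by
  obtain ⟨C, N, r, hr, h⟩ := hR
  obtain ⟨C', N', r', hr', h'⟩ := hR'
  refine ⟨C + C', N + N', min r r', lt_min hr hr', fun ε h0 hε => ?_⟩
  obtain ⟨p, hp⟩ := h ε h0 (hε.trans_le (min_le_left _ _))
  obtain ⟨p', hp'⟩ := h' ε h0 (hε.trans_le (min_le_right _ _))
  refine ⟨Fin.append p p', fun z hz => ?_⟩
  obtain ⟨k, hk⟩ := hp z hz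
  obtain ⟨k', hk'⟩ := hp' z hz
  rcases le_total (|z.1 - (p k).1| + |z.2 - (p k).2|) (|z.1 - (p' k').1| + |z.2 - (p' k').2|)
    with hle | hle
  · refine ⟨Fin.castAdd N' k, ?_⟩
    rw [Fin.append_left]
    calc _ ≤ (‖R ε z.1 z.2‖ + ‖R' ε z.1 z.2‖) * (|z.1 - (p k).1| + |z.2 - (p k).2|) := by
          gcongr; exact norm_add_le _ _
      _ ≤ ‖R ε z.1 z.2‖ * (|z.1 - (p k).1| + |z.2 - (p k).2|) +
          ‖R' ε z.1 z.2‖ * (|z.1 - (p' k').1| + |z.2 - (p' k').2|) := by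
          rw [add_mul]; gcongr
      _ ≤ _ := add_le_add hk hk'
  · refine ⟨Fin.natAdd N k', ?_⟩
    rw [Fin.append_right]
    calc _ ≤ (‖R ε z.1 z.2‖ + ‖R' ε z.1 z.2‖) * (|z.1 - (p' k').1| + |z.2 - (p' k').2|) := by
          gcongr; exact norm_add_le _ _
      _ ≤ ‖R ε z.1 z.2‖ * (|z.1 - (p k).1| + |z.2 - (p k).2|) +
          ‖R' ε z.1 z.2‖ * (|z.1 - (p' k').1| + |z.2 - (p' k').2|) := by
          rw [add_mul]; gcongr
      _ ≤ _ := add_le_add hk hk'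

theorem mono {W : Set (ℝ × ℝ)} (hR : HilbertBoundOn R W) (h : V ⊆ W) : HilbertBoundOn R V := by
  obtain ⟨C, N, r, hr, hb⟩ := hR
  exact ⟨C, N, r, hr, fun ε h0 hε => (hb ε h0 hε).imp fun p hp z hz => hp z (h hz)⟩

end HilbertBoundOn

/-- On `V`, the kernels `R ε` are bounded, uniformly for small `ε ≥ 0`. -/
def UniformBoundOn (R : ℝ → ℝ → ℝ → ℂ) (V : Set (ℝ × ℝ)) : Prop :=
  ∃ C : ℝ, ∃ r > 0, ∀ ε, 0 ≤ ε → ε < r → ∀ z ∈ V, ‖R ε z.1 z.2‖ ≤ C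

namespace UniformBoundOn

variable {R R' : ℝ → ℝ → ℝ → ℂ} {V W : Set (ℝ × ℝ)}

theorem mono (hR : UniformBoundOn R W) (h : V ⊆ W) : UniformBoundOn R V := by
  obtain ⟨C, r, hr, hb⟩ := hR
  exact ⟨C, r, hr, fun ε h0 hε z hz => hb ε h0 hε z (h hz)⟩

theorem sub (hR : UniformBoundOn R V) (hR' : UniformBoundOn R' V) :
    UniformBoundOn (fun ε x y => R ε x y - R' ε x y) V := by
  obtain ⟨C, r, hr, h⟩ := hR
  obtain ⟨C', r', hr', h'⟩ := hR'
  refine ⟨C + C', min r r', lt_min hr hr', fun ε h0 hε z hz => (norm_sub_le _ _).trans ?_⟩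
  exact add_le_add (h ε h0 (hε.trans_le (min_le_left _ _)) z hz)
    (h' ε h0 (hε.trans_le (min_le_right _ _)) z hz)

theorem neg (hR : UniformBoundOn R V) : UniformBoundOn (fun ε x y => -R ε x y) V := by
  obtain ⟨C, r, hr, h⟩ := hR
  exact ⟨C, r, hr, fun ε h0 hε z hz => by rw [norm_neg]; exact h ε h0 hε z hz⟩

theorem of_isCompact {S : Set (ℝ × ℝ)} (hS : IsCompact S)
    (h : ∀ z ∈ S, ∃ U ∈ 𝓝 z, UniformBoundOn R (U ∩ S)) : UniformBoundOn R S := by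
  refine hS.induction_on (p := UniformBoundOn R) ⟨0, 1, one_pos, by simp⟩
    (fun s t hst ht => ht.mono hst) ?_ fun z hz => ?_
  · rintro s t ⟨C, r, hr, h⟩ ⟨C', r', hr', h'⟩
    refine ⟨max C C', min r r', lt_min hr hr', fun ε h0 hε z hz => ?_⟩
    rcases hz with hz | hz
    · exact (h ε h0 (hε.trans_le (min_le_left _ _)) z hz).trans (le_max_left _ _)
    · exact (h' ε h0 (hε.trans_le (min_le_right _ _)) z hz).trans (le_max_right _ _)
  · obtain ⟨U, hU, hb⟩ := h z hz
    exact ⟨U ∩ S, inter_mem (mem_nhdsWithin_of_mem_nhds hU) self_mem_nhdsWithin, hb⟩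

/-- The unit square has `|x| + |y| ≤ 2`, so one centre at the origin suffices. -/
theorem hilbertBoundOn (hR : UniformBoundOn R V) (hV : V ⊆ Icc 0 1 ×ˢ Icc 0 1) :
    HilbertBoundOn R V := by
  obtain ⟨C, r, hr, h⟩ := hR
  refine ⟨C * 2, 1, r, hr, fun ε h0 hε => ⟨fun _ => 0, fun z hz => ⟨0, ?_⟩⟩⟩
  have h1 := h ε h0 hε z hz
  obtain ⟨⟨h2, h3⟩, h4, h5⟩ := hV hz
  refine mul_le_mul h1 ?_ (by positivity) ((norm_nonneg _).trans h1)
  simp only [Prod.fst_zero, Prod.snd_zero, sub_zero, abs_of_nonneg h2, abs_of_nonneg h4]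
  linarith

end UniformBoundOn

/-- The Cauchy kernel between the shifted curve `g` and the curve `h`. -/
noncomputable def curveKernel (g h : ℝ → ℂ) (s ε x y : ℝ) : ℂ :=
  deriv h y / (h y - normalShift g s ε x)

/-- The Cauchy kernel of the real line. -/
noncomputable def flatKernel (s ε x y : ℝ) : ℂ := 1 / ((y : ℂ) - x - Complex.I * s * ε)

theorem measurable_curveKernel {g h : ℝ → ℂ} (hg : ContDiff ℝ ∞ g) (hh : ContDiff ℝ ∞ h) (s ε : ℝ) :
    Measurable (Function.uncurry (curveKernel g h s ε)) := by
  have h1 := (hh.continuous_deriv (by simp)).measurable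
  have h2 := hh.continuous.measurable
  have h3 : Measurable (normalShift g s ε) :=
    ((continuous_normalShift hg s).comp (continuous_const.prodMk continuous_id)).measurable
  exact (h1.comp measurable_snd).div ((h2.comp measurable_snd).sub (h3.comp measurable_fst))

theorem measurable_flatKernel (s ε : ℝ) : Measurable (Function.uncurry (flatKernel s ε)) := by
  unfold flatKernel Function.uncurry
  fun_prop

theorem norm_flat_denominator_ge {s : ℝ} (hs : s = 1 ∨ s = -1) (ε x y : ℝ) :
    (|y - x| + |ε|) / 2 ≤ ‖(y : ℂ) - x - Complex.I * s * ε‖ := by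
  have e2 := Complex.abs_re_le_norm ((y : ℂ) - x - Complex.I * s * ε)
  have e3 := Complex.abs_im_le_norm ((y : ℂ) - x - Complex.I * s * ε)
  have e4 : |s * ε| = |ε| := by rcases hs with rfl | rfl <;> simp
  have h1 : ((y : ℂ) - x - Complex.I * s * ε).re = y - x := by simp
  have h2 : ((y : ℂ) - x - Complex.I * s * ε).im = -(s * ε) := by simp
  rw [h1] at e2
  rw [h2, abs_neg, e4] at e3
  linarith

theorem norm_curveKernel_mul_le {g h : ℝ → ℂ} {s ε x y c D M : ℝ} (hc : 0 < c) (hD : 0 ≤ D)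
    (h1 : c * D ≤ ‖h y - normalShift g s ε x‖) (h2 : ‖deriv h y‖ ≤ M) :
    ‖curveKernel g h s ε x y‖ * D ≤ M / c := by
  have hM := (norm_nonneg _).trans h2
  rw [curveKernel, norm_div]
  rcases (norm_nonneg (h y - normalShift g s ε x)).eq_or_lt with hA | hA
  · rw [← hA, div_zero, zero_mul]
    positivity
  · rw [div_mul_eq_mul_div, div_le_div_iff₀ hA hc]
    calc ‖deriv h y‖ * D * c = ‖deriv h y‖ * (c * D) := by ring
      _ ≤ M * ‖h y - normalShift g s ε x‖ := by gcongr

theorem exists_uniformBoundOn_flatKernel {s : ℝ} (hs : s = 1 ∨ s = -1) {x₀ y₀ : ℝ} (hne : x₀ ≠ y₀) :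
    ∃ U ∈ 𝓝 (x₀, y₀), UniformBoundOn (flatKernel s) U := by
  have hd : 0 < |y₀ - x₀| := abs_pos.2 (sub_ne_zero.2 hne.symm)
  have hcont : Continuous fun z : ℝ × ℝ => |z.2 - z.1| := by fun_prop
  refine ⟨{z | |y₀ - x₀| / 2 < |z.2 - z.1|}, hcont.continuousAt.eventually (lt_mem_nhds
    (half_lt_self hd)), 4 / |y₀ - x₀|, 1, one_pos, fun ε h0 _ z hz => ?_⟩
  have h1 := norm_flat_denominator_ge hs ε z.1 z.2
  have h2 : |y₀ - x₀| / 2 < |z.2 - z.1| := hz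
  rw [flatKernel, norm_div, norm_one, div_le_div_iff₀ (by linarith [abs_nonneg ε]) hd]
  linarith [abs_nonneg ε]

theorem exists_uniformBoundOn_curveKernel {g h : ℝ → ℂ} (hg : ContDiff ℝ ∞ g)
    (hh : ContDiff ℝ ∞ h) (s : ℝ) {x₀ y₀ : ℝ} (hne : g x₀ ≠ h y₀) :
    ∃ U ∈ 𝓝 (x₀, y₀), UniformBoundOn (curveKernel g h s) U := by
  have h1 := continuous_normalShift hg s
  have hcont : ContinuousAt (fun p : ℝ × ℝ × ℝ =>
      ‖deriv h p.2.2 / (h p.2.2 - normalShift g s p.1 p.2.1)‖) (0, x₀, y₀) := by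
    have h2 := hh.continuous
    have h3 := hh.continuous_deriv (by simp)
    refine (ContinuousAt.div (by fun_prop) ?_ ?_).norm
    · exact (h2.comp continuous_snd.snd).continuousAt.sub
        (h1.comp (continuous_fst.prodMk continuous_snd.fst)).continuousAt
    · simp only [normalShift_zero]
      exact sub_ne_zero.2 hne.symm
  have h4 := hcont.eventually (gt_mem_nhds (lt_add_one _))
  rw [nhds_prod_eq] at h4
  obtain ⟨A, hA, U, hU, hAU⟩ := mem_prod_iff.1 h4
  obtain ⟨r, hr, hrA⟩ := Metric.mem_nhds_iff.1 hA
  refine ⟨U, hU, _, r, hr, fun ε h0 hε z hz => le_of_lt (hAU (mk_mem_prod (hrA ?_) hz))⟩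
  simpa [abs_of_nonneg h0] using hε

/-- On a regular arc the Cauchy kernel has exactly the singularity of the line kernel. Over a common
denominator the numerator is of second order in `|y - x| + |ε|`, and the denominator is a product of
two quantities of at least first order. -/
theorem exists_uniformBoundOn_diagonal {g : ℝ → ℂ} (hg : ContDiff ℝ ∞ g) {s : ℝ}
    (hs : s = 1 ∨ s = -1) {p : ℝ} (hp : deriv g p ≠ 0) :
    ∃ U ∈ 𝓝 (p, p), UniformBoundOn
      (fun ε x y => curveKernel g g s ε x y - flatKernel s ε x y) U := by
  obtain ⟨c, hc, r, hr, H⟩ := exists_norm_sub_normalShift_ge hg hs hp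
  have hg' : ContDiff ℝ ∞ (deriv g) := ((contDiff_infty_iff_deriv (𝕜 := ℝ)).1 hg).2
  obtain ⟨L, hL⟩ := (isCompact_closedBall p r).exists_bound_of_continuousOn
    (hg'.continuous_deriv (by simp)).continuousOn
  have hL0 : 0 ≤ L := (norm_nonneg _).trans (hL p (Metric.mem_closedBall_self hr.le))
  have hlip : ∀ x ∈ Metric.closedBall p r, ∀ y ∈ Metric.closedBall p r,
      ‖deriv g y - deriv g x‖ ≤ L * |y - x| := fun x hx y hy =>
    (convex_closedBall p r).norm_image_sub_le_of_norm_deriv_le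
      (fun t _ => (hg'.differentiable (by simp)).differentiableAt) hL hx hy
  have htay : ∀ x ∈ Metric.closedBall p r, ∀ y ∈ Metric.closedBall p r,
      ‖g y - g x - deriv g y * (y - x)‖ ≤ L * |y - x| * |y - x| := by
    intro x hx y hy
    have hseg : segment ℝ x y ⊆ Metric.closedBall p r := (convex_closedBall p r).segment_subset hx hy
    have := (convex_segment x y).norm_image_sub_le_of_norm_hasDerivWithin_le
      (f := fun t : ℝ => g t - deriv g y * t) (f' := fun t => deriv g t - deriv g y)
      (C := L * |y - x|) (x := x) (y := y) (fun t _ => ?_) (fun t ht => ?_)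
      (left_mem_segment ℝ x y) (right_mem_segment ℝ x y)
    · refine le_trans (le_of_eq ?_) this
      congr 1
      ring
    · have h1 : HasDerivAt (fun t : ℝ => deriv g y * (t : ℂ)) (deriv g y) t := by
        simpa using (Complex.ofRealCLM.hasDerivAt (x := t)).const_mul (deriv g y)
      exact ((hg.differentiable (by simp)).differentiableAt.hasDerivAt.sub h1).hasDerivWithinAt
    · refine (hlip y hy t (hseg ht)).trans (mul_le_mul_of_nonneg_left ?_ hL0)
      rw [segment_eq_uIcc] at ht
      rw [abs_sub_comm t y]
      exact abs_sub_right_of_mem_uIcc ht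
  refine ⟨Metric.ball (p, p) r, Metric.ball_mem_nhds _ hr, 2 * L / c, r, hr, fun ε h0 hε z hz => ?_⟩
  rw [Metric.mem_ball, Prod.dist_eq, sup_lt_iff, Real.dist_eq, Real.dist_eq] at hz
  obtain ⟨x, y⟩ := z
  obtain ⟨hx, hy⟩ := hz
  simp only at hx hy ⊢
  have h1 := H ε x y (by rwa [abs_of_nonneg h0]) hx hy
  have h2 := norm_flat_denominator_ge hs ε x y
  set A := g y - normalShift g s ε x with hA
  set B := (y : ℂ) - x - Complex.I * s * ε with hB
  set D := |y - x| + |ε| with hD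
  have hD0 : 0 ≤ D := by positivity
  rw [curveKernel, flatKernel, ← hA, ← hB]
  -- At `ε = 0` and `y = x` both denominators vanish, and both kernels are `0` by the convention on
  -- division.
  rcases hD0.eq_or_lt with hz | hpos
  · have e1 : |y - x| = 0 := by linarith [abs_nonneg (y - x), abs_nonneg ε]
    have e2 : |ε| = 0 := by linarith [abs_nonneg (y - x), abs_nonneg ε]
    have e3 : y = x := by linarith [abs_eq_zero.1 e1]
    have e4 : ε = 0 := abs_eq_zero.1 e2
    have hA0 : A = 0 := by rw [hA, e3, e4, normalShift_zero, sub_self]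
    have hB0 : B = 0 := by rw [hB, e3, e4]; simp
    rw [hA0, hB0]
    simp only [div_zero, sub_self, norm_zero]
    positivity
  · have hAn : 0 < ‖A‖ := lt_of_lt_of_le (by positivity) h1
    have hBn : 0 < ‖B‖ := lt_of_lt_of_le (by positivity) h2
    rw [div_sub_div _ _ (norm_pos_iff.1 hAn) (norm_pos_iff.1 hBn), norm_div, norm_mul,
      div_le_div_iff₀ (by positivity) hc]
    have hnum : ‖deriv g y * B - A * 1‖ ≤ L * D * D := by
      -- A Taylor remainder of `g` plus `ε` times an increment of `g'`; both are quadratically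
      -- small.
      have e1 : deriv g y * B - A * 1 = -(g y - g x - deriv g y * (y - x)) -
          Complex.I * s * ε * (deriv g y - deriv g x) := by
        rw [hA, hB, normalShift]; ring
      have hx' : x ∈ Metric.closedBall p r := by
        rw [Metric.mem_closedBall, Real.dist_eq]; exact hx.le
      have hy' : y ∈ Metric.closedBall p r := by
        rw [Metric.mem_closedBall, Real.dist_eq]; exact hy.le
      have e2 : ‖Complex.I * s * ε‖ = |ε| := by rcases hs with rfl | rfl <;> simp
      rw [e1]
      refine (norm_sub_le _ _).trans ?_
      rw [norm_neg, norm_mul, e2]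
      calc _ ≤ L * |y - x| * |y - x| + |ε| * (L * |y - x|) := by
            gcongr
            · exact htay x hx' y hy'
            · exact hlip x hx' y hy'
        _ = L * |y - x| * D := by rw [hD]; ring
        _ ≤ L * D * D := by
            gcongr
            rw [hD]; linarith [abs_nonneg ε]
    calc ‖deriv g y * B - A * 1‖ * c ≤ L * D * D * c := by gcongr
      _ = 2 * L * ((c * D) * (D / 2)) := by ring
      _ ≤ 2 * L * (‖A‖ * ‖B‖) := by gcongr

/-- At the junction of a closed curve, moving `y` by one period brings the pair near the diagonal,
where the lower bound is known. Inside the unit square the two parameters lie on opposite sides of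
the junction, so their distance is the sum of the distances to it: a Hilbert kernel centred at the
corner. -/
theorem exists_hilbertBoundOn_of_periodic {g : ℝ → ℂ} (hg : ContDiff ℝ ∞ g)
    (hper : Function.Periodic g 1) {s : ℝ} (hs : s = 1 ∨ s = -1) {x₀ y₀ : ℝ} (hx : deriv g x₀ ≠ 0)
    (h01 : x₀ = 0 ∧ y₀ = 1 ∨ x₀ = 1 ∧ y₀ = 0) :
    ∃ U ∈ 𝓝 (x₀, y₀), HilbertBoundOn (curveKernel g g s) (U ∩ Icc 0 1 ×ˢ Icc 0 1) := by
  obtain ⟨c, hc, r, hr, H⟩ := exists_norm_sub_normalShift_ge hg hs hx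
  obtain ⟨M, hM⟩ := (isCompact_Icc (a := (0 : ℝ)) (b := 1)).exists_bound_of_continuousOn
    (hg.continuous_deriv (by simp)).continuousOn
  refine ⟨Metric.ball (x₀, y₀) r, Metric.ball_mem_nhds _ hr, M / c, 1, r, hr,
    fun ε h0 hε => ⟨fun _ => (x₀, y₀), fun z hz => ⟨0, ?_⟩⟩⟩
  obtain ⟨hz, ⟨hx0, hx1⟩, hy0, hy1⟩ := hz
  rw [Metric.mem_ball, Prod.dist_eq, sup_lt_iff, Real.dist_eq, Real.dist_eq] at hz
  refine norm_curveKernel_mul_le hc (by positivity) ?_ (hM _ ⟨hy0, hy1⟩)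
  have hε' : |ε| < r := by rwa [abs_of_nonneg h0]
  rcases h01 with ⟨rfl, rfl⟩ | ⟨rfl, rfl⟩
  · have h1 := H ε z.1 (z.2 - 1) hε' hz.1 (by simpa using hz.2)
    rw [hper.sub_eq] at h1
    refine le_trans (mul_le_mul_of_nonneg_left ?_ hc.le) h1
    change |z.1 - 0| + |z.2 - 1| ≤ _
    rw [abs_of_nonneg (by linarith : 0 ≤ z.1 - 0), abs_of_nonpos (by linarith : z.2 - 1 ≤ 0),
      abs_of_nonpos (by linarith : z.2 - 1 - z.1 ≤ 0)]
    linarith [abs_nonneg ε]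
  · have h1 := H ε z.1 (z.2 + 1) hε' hz.1 (by simpa using hz.2)
    rw [hper z.2] at h1
    refine le_trans (mul_le_mul_of_nonneg_left ?_ hc.le) h1
    change |z.1 - 1| + |z.2 - 0| ≤ _
    rw [abs_of_nonpos (by linarith : z.1 - 1 ≤ 0), abs_of_nonneg (by linarith : 0 ≤ z.2 - 0),
      abs_of_nonneg (by linarith : 0 ≤ z.2 + 1 - z.1)]
    linarith [abs_nonneg ε]

theorem Function.Periodic.deriv_one_eq {g : ℝ → ℂ} (hg : Function.Periodic g 1) :
    deriv g 1 = deriv g 0 := by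
  have h : (fun x => g (x + 1)) = g := funext hg
  have := deriv_comp_add_const (f := g) 1 0
  rw [h, zero_add] at this
  exact this.symm

/-- A nonzero derivative prevents the points of a fibre from accumulating. -/
theorem finite_setOf_eq_of_deriv_ne_zero {g : ℝ → ℂ} (hg : Differentiable ℝ g) {K : Set ℝ}
    (hK : IsCompact K) (hd : ∀ x ∈ K, deriv g x ≠ 0) (z : ℂ) : {x ∈ K | g x = z}.Finite := by
  by_contra hinf
  obtain ⟨x, hx, hacc⟩ := Set.Infinite.exists_accPt_of_subset_isCompact hinf hK
    (fun y hy => hy.1)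
  have h1 : ∀ᶠ y in 𝓝[≠] x, g y ≠ z := (hg x).hasDerivAt.eventually_ne (hd x hx)
  rw [accPt_iff_frequently_nhdsNE] at hacc
  obtain ⟨y, hy1, hy2⟩ := (hacc.and_eventually h1).exists
  exact hy2 hy1.2

/-! ### Crossings, end points and the regular part of the kernel -/

namespace OrientedContour

variable {n : ℕ} (Γ : OrientedContour n)

/-- The crossings and end points of the contour. -/
def nodes : Set ℂ :=
  {z : ℂ | ∃ i j : Fin n, ∃ x ∈ Icc (0 : ℝ) 1, ∃ y ∈ Icc (0 : ℝ) 1,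
      (Function.Periodic (Γ.curve i) 1 → x ≠ 1) ∧ (Function.Periodic (Γ.curve j) 1 → y ≠ 1) ∧
      (i, x) ≠ (j, y) ∧ Γ.curve i x = z ∧ Γ.curve j y = z} ∪
    ((range fun i => Γ.curve i 0) ∪ range fun i => Γ.curve i 1)

/-- The nodes of the contour and their inverses. -/
def exceptional : Set ℂ := {z | z ∈ Γ.nodes ∨ z⁻¹ ∈ Γ.nodes}

theorem finite_exceptional : Γ.exceptional.Finite := by
  have h : Γ.nodes.Finite :=
    Γ.finite_crossings.union ((finite_range _).union (finite_range _))
  exact h.union (h.preimage inv_injective.injOn)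

theorem inv_mem_exceptional {z : ℂ} : z⁻¹ ∈ Γ.exceptional ↔ z ∈ Γ.exceptional := by
  simp only [exceptional, mem_ofPred_eq, inv_inv]
  exact or_comm

theorem curve_zero_mem_exceptional (i : Fin n) : Γ.curve i 0 ∈ Γ.exceptional :=
  Or.inl (Or.inr (Or.inl ⟨i, rfl⟩))

theorem curve_one_mem_exceptional (i : Fin n) : Γ.curve i 1 ∈ Γ.exceptional :=
  Or.inl (Or.inr (Or.inr ⟨i, rfl⟩))

variable {Γ}

/-- A coincidence of distinct parameters is a crossing unless it comes from the parameter `1` of a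
closed curve, and all end points are exceptional too. Hence the curves are jointly injective off the
exceptional set. -/
theorem eq_of_curve_eq {i j : Fin n} {x y : ℝ} (hx : x ∈ Icc (0 : ℝ) 1) (hy : y ∈ Icc (0 : ℝ) 1)
    (h : Γ.curve i x = Γ.curve j y) (hE : Γ.curve j y ∉ Γ.exceptional) : i = j ∧ x = y := by
  by_contra hne
  refine hE (Or.inl (Or.inl ⟨i, j, x, hx, y, hy, fun _ hx1 => ?_, fun _ hy1 => ?_, ?_, h, rfl⟩))
  · rw [← h, hx1] at hE
    exact hE (Γ.curve_one_mem_exceptional i)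
  · rw [hy1] at hE
    exact hE (Γ.curve_one_mem_exceptional j)
  · simpa [Prod.ext_iff] using hne

theorem eq_or_periodic_or_linearIndependent {i j : Fin n} {x y : ℝ} (hx : x ∈ Icc (0 : ℝ) 1)
    (hy : y ∈ Icc (0 : ℝ) 1) (h : Γ.curve i x = Γ.curve j y) :
    (i = j ∧ x = y) ∨
      (i = j ∧ Function.Periodic (Γ.curve i) 1 ∧ (x = 0 ∧ y = 1 ∨ x = 1 ∧ y = 0)) ∨
      LinearIndependent ℝ ![deriv (Γ.curve i) x, deriv (Γ.curve j) y] := by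
  -- On a closed curve the parameter `1` is replaced by `0`, with the same point and tangent, so
  -- that transversality becomes applicable.
  have red : ∀ (i : Fin n) (x : ℝ), x ∈ Icc (0 : ℝ) 1 → ∃ x' ∈ Icc (0 : ℝ) 1,
      Γ.curve i x' = Γ.curve i x ∧ deriv (Γ.curve i) x' = deriv (Γ.curve i) x ∧
      (Function.Periodic (Γ.curve i) 1 → x' ≠ 1) ∧
      (x' = x ∨ Function.Periodic (Γ.curve i) 1 ∧ x' = 0 ∧ x = 1) := by
    intro i x hx
    by_cases hp : Function.Periodic (Γ.curve i) 1 ∧ x = 1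
    · obtain ⟨hp, rfl⟩ := hp
      refine ⟨0, by simp, ?_, hp.deriv_one_eq.symm, by simp, Or.inr ⟨hp, rfl, rfl⟩⟩
      simpa using (hp 0).symm
    · exact ⟨x, hx, rfl, rfl, fun h h' => hp ⟨h, h'⟩, Or.inl rfl⟩
  obtain ⟨x', hx', e1, e2, e3, e4⟩ := red i x hx
  obtain ⟨y', hy', f1, f2, f3, f4⟩ := red j y hy
  by_cases hne : (i, x') = (j, y')
  · simp only [Prod.mk.injEq] at hne
    obtain ⟨rfl, rfl⟩ := hne
    rcases e4 with rfl | ⟨hp, rfl, rfl⟩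
    · rcases f4 with rfl | ⟨hp, rfl, rfl⟩
      · simp
      · exact Or.inr (Or.inl ⟨rfl, hp, Or.inl ⟨rfl, rfl⟩⟩)
    · rcases f4 with rfl | ⟨-, -, rfl⟩
      · exact Or.inr (Or.inl ⟨rfl, hp, Or.inr ⟨rfl, rfl⟩⟩)
      · simp
  · refine Or.inr (Or.inr ?_)
    rw [← e2, ← f2]
    exact Γ.transversal i j x' hx' y' hy' e3 f3 hne (by rw [e1, f1, h])

variable (Γ)

theorem differentiable_curve (i : Fin n) : Differentiable ℝ (Γ.curve i) :=
  (Γ.smooth i).differentiable (by simp)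

theorem continuous_curve (i : Fin n) : Continuous (Γ.curve i) := (Γ.smooth i).continuous

theorem continuous_deriv_curve (i : Fin n) : Continuous (deriv (Γ.curve i)) :=
  (Γ.smooth i).continuous_deriv (by simp)

/-- The parameters of exceptional points on a curve. -/
def exceptionalParams (i : Fin n) : Set ℝ := {x ∈ Icc (0 : ℝ) 1 | Γ.curve i x ∈ Γ.exceptional}

theorem finite_exceptionalParams (i : Fin n) : (Γ.exceptionalParams i).Finite := by
  have : Γ.exceptionalParams i =
      ⋃ z ∈ Γ.exceptional, {x ∈ Icc (0 : ℝ) 1 | Γ.curve i x = z} := by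
    ext x; simp [exceptionalParams]
  rw [this]
  exact Γ.finite_exceptional.biUnion fun z _ =>
    finite_setOf_eq_of_deriv_ne_zero (Γ.differentiable_curve i) isCompact_Icc (Γ.regular i) z

theorem zero_mem_exceptionalParams (i : Fin n) : (0 : ℝ) ∈ Γ.exceptionalParams i :=
  ⟨by simp, Γ.curve_zero_mem_exceptional i⟩

theorem ae_notMem_exceptionalParams (i : Fin n) :
    ∀ᵐ x ∂unitMeasure, x ∈ Icc (0 : ℝ) 1 ∧ Γ.curve i x ∉ Γ.exceptional := by
  filter_upwards [ae_restrict_mem measurableSet_Icc, ae_restrict_of_ae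
    (measure_eq_zero_iff_ae_notMem.1 ((Γ.finite_exceptionalParams i).measure_zero volume))]
    with x hx hx'
  exact ⟨hx, fun h => hx' ⟨hx, h⟩⟩

/-- The Cauchy kernel between the `i`-th and the `j`-th curve, minus its singular part. -/
noncomputable def regularKernel (i j : Fin n) (s ε x y : ℝ) : ℂ :=
  curveKernel (Γ.curve i) (Γ.curve j) s ε x y - if i = j then flatKernel s ε x y else 0

theorem regularKernel_self (i : Fin n) (s : ℝ) : Γ.regularKernel i i s = fun ε x y =>
    curveKernel (Γ.curve i) (Γ.curve i) s ε x y - flatKernel s ε x y := by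
  ext; simp [regularKernel]

theorem regularKernel_of_ne {i j : Fin n} (h : i ≠ j) (s : ℝ) :
    Γ.regularKernel i j s = curveKernel (Γ.curve i) (Γ.curve j) s := by
  ext; simp [regularKernel, h]

theorem measurable_regularKernel (i j : Fin n) (s ε : ℝ) :
    Measurable (Function.uncurry (Γ.regularKernel i j s ε)) := by
  have h1 := measurable_curveKernel (Γ.smooth i) (Γ.smooth j) s ε
  rcases eq_or_ne i j with rfl | h
  · rw [regularKernel_self]
    exact h1.sub (measurable_flatKernel s ε)
  · rwa [Γ.regularKernel_of_ne h]

theorem uniformBoundOn_regularKernel_of_ne (i j : Fin n) {s : ℝ} (hs : s = 1 ∨ s = -1) {x₀ y₀ : ℝ}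
    (h : Γ.curve i x₀ ≠ Γ.curve j y₀) :
    ∃ U ∈ 𝓝 (x₀, y₀), UniformBoundOn (Γ.regularKernel i j s) U := by
  obtain ⟨U, hU, hb⟩ := exists_uniformBoundOn_curveKernel (Γ.smooth i) (Γ.smooth j) s h
  rcases eq_or_ne i j with rfl | hij
  · have hxy : x₀ ≠ y₀ := by
      rintro rfl
      exact h rfl
    obtain ⟨U', hU', hb'⟩ := exists_uniformBoundOn_flatKernel hs hxy
    refine ⟨U ∩ U', inter_mem hU hU', ?_⟩
    have := (hb.mono inter_subset_left).sub (hb'.mono (inter_subset_right (s := U)))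
    rwa [regularKernel_self]
  · refine ⟨U, hU, ?_⟩
    rwa [Γ.regularKernel_of_ne hij]

theorem uniformBoundOn_regularKernel_diagonal (i : Fin n) {s : ℝ} (hs : s = 1 ∨ s = -1) {x₀ : ℝ}
    (h : x₀ ∈ Icc (0 : ℝ) 1) :
    ∃ U ∈ 𝓝 (x₀, x₀), UniformBoundOn (Γ.regularKernel i i s) U := by
  obtain ⟨U, hU, hb⟩ := exists_uniformBoundOn_diagonal (Γ.smooth i) hs (Γ.regular i x₀ h)
  refine ⟨U, hU, ?_⟩
  rwa [regularKernel_self]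

/-- Locally there are four cases: distinct points and the diagonal, where the kernel is bounded, and
the junction of a closed curve and a transversal crossing, where it is of Hilbert type. -/
theorem hilbertBoundOn_regularKernel (i j : Fin n) {s : ℝ} (hs : s = 1 ∨ s = -1) :
    HilbertBoundOn (Γ.regularKernel i j s) (Icc 0 1 ×ˢ Icc 0 1) := by
  have hcl : IsClosed (Icc (0 : ℝ) 1 ×ˢ Icc (0 : ℝ) 1) := isClosed_Icc.prod isClosed_Icc
  refine HilbertBoundOn.of_isCompact (isCompact_Icc.prod isCompact_Icc) ?_
  rintro ⟨x₀, y₀⟩ hz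
  have hadd : (∃ U ∈ 𝓝 (x₀, y₀), HilbertBoundOn (curveKernel (Γ.curve i) (Γ.curve j) s)
      (U ∩ Icc 0 1 ×ˢ Icc 0 1)) → (i = j → x₀ ≠ y₀) →
      ∃ U ∈ 𝓝 (x₀, y₀), HilbertBoundOn (Γ.regularKernel i j s) (U ∩ Icc 0 1 ×ˢ Icc 0 1) := by
    rintro ⟨U, hU, hb⟩ hne
    rcases eq_or_ne i j with rfl | hij
    · obtain ⟨U', hU', hb'⟩ := exists_uniformBoundOn_flatKernel hs (hne rfl)
      refine ⟨U ∩ U', inter_mem hU hU', ?_⟩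
      have h1 := (hb'.neg.mono (V := U ∩ U' ∩ Icc 0 1 ×ˢ Icc 0 1)
        (fun _ h => h.1.2)).hilbertBoundOn inter_subset_right
      have h2 := (hb.mono (V := U ∩ U' ∩ Icc 0 1 ×ˢ Icc 0 1) (fun _ h => ⟨h.1.1, h.2⟩)).add h1
      rw [regularKernel_self]
      simpa only [sub_eq_add_neg] using h2
    · refine ⟨U, hU, ?_⟩
      rwa [Γ.regularKernel_of_ne hij]
  have hbd : (∃ U ∈ 𝓝 (x₀, y₀), UniformBoundOn (Γ.regularKernel i j s) U) →
      ∃ U ∈ 𝓝 (x₀, y₀), HilbertBoundOn (Γ.regularKernel i j s) (U ∩ Icc 0 1 ×ˢ Icc 0 1) := by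
    rintro ⟨U, hU, hb⟩
    exact ⟨U, hU, (hb.mono inter_subset_left).hilbertBoundOn inter_subset_right⟩
  by_cases hc : Γ.curve i x₀ = Γ.curve j y₀
  · by_cases hd : i = j ∧ x₀ = y₀
    · obtain ⟨rfl, rfl⟩ := hd
      exact hbd (Γ.uniformBoundOn_regularKernel_diagonal i hs hz.1)
    · refine hadd ?_ fun h1 h2 => hd ⟨h1, h2⟩
      rcases eq_or_periodic_or_linearIndependent hz.1 hz.2 hc with h | ⟨rfl, hp, h01⟩ | h
      · exact absurd h hd
      · exact exists_hilbertBoundOn_of_periodic (Γ.smooth i) hp hs (Γ.regular i _ hz.1) h01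
      · exact exists_hilbertBoundOn_of_transversal (Γ.smooth i) (Γ.smooth j) s h hcl hz
  · exact hbd (Γ.uniformBoundOn_regularKernel_of_ne i j hs hc)

/-- At `ε = 0` the side is irrelevant. Hence the regular parts have the same limit from both sides,
and the jump comes from the line kernel alone. -/
theorem regularKernel_zero (i j : Fin n) (s : ℝ) :
    Γ.regularKernel i j s 0 = Γ.regularKernel i j 1 0 := by
  ext x y
  simp [regularKernel, curveKernel, flatKernel, normalShift_zero]

theorem tendsto_regularKernel (i j : Fin n) (s : ℝ) {x y : ℝ} (h : Γ.curve i x ≠ Γ.curve j y) :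
    Tendsto (fun ε => Γ.regularKernel i j s ε x y) (𝓝[>] 0) (𝓝 (Γ.regularKernel i j s 0 x y)) := by
  suffices ContinuousAt (fun ε => Γ.regularKernel i j s ε x y) 0 from
    this.tendsto.mono_left nhdsWithin_le_nhds
  have h1 : ContinuousAt (fun ε => curveKernel (Γ.curve i) (Γ.curve j) s ε x y) 0 := by
    refine ContinuousAt.div continuousAt_const (continuousAt_const.sub ?_) ?_
    · exact ((continuous_normalShift (Γ.smooth i) s).comp
        (continuous_id.prodMk continuous_const)).continuousAt
    · rw [normalShift_zero]
      exact sub_ne_zero.2 h.symm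
  rcases eq_or_ne i j with rfl | hij
  · simp only [regularKernel_self]
    refine h1.sub (ContinuousAt.div continuousAt_const (by fun_prop) ?_)
    have : x ≠ y := by
      rintro rfl
      exact h rfl
    simp only [Complex.ofReal_zero, mul_zero, sub_zero]
    rw [sub_ne_zero]
    exact_mod_cast this.symm
  · rwa [Γ.regularKernel_of_ne hij]

/-- The bad set consists of the exceptional parameters of the target curve. When `y` stays away from
it, the only coincidence left is `x = y` on the same curve, where subtracting the line kernel leaves
a bounded remainder. -/
theorem exists_tendsto_regularKernel (i j : Fin n) {s : ℝ} (hs : s = 1 ∨ s = -1) :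
    ∃ B : ℝ≥0, (∀ u, MemLp u 2 unitMeasure →
      MemLp (kernelOp (Γ.regularKernel i j 1 0) u) 2 unitMeasure ∧
      eLpNorm (kernelOp (Γ.regularKernel i j 1 0) u) 2 unitMeasure ≤ B * eLpNorm u 2 unitMeasure ∧
      Tendsto (fun ε => eLpNorm (fun x => kernelOp (Γ.regularKernel i j s ε) u x -
        kernelOp (Γ.regularKernel i j 1 0) u x) 2 unitMeasure) (𝓝[>] 0) (𝓝 0)) ∧
      ∀ᶠ ε in 𝓝[>] 0, ∀ u, MemLp u 2 unitMeasure → ∀ᵐ x ∂unitMeasure,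
        Integrable (fun y => Γ.regularKernel i j s ε x y * u y) unitMeasure := by
  rw [← Γ.regularKernel_zero i j s]
  refine exists_tendsto_kernelOp (Γ.measurable_regularKernel i j s)
    (Γ.hilbertBoundOn_regularKernel i j hs) (Γ.finite_exceptionalParams j).isClosed
    ((Γ.finite_exceptionalParams j).measure_zero volume) ⟨0, Γ.zero_mem_exceptionalParams j⟩ ?_ ?_
  · intro K hK hKc hKd
    have hE : ∀ y ∈ K, Γ.curve j y ∉ Γ.exceptional := fun y hy h =>
      Set.disjoint_left.1 hKd hy ⟨hK hy, h⟩
    have : UniformBoundOn (Γ.regularKernel i j s) (Icc 0 1 ×ˢ K) := by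
      refine UniformBoundOn.of_isCompact (isCompact_Icc.prod hKc) ?_
      rintro ⟨x₀, y₀⟩ hz
      obtain ⟨U, hU, hb⟩ : ∃ U ∈ 𝓝 (x₀, y₀), UniformBoundOn (Γ.regularKernel i j s) U := by
        by_cases hc : Γ.curve i x₀ = Γ.curve j y₀
        · obtain ⟨rfl, h2⟩ := eq_of_curve_eq hz.1 (hK hz.2) hc (hE _ hz.2)
          obtain rfl : x₀ = y₀ := h2
          exact Γ.uniformBoundOn_regularKernel_diagonal i hs hz.1
        · exact Γ.uniformBoundOn_regularKernel_of_ne i j hs hc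
      exact ⟨U, hU, hb.mono inter_subset_left⟩
    obtain ⟨C, r, hr, hb⟩ := this
    exact ⟨C, r, hr, fun ε h0 hε x hx y hy => hb ε h0 hε (x, y) ⟨hx, hy⟩⟩
  · intro x hx y hy hyE hne
    refine Γ.tendsto_regularKernel i j s fun h => hne ?_
    exact (eq_of_curve_eq hx hy h fun h' => hyE ⟨hy, h'⟩).2.symm

/-! ### Boundary values of scalar Cauchy integrals over the contour -/

/-- The scalar Cauchy integral `∫_Σ u(s) / (s - z) ds` of a function of the curve parameters. -/
noncomputable def cauchySum (u : Fin n → ℝ → ℂ) (z : ℂ) : ℂ :=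
  ∑ j, ∫ y, deriv (Γ.curve j) y * u j y / (Γ.curve j y - z) ∂unitMeasure

end OrientedContour

theorem integrable_flatKernel_mul {s : ℝ} (hs : s = 1 ∨ s = -1) {ε : ℝ} (hε : 0 < ε) {u : ℝ → ℂ}
    (hu : Integrable u unitMeasure) (x : ℝ) :
    Integrable (fun y => flatKernel s ε x y * u y) unitMeasure := by
  refine hu.bdd_mul (c := 2 / ε) (measurable_flatKernel s ε).of_uncurry_left.aestronglyMeasurable
    (Eventually.of_forall fun y => ?_)
  have h1 := norm_flat_denominator_ge hs ε x y
  rw [abs_of_pos hε] at h1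
  rw [flatKernel, norm_div, norm_one, div_le_div_iff₀ (by linarith [abs_nonneg (y - x)]) hε]
  linarith [abs_nonneg (y - x)]

/-- Extension by zero reduces the interval to the whole line. -/
theorem exists_boundary_flatKernel {u : ℝ → ℂ} (hu : MemLp u 2 unitMeasure) :
    ∃ v : ℝ → ℝ → ℂ, (∀ s : ℝ, s = 1 ∨ s = -1 → MemLp (v s) 2 unitMeasure ∧
        eLpNorm (v s) 2 unitMeasure ≤ ENNReal.ofReal (2 * Real.pi) * eLpNorm u 2 unitMeasure ∧
        Tendsto (fun ε : ℝ => eLpNorm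
          (fun x : ℝ => kernelOp (flatKernel s ε) u x - v s x) 2 unitMeasure) (𝓝[>] 0) (𝓝 0)) ∧
      ∀ᵐ x ∂unitMeasure, v 1 x - v (-1) x = 2 * Real.pi * Complex.I * u x := by
  have hu2 : MemLp ((Icc (0 : ℝ) 1).indicator u) 2 := (memLp_indicator_iff_restrict measurableSet_Icc).2 hu
  have hu1 : Integrable ((Icc (0 : ℝ) 1).indicator u) :=
    (integrable_indicator_iff measurableSet_Icc).2 (hu.integrable (by norm_num))
  obtain ⟨v, hv, hj⟩ := exists_boundary_integral_div_sub hu2 hu1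
  have hop : ∀ s ε x : ℝ, ∫ y : ℝ, (Icc (0 : ℝ) 1).indicator u y / (y - x - Complex.I * s * ε) =
      kernelOp (flatKernel s ε) u x := by
    intro s ε x
    rw [kernelOp, ← integral_indicator measurableSet_Icc]
    congr 1; ext y
    by_cases hy : y ∈ Icc (0 : ℝ) 1
    · simp only [indicator_of_mem hy, flatKernel]; ring
    · simp only [indicator_of_notMem hy, zero_div]
  refine ⟨v, fun s hs => ?_, ?_⟩
  · obtain ⟨h1, h2, h3⟩ := hv s hs
    refine ⟨h1.restrict _, ?_, ?_⟩
    · rw [eLpNorm_indicator_eq_eLpNorm_restrict measurableSet_Icc] at h2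
      exact (eLpNorm_mono_measure _ Measure.restrict_le_self).trans h2
    · simp only [hop] at h3
      refine tendsto_of_tendsto_of_tendsto_of_le_of_le tendsto_const_nhds h3 (fun _ => zero_le) ?_
      intro ε
      exact eLpNorm_mono_measure _ Measure.restrict_le_self
  · filter_upwards [ae_restrict_of_ae hj, ae_restrict_mem measurableSet_Icc] with x hx hxm
    rw [hx, indicator_of_mem hxm]

namespace OrientedContour

variable {n : ℕ} (Γ : OrientedContour n)

/-- Along the `i`-th shifted curve the Cauchy integral is the line integral of `u i` plus the
regular parts of all `u j`. The first supplies the jump; the others cancel in the difference of the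
two sides. -/
theorem exists_boundary_cauchySum : ∃ B : ℝ≥0, ∀ u : Fin n → ℝ → ℂ,
    (∀ j, MemLp (u j) 2 unitMeasure) → ∃ v : ℝ → Fin n → ℝ → ℂ,
      (∀ s : ℝ, s = 1 ∨ s = -1 → ∀ i, MemLp (v s i) 2 unitMeasure ∧
        eLpNorm (v s i) 2 unitMeasure ≤ B * ∑ j, eLpNorm (u j) 2 unitMeasure ∧
        Tendsto (fun ε : ℝ => eLpNorm (fun x : ℝ =>
          Γ.cauchySum u (normalShift (Γ.curve i) s ε x) - v s i x) 2 unitMeasure)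
          (𝓝[>] 0) (𝓝 0)) ∧
      ∀ i, ∀ᵐ x ∂unitMeasure, v 1 i x - v (-1) i x = 2 * Real.pi * Complex.I * u i x := by
  choose B hB using fun i j => Γ.exists_tendsto_regularKernel i j (s := 1) (Or.inl rfl)
  choose B' hB' using fun i j => Γ.exists_tendsto_regularKernel i j (s := -1) (Or.inr rfl)
  have hev : ∀ s : ℝ, s = 1 ∨ s = -1 → ∀ i j, ∀ᶠ ε in 𝓝[>] 0, ∀ u, MemLp u 2 unitMeasure →
      ∀ᵐ x ∂unitMeasure, Integrable (fun y => Γ.regularKernel i j s ε x y * u y) unitMeasure := by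
    rintro s (rfl | rfl) i j
    exacts [(hB i j).2, (hB' i j).2]
  have hlim : ∀ s : ℝ, s = 1 ∨ s = -1 → ∀ i j, ∀ u, MemLp u 2 unitMeasure →
      Tendsto (fun ε => eLpNorm (fun x => kernelOp (Γ.regularKernel i j s ε) u x -
        kernelOp (Γ.regularKernel i j 1 0) u x) 2 unitMeasure) (𝓝[>] 0) (𝓝 0) := by
    rintro s (rfl | rfl) i j u hu
    exacts [((hB i j).1 u hu).2.2, ((hB' i j).1 u hu).2.2]
  -- The bounds for `s = 1` suffice, since the limits of the regular parts do not depend on the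
  -- side.
  refine ⟨(2 * Real.pi).toNNReal + ∑ i, ∑ j, B i j, fun u hu => ?_⟩
  choose w hw hwj using fun i => exists_boundary_flatKernel (hu i)
  have hker : ∀ i j, MemLp (kernelOp (Γ.regularKernel i j 1 0) (u j)) 2 unitMeasure :=
    fun i j => ((hB i j).1 _ (hu j)).1
  have hsumfun : ∀ i, (fun x => ∑ j, kernelOp (Γ.regularKernel i j 1 0) (u j) x) =
      ∑ j, kernelOp (Γ.regularKernel i j 1 0) (u j) := by
    intro i; ext x; simp
  refine ⟨fun s i x => w i s x + ∑ j, kernelOp (Γ.regularKernel i j 1 0) (u j) x,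
    fun s hs i => ⟨?_, ?_, ?_⟩, fun i => ?_⟩
  · exact ((hw i s hs).1).add (memLp_finsetSum _ fun j _ => hker i j)
  · refine (eLpNorm_add_le (hw i s hs).1.1
      (memLp_finsetSum (f := fun j => kernelOp (Γ.regularKernel i j 1 0) (u j)) _
        fun j _ => hker i j).1 (by norm_num)).trans ?_
    push_cast
    rw [add_mul]
    gcongr
    · refine (hw i s hs).2.1.trans ?_
      exact mul_le_mul' le_rfl
        (Finset.single_le_sum (f := fun j => eLpNorm (u j) 2 unitMeasure) (fun _ _ => zero_le)
          (Finset.mem_univ i))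
    · rw [hsumfun]
      refine (eLpNorm_sum_le (fun j _ => (hker i j).1) (by norm_num)).trans ?_
      rw [Finset.mul_sum]
      refine Finset.sum_le_sum fun j _ => ((hB i j).1 _ (hu j)).2.1.trans ?_
      gcongr
      exact (Finset.single_le_sum (f := fun j => (B i j : ℝ≥0∞)) (fun _ _ => zero_le)
        (Finset.mem_univ j)).trans
        (Finset.single_le_sum (f := fun i => ∑ j, (B i j : ℝ≥0∞)) (fun _ _ => zero_le)
        (Finset.mem_univ i))
  · have hbound : Tendsto (fun ε => eLpNorm (fun x => kernelOp (flatKernel s ε) (u i) x - w i s x) 2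
        unitMeasure + ∑ j, eLpNorm (fun x => kernelOp (Γ.regularKernel i j s ε) (u j) x -
          kernelOp (Γ.regularKernel i j 1 0) (u j) x) 2 unitMeasure) (𝓝[>] 0) (𝓝 0) := by
      have h1 := (hw i s hs).2.2
      have h2 := tendsto_finsetSum Finset.univ fun j _ => hlim s hs i j (u j) (hu j)
      simpa using h1.add h2
    refine tendsto_of_tendsto_of_tendsto_of_le_of_le' tendsto_const_nhds hbound
      (Eventually.of_forall fun _ => zero_le) ?_
    filter_upwards [self_mem_nhdsWithin, eventually_all.2 fun j => hev s hs i j] with ε hε hint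
    have heq : (fun x => Γ.cauchySum u (normalShift (Γ.curve i) s ε x) -
        (w i s x + ∑ j, kernelOp (Γ.regularKernel i j 1 0) (u j) x)) =ᵐ[unitMeasure]
        (fun x => kernelOp (flatKernel s ε) (u i) x - w i s x) +
        ∑ j, fun x => kernelOp (Γ.regularKernel i j s ε) (u j) x -
          kernelOp (Γ.regularKernel i j 1 0) (u j) x := by
      filter_upwards [eventually_all.2 fun j => hint j (u j) (hu j)] with x hx
      have h1 : ∀ j, ∫ y, deriv (Γ.curve j) y * u j y /
          (Γ.curve j y - normalShift (Γ.curve i) s ε x) ∂unitMeasure =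
          kernelOp (Γ.regularKernel i j s ε) (u j) x +
            if j = i then kernelOp (flatKernel s ε) (u i) x else 0 := by
        intro j
        have h2 : ∫ y, deriv (Γ.curve j) y * u j y /
            (Γ.curve j y - normalShift (Γ.curve i) s ε x) ∂unitMeasure =
            kernelOp (curveKernel (Γ.curve i) (Γ.curve j) s ε) (u j) x := by
          rw [kernelOp]
          congr 1; ext y
          rw [curveKernel]; ring
        rw [h2]
        rcases eq_or_ne j i with rfl | hji
        · rw [if_pos rfl, kernelOp, kernelOp, kernelOp, ← integral_add (hx j)
            (integrable_flatKernel_mul hs hε ((hu j).integrable (by norm_num)) x)]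
          congr 1; ext y
          rw [regularKernel_self]; ring
        · rw [if_neg hji, add_zero, Γ.regularKernel_of_ne hji.symm]
      simp only [cauchySum, h1, Pi.add_apply, Finset.sum_apply, Finset.sum_add_distrib,
        Finset.sum_ite_eq', Finset.mem_univ, if_true, Finset.sum_sub_distrib]
      ring
    rw [eLpNorm_congr_ae heq]
    have hms : ∀ j, AEStronglyMeasurable (fun x => kernelOp (Γ.regularKernel i j s ε) (u j) x -
          kernelOp (Γ.regularKernel i j 1 0) (u j) x) unitMeasure := fun j =>
      (aestronglyMeasurable_kernelOp (Γ.measurable_regularKernel i j s ε) (hu j).1).sub (hker i j).1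
    refine (eLpNorm_add_le ((aestronglyMeasurable_kernelOp (measurable_flatKernel s ε) (hu i).1).sub
      (hw i s hs).1.1) (Finset.aestronglyMeasurable_sum _ fun j _ => hms j) (by norm_num)).trans ?_
    exact add_le_add le_rfl (eLpNorm_sum_le (fun j _ => hms j) (by norm_num))
  · filter_upwards [hwj i] with x hx
    rw [← hx]; ring

end OrientedContour

instance : IsProbabilityMeasure unitMeasure := ⟨by simp⟩

/-! ### Arc length and the curve parameters -/

namespace OrientedContour

variable {n : ℕ} (Γ : OrientedContour n)

/-- The parameters of the points on a curve that are not exceptional. -/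
def regularParams (i : Fin n) : Set ℝ := {x ∈ Icc (0 : ℝ) 1 | Γ.curve i x ∉ Γ.exceptional}

theorem measurableSet_regularParams (i : Fin n) : MeasurableSet (Γ.regularParams i) :=
  measurableSet_Icc.inter ((Γ.continuous_curve i).measurable
    Γ.finite_exceptional.measurableSet.compl)

theorem injOn_curve (i : Fin n) : InjOn (Γ.curve i) (Γ.regularParams i) :=
  fun _ hx _ hy h => (eq_of_curve_eq hx.1 hy.1 h hy.2).2

theorem measurableEmbedding_curve (i : Fin n) :
    MeasurableEmbedding fun x : Γ.regularParams i => Γ.curve i x := by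
  exact (Γ.continuous_curve i).continuousOn.measurableEmbedding
    (Γ.measurableSet_regularParams i) (Γ.injOn_curve i)

/-- Arc length on the parameter interval of the `i`-th curve. -/
noncomputable def speedMeasure (i : Fin n) : Measure ℝ :=
  unitMeasure.withDensity fun x => ENNReal.ofReal ‖deriv (Γ.curve i) x‖

theorem ae_speedMeasure_iff (i : Fin n) {p : ℝ → Prop} :
    (∀ᵐ x ∂Γ.speedMeasure i, p x) ↔ ∀ᵐ x ∂unitMeasure, p x := by
  have hm : Measurable fun x => ENNReal.ofReal ‖deriv (Γ.curve i) x‖ := by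
    have := Γ.continuous_deriv_curve i
    fun_prop
  rw [speedMeasure, ae_withDensity_iff hm]
  refine ⟨fun h => ?_, fun h => ?_⟩
  · filter_upwards [h, ae_restrict_mem measurableSet_Icc] with x hx hxm
    refine hx ?_
    simpa using Γ.regular i x hxm
  · filter_upwards [h] with x hx using fun _ => hx

theorem map_curve_eq (i : Fin n) : Measure.map (Γ.curve i) (Γ.speedMeasure i) =
    Measure.map (fun x : Γ.regularParams i => Γ.curve i x)
      (Measure.comap Subtype.val (Γ.speedMeasure i)) := by
  have h1 : (Γ.speedMeasure i).restrict (Γ.regularParams i) = Γ.speedMeasure i := by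
    refine Measure.restrict_eq_self_of_ae_mem ?_
    rw [ae_speedMeasure_iff]
    exact Γ.ae_notMem_exceptionalParams i
  conv_lhs => rw [← h1, ← map_comap_subtype_coe (Γ.measurableSet_regularParams i)]
  rw [Measure.map_map (Γ.continuous_curve i).measurable measurable_subtype_coe]
  rfl

theorem arcLength_eq : Γ.arcLength = ∑ i, Measure.map (Γ.curve i) (Γ.speedMeasure i) := rfl

/-- Off finitely many parameters each curve is a measurable embedding, and its speed is positive.
This is why the transfer needs no measurability of `p`. -/
theorem ae_arcLength_iff {p : ℂ → Prop} :
    (∀ᵐ z ∂Γ.arcLength, p z) ↔ ∀ i, ∀ᵐ x ∂unitMeasure, p (Γ.curve i x) := by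
  have h1 : (∀ᵐ z ∂Γ.arcLength, p z) ↔
      ∀ i, ∀ᵐ z ∂(Measure.map (Γ.curve i) (Γ.speedMeasure i)), p z := by
    simp only [ae_iff, arcLength_eq, Measure.coe_finsetSum, Finset.sum_apply,
      Finset.sum_eq_zero_iff, Finset.mem_univ, true_implies]
  rw [h1]
  refine forall_congr' fun i => ?_
  rw [map_curve_eq, (Γ.measurableEmbedding_curve i).ae_map_iff, ← Γ.ae_speedMeasure_iff i,
    ← (MeasurableEmbedding.subtype_coe (Γ.measurableSet_regularParams i)).ae_map_iff
      (p := fun x => p (Γ.curve i x)), map_comap_subtype_coe (Γ.measurableSet_regularParams i),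
    Measure.restrict_eq_self_of_ae_mem]
  rw [ae_speedMeasure_iff]
  exact Γ.ae_notMem_exceptionalParams i

theorem quasiMeasurePreserving_curve (i : Fin n) :
    Measure.QuasiMeasurePreserving (Γ.curve i) unitMeasure Γ.arcLength := by
  refine ⟨(Γ.continuous_curve i).measurable, Measure.AbsolutelyContinuous.mk fun s hsm hs => ?_⟩
  rw [Measure.map_apply (Γ.continuous_curve i).measurable hsm]
  exact measure_eq_zero_iff_ae_notMem.2
    (Γ.ae_arcLength_iff.1 (measure_eq_zero_iff_ae_notMem.1 hs) i)

variable {E : Type*} [NormedAddCommGroup E]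

/-- Off the exceptional points the curves are disjoint and injective. The functions can be
transported to their images, extended by zero and added. -/
theorem exists_strongly_measurable_glue (v : Fin n → ℝ → E)
    (hv : ∀ i, AEStronglyMeasurable (v i) unitMeasure) :
    ∃ h : ℂ → E, StronglyMeasurable h ∧ ∀ i, ∀ᵐ x ∂unitMeasure, h (Γ.curve i x) = v i x := by
  refine ⟨∑ i, Function.extend (fun x : Γ.regularParams i => Γ.curve i x)
    (fun x => (hv i).mk (v i) x) 0, ?_, fun i => ?_⟩
  · exact Finset.stronglyMeasurable_sum _ fun i _ => (Γ.measurableEmbedding_curve i).stronglyMeasurable_extend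
      ((hv i).stronglyMeasurable_mk.comp_measurable measurable_subtype_coe) stronglyMeasurable_zero
  · filter_upwards [(hv i).ae_eq_mk, Γ.ae_notMem_exceptionalParams i] with x hx hxr
    rw [Finset.sum_apply, Finset.sum_eq_single i, hx]
    · exact (Γ.measurableEmbedding_curve i).injective.extend_apply _ _
        (⟨x, hxr⟩ : Γ.regularParams i)
    · intro j _ hji
      rw [Function.extend_apply']
      · rfl
      · rintro ⟨y, hy⟩
        exact hji (eq_of_curve_eq y.2.1 hxr.1 hy hxr.2).1
    · simp

theorem exists_speed_bounds : ∃ m M : ℝ, 0 < m ∧ 0 < M ∧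
    ∀ i, ∀ x ∈ Icc (0 : ℝ) 1, m ≤ ‖deriv (Γ.curve i) x‖ ∧ ‖deriv (Γ.curve i) x‖ ≤ M := by
  have h1 : ∀ i, ∃ m > 0, ∀ x ∈ Icc (0 : ℝ) 1, m ≤ ‖deriv (Γ.curve i) x‖ := by
    intro i
    obtain ⟨x, hx, hmin⟩ := (isCompact_Icc (a := (0 : ℝ)) (b := 1)).exists_isMinOn ⟨0, by simp⟩
      (Γ.continuous_deriv_curve i).norm.continuousOn
    exact ⟨_, norm_pos_iff.2 (Γ.regular i x hx), fun y hy => hmin hy⟩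
  have h2 : ∀ i, ∃ M, ∀ x ∈ Icc (0 : ℝ) 1, ‖deriv (Γ.curve i) x‖ ≤ M := fun i =>
    (isCompact_Icc (a := (0 : ℝ)) (b := 1)).exists_bound_of_continuousOn
      (Γ.continuous_deriv_curve i).continuousOn
  choose m hm hmb using h1
  choose M hM using h2
  -- The contour may consist of no curves at all; then any constant serves.
  have hm' : ∃ c > 0, ∀ i, c ≤ m i := by
    rcases isEmpty_or_nonempty (Fin n) with hn | hn
    · exact ⟨1, one_pos, fun i => hn.elim i⟩
    · obtain ⟨i, hi⟩ := Finite.exists_min m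
      exact ⟨m i, hm i, hi⟩
  obtain ⟨c, hc, hcm⟩ := hm'
  refine ⟨c, 1 + ∑ i, |M i|, hc, by positivity, fun i x hx => ⟨(hcm i).trans (hmb i x hx), ?_⟩⟩
  have h3 := Finset.single_le_sum (f := fun i => |M i|) (fun _ _ => abs_nonneg _) (Finset.mem_univ i)
  linarith [hM i x hx, le_abs_self (M i)]

/-- The speed is bounded below, so parameter measure is at most a multiple of arc length; the
constant enters the `L²` norm through its square root. -/
theorem exists_eLpNorm_curve_le : ∃ B : ℝ≥0, ∀ f : ℂ → E, AEStronglyMeasurable f Γ.arcLength →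
    ∀ i, eLpNorm (fun x => f (Γ.curve i x)) 2 unitMeasure ≤ B * eLpNorm f 2 Γ.arcLength := by
  obtain ⟨m, M, hm, hM, hb⟩ := Γ.exists_speed_bounds
  have hle : ∀ i, unitMeasure ≤ ENNReal.ofReal m⁻¹ • Γ.speedMeasure i := by
    intro i
    have h1 : unitMeasure = ENNReal.ofReal m⁻¹ • ENNReal.ofReal m • unitMeasure := by
      rw [smul_smul, ← ENNReal.ofReal_mul (by positivity), inv_mul_cancel₀ hm.ne',
        ENNReal.ofReal_one, one_smul]
    have h2 : ENNReal.ofReal m • unitMeasure ≤ Γ.speedMeasure i := by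
      rw [speedMeasure, ← withDensity_const]
      refine withDensity_mono ?_
      filter_upwards [ae_restrict_mem measurableSet_Icc] with x hx
      exact ENNReal.ofReal_le_ofReal (hb i x hx).1
    conv_lhs => rw [h1]
    exact Measure.le_iff'.2 fun s => mul_le_mul_right (h2 s) _
  refine ⟨(m⁻¹).toNNReal ^ (1 / 2 : ℝ), fun f hf i => ?_⟩
  have hle2 : Measure.map (Γ.curve i) (Γ.speedMeasure i) ≤ Γ.arcLength := by
    rw [arcLength_eq]
    exact Finset.single_le_sum (f := fun i => Measure.map (Γ.curve i) (Γ.speedMeasure i))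
      (fun _ _ => Measure.zero_le _) (Finset.mem_univ i)
  calc eLpNorm (fun x => f (Γ.curve i x)) 2 unitMeasure
      ≤ eLpNorm (fun x => f (Γ.curve i x)) 2 (ENNReal.ofReal m⁻¹ • Γ.speedMeasure i) :=
        eLpNorm_mono_measure _ (hle i)
    _ = ENNReal.ofReal m⁻¹ ^ (1 / 2 : ℝ) * eLpNorm (fun x => f (Γ.curve i x)) 2 (Γ.speedMeasure i) := by
        rw [eLpNorm_smul_measure_of_ne_zero (by simpa using hm)]
        simp
    _ = ENNReal.ofReal m⁻¹ ^ (1 / 2 : ℝ) *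
          eLpNorm f 2 (Measure.map (Γ.curve i) (Γ.speedMeasure i)) := by
        rw [eLpNorm_map_measure (hf.mono_measure hle2) (Γ.continuous_curve i).aemeasurable]
        rfl
    _ ≤ ENNReal.ofReal m⁻¹ ^ (1 / 2 : ℝ) * eLpNorm f 2 Γ.arcLength := by
        gcongr
    _ = _ := by
        rw [ENNReal.coe_rpow_of_nonneg _ (by norm_num)]
        rfl

theorem exists_eLpNorm_arcLength_le : ∃ B : ℝ≥0, ∀ f : ℂ → E, AEStronglyMeasurable f Γ.arcLength →
    eLpNorm f 2 Γ.arcLength ≤ B * ∑ i, eLpNorm (fun x => f (Γ.curve i x)) 2 unitMeasure := by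
  obtain ⟨m, M, hm, hM, hb⟩ := Γ.exists_speed_bounds
  have hle : ∀ i, Γ.speedMeasure i ≤ ENNReal.ofReal M • unitMeasure := by
    intro i
    rw [speedMeasure, ← withDensity_const]
    refine withDensity_mono ?_
    filter_upwards [ae_restrict_mem measurableSet_Icc] with x hx
    exact ENNReal.ofReal_le_ofReal (hb i x hx).2
  refine ⟨M.toNNReal ^ (1 / 2 : ℝ), fun f hf => ?_⟩
  have hle2 : ∀ i, Measure.map (Γ.curve i) (Γ.speedMeasure i) ≤ Γ.arcLength := by
    intro i
    rw [arcLength_eq]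
    exact Finset.single_le_sum (f := fun i => Measure.map (Γ.curve i) (Γ.speedMeasure i))
      (fun _ _ => Measure.zero_le _) (Finset.mem_univ i)
  -- Subadditivity of the square root turns the norm for a sum of measures into a sum of norms.
  have hsub : ∀ (s : Finset (Fin n)) (a : Fin n → ℝ≥0∞),
      (∑ i ∈ s, a i) ^ (1 / 2 : ℝ) ≤ ∑ i ∈ s, a i ^ (1 / 2 : ℝ) := by
    intro s a
    induction s using Finset.cons_induction with
    | empty => simp
    | cons i s hi ih =>
      rw [Finset.sum_cons, Finset.sum_cons]
      exact (ENNReal.rpow_add_le_add_rpow _ _ (by norm_num) (by norm_num)).trans (by gcongr)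
  have h1 : eLpNorm f 2 Γ.arcLength ≤
      ∑ i, eLpNorm f 2 (Measure.map (Γ.curve i) (Γ.speedMeasure i)) := by
    simp only [eLpNorm_eq_lintegral_rpow_enorm_toReal (two_ne_zero : (2 : ℝ≥0∞) ≠ 0)
      ENNReal.ofNat_ne_top, ENNReal.toReal_ofNat]
    refine le_trans ?_ (hsub _ _)
    rw [arcLength_eq, lintegral_finsetSum_measure]
  refine h1.trans ?_
  rw [Finset.mul_sum]
  refine Finset.sum_le_sum fun i _ => ?_
  calc eLpNorm f 2 (Measure.map (Γ.curve i) (Γ.speedMeasure i))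
      = eLpNorm (fun x => f (Γ.curve i x)) 2 (Γ.speedMeasure i) := by
        rw [eLpNorm_map_measure (hf.mono_measure (hle2 i)) (Γ.continuous_curve i).aemeasurable]
        rfl
    _ ≤ eLpNorm (fun x => f (Γ.curve i x)) 2 (ENNReal.ofReal M • unitMeasure) :=
        eLpNorm_mono_measure _ (hle i)
    _ = ENNReal.ofReal M ^ (1 / 2 : ℝ) * eLpNorm (fun x => f (Γ.curve i x)) 2 unitMeasure := by
        rw [eLpNorm_smul_measure_of_ne_zero (by simpa using hM)]
        simp
    _ = _ := by
        rw [ENNReal.coe_rpow_of_nonneg _ (by norm_num)]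
        rfl

theorem memLp_curve {f : ℂ → E} (hf : MemLp f 2 Γ.arcLength) (i : Fin n) :
    MemLp (fun x => f (Γ.curve i x)) 2 unitMeasure := by
  obtain ⟨B, hB⟩ := Γ.exists_eLpNorm_curve_le (E := E)
  exact ⟨hf.1.comp_quasiMeasurePreserving (Γ.quasiMeasurePreserving_curve i),
    (hB f hf.1 i).trans_lt (ENNReal.mul_lt_top ENNReal.coe_lt_top hf.2)⟩

theorem memLp_arcLength {f : ℂ → E} (hf : AEStronglyMeasurable f Γ.arcLength)
    (h : ∀ i, MemLp (fun x => f (Γ.curve i x)) 2 unitMeasure) : MemLp f 2 Γ.arcLength := by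
  obtain ⟨B, hB⟩ := Γ.exists_eLpNorm_arcLength_le (E := E)
  exact ⟨hf, (hB f hf).trans_lt (ENNReal.mul_lt_top ENNReal.coe_lt_top
    (ENNReal.sum_lt_top.2 fun i _ => (h i).2))⟩

end OrientedContour

/-! ### The Cauchy operator on row vectors -/

theorem MeasureTheory.eLpNorm_pi_le {α ι : Type*} [Fintype ι] [MeasurableSpace α] {μ : Measure α}
    {g : α → ι → ℂ} (hg : ∀ k, AEStronglyMeasurable (fun x => g x k) μ) :
    eLpNorm g 2 μ ≤ ∑ k, eLpNorm (fun x => g x k) 2 μ := by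
  calc eLpNorm g 2 μ ≤ eLpNorm (∑ k, fun x => ‖g x k‖) 2 μ := by
        refine eLpNorm_mono fun x => ?_
        rw [Finset.sum_apply, Real.norm_eq_abs, abs_of_nonneg (by positivity)]
        exact pi_norm_le_iff_of_nonneg (by positivity) |>.2 fun k =>
          Finset.single_le_sum (f := fun k => ‖g x k‖) (fun _ _ => norm_nonneg _) (Finset.mem_univ k)
    _ ≤ ∑ k, eLpNorm (fun x => ‖g x k‖) 2 μ :=
        eLpNorm_sum_le (fun k _ => (hg k).norm) (by norm_num)
    _ = _ := by simp only [eLpNorm_norm]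

theorem MeasureTheory.eLpNorm_apply_le {α ι : Type*} [Fintype ι] [MeasurableSpace α] {μ : Measure α}
    (g : α → ι → ℂ) (k : ι) : eLpNorm (fun x => g x k) 2 μ ≤ eLpNorm g 2 μ :=
  eLpNorm_mono fun x => norm_le_pi_norm (g x) k

namespace OrientedContour

variable {n : ℕ} (Γ : OrientedContour n)

theorem isCompact_carrier : IsCompact Γ.carrier :=
  isCompact_iUnion fun i => isCompact_Icc.image (Γ.continuous_curve i)

theorem curve_mem_carrier (i : Fin n) {x : ℝ} (hx : x ∈ Icc (0 : ℝ) 1) : Γ.curve i x ∈ Γ.carrier :=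
  mem_iUnion.2 ⟨i, mem_image_of_mem _ hx⟩

theorem exists_dist_ge {z : ℂ} (hz : z ∉ Γ.carrier) :
    ∃ δ > 0, ∀ s ∈ Γ.carrier, δ ≤ dist z s := by
  obtain ⟨δ, hδ, h⟩ := Metric.isOpen_iff.1 Γ.isCompact_carrier.isClosed.isOpen_compl z hz
  refine ⟨δ, hδ, fun s hs => ?_⟩
  by_contra hlt
  exact h (Metric.mem_ball'.2 (not_le.1 hlt)) hs

theorem integrable_cauchy_of_dist_ge {u : ℝ → ℂ} (hu : Integrable u unitMeasure) (j : Fin n) {z : ℂ}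
    (hz : z ∉ Γ.carrier) :
    Integrable (fun y => deriv (Γ.curve j) y * u y / (Γ.curve j y - z)) unitMeasure := by
  have hne : ∀ y ∈ Icc (0 : ℝ) 1, Γ.curve j y - z ≠ 0 := fun y hy h =>
    hz (by rw [← sub_eq_zero.1 h]; exact Γ.curve_mem_carrier j hy)
  have hcont : ContinuousOn (fun y => deriv (Γ.curve j) y / (Γ.curve j y - z)) (Icc 0 1) :=
    (Γ.continuous_deriv_curve j).continuousOn.div
      ((Γ.continuous_curve j).sub continuous_const).continuousOn hne
  have := IntegrableOn.continuousOn_mul hcont hu isCompact_Icc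
  refine this.congr (Eventually.of_forall fun y => ?_)
  simp only
  ring

/-- At distance `δ` the kernel is at most `M / δ`, and on a probability space the `L¹` norm is at
most the `L²` norm. -/
theorem exists_enorm_cauchySum_le : ∃ C > 0, ∀ u : Fin n → ℝ → ℂ,
    (∀ j, MemLp (u j) 2 unitMeasure) → ∀ δ > 0, ∀ z, (∀ s ∈ Γ.carrier, δ ≤ dist z s) →
      ‖Γ.cauchySum u z‖ₑ ≤ ENNReal.ofReal (C / δ) * ∑ j, eLpNorm (u j) 2 unitMeasure := by
  obtain ⟨m, M, hm, hM, hb⟩ := Γ.exists_speed_bounds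
  refine ⟨M, hM, fun u hu δ hδ z hz => ?_⟩
  rw [cauchySum, Finset.mul_sum]
  refine (enorm_sum_le _ _).trans (Finset.sum_le_sum fun j _ => ?_)
  calc ‖∫ y, deriv (Γ.curve j) y * u j y / (Γ.curve j y - z) ∂unitMeasure‖ₑ
      ≤ ∫⁻ y, ‖deriv (Γ.curve j) y * u j y / (Γ.curve j y - z)‖ₑ ∂unitMeasure :=
        enorm_integral_le_lintegral_enorm _
    _ ≤ ∫⁻ y, ENNReal.ofReal (M / δ) * ‖u j y‖ₑ ∂unitMeasure := by
        refine lintegral_mono_ae ?_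
        filter_upwards [ae_restrict_mem measurableSet_Icc] with y hy
        rw [← ofReal_norm, ← ofReal_norm, ← ENNReal.ofReal_mul (by positivity)]
        apply ENNReal.ofReal_le_ofReal
        have h1 : δ ≤ ‖Γ.curve j y - z‖ := by
          rw [← dist_eq_norm, dist_comm]
          exact hz _ (Γ.curve_mem_carrier j hy)
        rw [norm_div, norm_mul, div_mul_eq_mul_div]
        gcongr
        exact (hb j y hy).2
    _ = ENNReal.ofReal (M / δ) * eLpNorm (u j) 1 unitMeasure := by
        rw [lintegral_const_mul' _ _ ENNReal.ofReal_ne_top, eLpNorm_one_eq_lintegral_enorm]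
    _ ≤ _ := by
        gcongr
        exact eLpNorm_le_eLpNorm_of_exponent_le (by norm_num) (hu j).1

/-- Near a crossing the shifted curve may meet another part of the contour, so integrability can be
claimed only for almost every `x`. -/
theorem eventually_ae_integrable_cauchy {s : ℝ} (hs : s = 1 ∨ s = -1) (i j : Fin n) :
    ∀ᶠ ε in 𝓝[>] 0, ∀ u, MemLp u 2 unitMeasure → ∀ᵐ x ∂unitMeasure, Integrable (fun y =>
      deriv (Γ.curve j) y * u y / (Γ.curve j y - normalShift (Γ.curve i) s ε x)) unitMeasure := by
  obtain ⟨-, -, hint⟩ := Γ.exists_tendsto_regularKernel i j hs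
  filter_upwards [hint, self_mem_nhdsWithin] with ε hε hpos u hu
  filter_upwards [hε u hu] with x hx
  rcases eq_or_ne i j with rfl | hij
  · refine (hx.add (integrable_flatKernel_mul hs hpos (hu.integrable (by norm_num)) x)).congr
      (Eventually.of_forall fun y => ?_)
    simp only [Pi.add_apply, regularKernel_self, curveKernel]
    ring
  · refine hx.congr (Eventually.of_forall fun y => ?_)
    rw [Γ.regularKernel_of_ne hij]
    simp only [curveKernel]
    ring

theorem aestronglyMeasurable_cauchySum_normalShift {u : Fin n → ℝ → ℂ}
    (hu : ∀ j, MemLp (u j) 2 unitMeasure) (i : Fin n) (s ε : ℝ) :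
    AEStronglyMeasurable (fun x => Γ.cauchySum u (normalShift (Γ.curve i) s ε x)) unitMeasure := by
  refine Finset.aestronglyMeasurable_fun_sum _ fun j _ => ?_
  refine (aestronglyMeasurable_kernelOp (measurable_curveKernel (Γ.smooth i) (Γ.smooth j) s ε)
    (hu j).1).congr (Eventually.of_forall fun x => ?_)
  simp only [kernelOp, curveKernel]
  congr 1; ext y; ring

/-- The components of a function on the contour, in terms of the curve parameters. -/
def pullback (f : ℂ → Fin 2 → ℂ) (k : Fin 2) (j : Fin n) (y : ℝ) : ℂ := f (Γ.curve j y) k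

theorem memLp_pullback {f : ℂ → Fin 2 → ℂ} (hf : MemLp f 2 Γ.arcLength) (k : Fin 2) (j : Fin n) :
    MemLp (Γ.pullback f k j) 2 unitMeasure :=
  (memLp_pi_iff.1 (Γ.memLp_curve hf j)) k

end OrientedContour

/-- The point at which the `k`-th diagonal entry of the Cauchy kernel vanishes. -/
noncomputable def kernelPole (ζ : ℝ) (k : Fin 2) : ℂ := ![(ζ : ℂ)⁻¹, (ζ : ℂ)] k

theorem vecMul_cauchyKernel (ζ : ℝ) (v : Fin 2 → ℂ) (s z : ℂ) (k : Fin 2) :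
    (v ᵥ* cauchyKernel ζ s z) k = v k * (1 / (s - z) - 1 / (s - kernelPole ζ k)) := by
  rw [cauchyKernel, Matrix.vecMul_diagonal]
  fin_cases k <;> simp [kernelPole]

namespace OrientedContour

variable {n : ℕ} (Γ : OrientedContour n)

/-- Integrability of all components is required even for a single one, because the integral of a
vector function that is not integrable is `0` by convention. -/
theorem lineIntegral_apply {g : ℂ → Fin 2 → ℂ}
    (hg : ∀ j k, Integrable (fun y => deriv (Γ.curve j) y * g (Γ.curve j y) k) unitMeasure)
    (k : Fin 2) : Γ.lineIntegral g k =
      ∑ j, ∫ y, deriv (Γ.curve j) y * g (Γ.curve j y) k ∂unitMeasure := by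
  rw [lineIntegral, Finset.sum_apply]
  refine Finset.sum_congr rfl fun j _ => ?_
  rw [intervalIntegral.integral_of_le zero_le_one, ← integral_Icc_eq_integral_Ioc,
    eval_integral (fun k => by simpa using hg j k)]
  rfl

theorem cauchyOp_apply {ζ : ℝ} (hζ : ∀ k, kernelPole ζ k ∉ Γ.carrier) {f : ℂ → Fin 2 → ℂ}
    (hf : MemLp f 2 Γ.arcLength) {z : ℂ}
    (hz : ∀ j k, Integrable (fun y => deriv (Γ.curve j) y * Γ.pullback f k j y /
      (Γ.curve j y - z)) unitMeasure) (k : Fin 2) :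
    Γ.cauchyOp ζ f z k = (2 * Real.pi * Complex.I)⁻¹ *
      (Γ.cauchySum (Γ.pullback f k) z - Γ.cauchySum (Γ.pullback f k) (kernelPole ζ k)) := by
  have hpole : ∀ j k, Integrable (fun y => deriv (Γ.curve j) y * Γ.pullback f k j y /
      (Γ.curve j y - kernelPole ζ k)) unitMeasure := fun j k =>
    Γ.integrable_cauchy_of_dist_ge ((Γ.memLp_pullback hf k j).integrable (by norm_num)) j (hζ k)
  have heq : ∀ j k, (fun y => deriv (Γ.curve j) y *
      (f (Γ.curve j y) ᵥ* cauchyKernel ζ (Γ.curve j y) z) k) = fun y =>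
      deriv (Γ.curve j) y * Γ.pullback f k j y / (Γ.curve j y - z) -
      deriv (Γ.curve j) y * Γ.pullback f k j y / (Γ.curve j y - kernelPole ζ k) := by
    intro j k
    ext y
    rw [vecMul_cauchyKernel, pullback]
    ring
  rw [cauchyOp, Pi.smul_apply, smul_eq_mul,
    lineIntegral_apply Γ (fun j k => by rw [heq]; exact (hz j k).sub (hpole j k)),
    cauchySum, cauchySum, ← Finset.sum_sub_distrib]
  congr 1
  refine Finset.sum_congr rfl fun j _ => ?_
  rw [heq, integral_sub (hz j k) (hpole j k)]

theorem cauchyOp_apply_of_notMem {ζ : ℝ} (hζ : ∀ k, kernelPole ζ k ∉ Γ.carrier)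
    {f : ℂ → Fin 2 → ℂ} (hf : MemLp f 2 Γ.arcLength) {z : ℂ} (hz : z ∉ Γ.carrier) (k : Fin 2) :
    Γ.cauchyOp ζ f z k = (2 * Real.pi * Complex.I)⁻¹ *
      (Γ.cauchySum (Γ.pullback f k) z - Γ.cauchySum (Γ.pullback f k) (kernelPole ζ k)) :=
  Γ.cauchyOp_apply hζ hf (fun j k => Γ.integrable_cauchy_of_dist_ge
    ((Γ.memLp_pullback hf k j).integrable (by norm_num)) j hz) k

end OrientedContour

theorem MeasureTheory.aestronglyMeasurable_pi {α ι : Type*} [Fintype ι] [MeasurableSpace α]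
    {μ : Measure α} {g : α → ι → ℂ} (hg : ∀ k, AEStronglyMeasurable (fun x => g x k) μ) :
    AEStronglyMeasurable g μ :=
  (aemeasurable_pi_iff.2 fun k => (hg k).aemeasurable).aestronglyMeasurable

/-! ### Boundary values of the Cauchy operator -/

namespace OrientedContour

variable {n : ℕ} {Γ : OrientedContour n} {ζ : ℝ}

theorem IsSymmetric.kernelPole_notMem (hΓ : Γ.IsSymmetric ζ) (k : Fin 2) :
    kernelPole ζ k ∉ Γ.carrier := by
  fin_cases k
  · intro h
    obtain ⟨i, x, hx, h⟩ := mem_iUnion.1 h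
    obtain ⟨j, y, hy, h1, -⟩ := hΓ.inversion i x hx
    refine hΓ.zeta_notMem ?_
    have : (ζ : ℂ) = Γ.curve j y := by rw [h1, h]; simp [kernelPole]
    exact this ▸ Γ.curve_mem_carrier j hy
  · exact hΓ.zeta_notMem

theorem cauchyOp_normalShift (hζ : ∀ k, kernelPole ζ k ∉ Γ.carrier) {f : ℂ → Fin 2 → ℂ}
    (hf : MemLp f 2 Γ.arcLength) {s : ℝ} (hs : s = 1 ∨ s = -1) (i : Fin n) :
    ∀ᶠ ε in 𝓝[>] 0, ∀ᵐ x ∂unitMeasure, ∀ k,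
      Γ.cauchyOp ζ f (normalShift (Γ.curve i) s ε x) k = (2 * Real.pi * Complex.I)⁻¹ *
        (Γ.cauchySum (Γ.pullback f k) (normalShift (Γ.curve i) s ε x) -
          Γ.cauchySum (Γ.pullback f k) (kernelPole ζ k)) := by
  have h := eventually_all.2 fun j => Γ.eventually_ae_integrable_cauchy hs i j
  filter_upwards [h] with ε hε
  have h2 : ∀ᵐ x ∂unitMeasure, ∀ j k, Integrable (fun y => deriv (Γ.curve j) y *
      Γ.pullback f k j y / (Γ.curve j y - normalShift (Γ.curve i) s ε x)) unitMeasure := by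
    rw [ae_all_iff]
    intro j
    rw [ae_all_iff]
    exact fun k => hε j _ (Γ.memLp_pullback hf k j)
  filter_upwards [h2] with x hx k
  exact Γ.cauchyOp_apply hζ hf hx k

theorem aestronglyMeasurable_cauchyOp_normalShift (hζ : ∀ k, kernelPole ζ k ∉ Γ.carrier)
    {f : ℂ → Fin 2 → ℂ} (hf : MemLp f 2 Γ.arcLength) {s : ℝ} (hs : s = 1 ∨ s = -1) (i : Fin n) :
    ∀ᶠ ε in 𝓝[>] 0, AEStronglyMeasurable
      (fun x => Γ.cauchyOp ζ f (normalShift (Γ.curve i) s ε x)) unitMeasure := by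
  filter_upwards [Γ.cauchyOp_normalShift hζ hf hs i] with ε hε
  refine aestronglyMeasurable_pi fun k => ?_
  refine AEStronglyMeasurable.congr
    (((Γ.aestronglyMeasurable_cauchySum_normalShift (Γ.memLp_pullback hf k) i s ε).sub
      (aestronglyMeasurable_const (b := Γ.cauchySum (Γ.pullback f k) (kernelPole ζ k)))).const_mul
        (2 * Real.pi * Complex.I : ℂ)⁻¹) ?_
  filter_upwards [hε] with x hx
  exact (hx k).symm

/-- An `L²` limit is unique. Measurability of the shifted functions has to be assumed, since the
triangle inequality for `eLpNorm` needs it. -/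
theorem HasBoundaryValue.unique {s : ℝ} {F : ℂ → Fin 2 → ℂ} {h h' : Γ.L2}
    (hF : ∀ i, ∀ᶠ ε in 𝓝[>] 0,
      AEStronglyMeasurable (fun x => F (normalShift (Γ.curve i) s ε x)) unitMeasure)
    (H : Γ.HasBoundaryValue s F h) (H' : Γ.HasBoundaryValue s F h') : h = h' := by
  refine Lp.ext ?_
  refine Γ.ae_arcLength_iff.2 fun i => ?_
  have hm : ∀ g : Γ.L2, AEStronglyMeasurable (fun x => g (Γ.curve i x)) unitMeasure :=
    fun g => (Γ.memLp_curve (Lp.memLp g) i).1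
  have h1 : eLpNorm (fun x => h (Γ.curve i x) - h' (Γ.curve i x)) 2 unitMeasure ≤ 0 := by
    have h0 := (H i).add (H' i)
    rw [add_zero] at h0
    refine ge_of_tendsto h0 ?_
    filter_upwards [hF i] with ε hε
    have := eLpNorm_sub_le (p := 2) (hε.sub (hm h')) (hε.sub (hm h)) (by norm_num)
    rw [add_comm]
    refine le_trans (le_of_eq ?_) this
    congr 1
    ext x : 1
    simp only [Pi.sub_apply]
    abel
  have h2 := (eLpNorm_eq_zero_iff ((hm h).sub (hm h')) (by norm_num)).1 (le_antisymm h1 bot_le)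
  filter_upwards [h2] with x hx
  exact sub_eq_zero.1 hx

theorem HasBoundaryValue.sub {s : ℝ} {F F' G : ℂ → Fin 2 → ℂ} {h h' : Γ.L2}
    (hF : ∀ i, ∀ᶠ ε in 𝓝[>] 0,
      AEStronglyMeasurable (fun x => F (normalShift (Γ.curve i) s ε x)) unitMeasure)
    (hF' : ∀ i, ∀ᶠ ε in 𝓝[>] 0,
      AEStronglyMeasurable (fun x => F' (normalShift (Γ.curve i) s ε x)) unitMeasure)
    (H : Γ.HasBoundaryValue s F h) (H' : Γ.HasBoundaryValue s F' h')
    (hG : ∀ i, ∀ᶠ ε in 𝓝[>] 0, ∀ᵐ x ∂unitMeasure, G (normalShift (Γ.curve i) s ε x) =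
      F (normalShift (Γ.curve i) s ε x) - F' (normalShift (Γ.curve i) s ε x)) :
    Γ.HasBoundaryValue s G (h - h') := by
  intro i
  have hm : ∀ g : Γ.L2, AEStronglyMeasurable (fun x => g (Γ.curve i x)) unitMeasure :=
    fun g => (Γ.memLp_curve (Lp.memLp g) i).1
  have h0 := (H i).add (H' i)
  rw [add_zero] at h0
  refine tendsto_of_tendsto_of_tendsto_of_le_of_le' tendsto_const_nhds h0
    (Eventually.of_forall fun _ => bot_le) ?_
  filter_upwards [hF i, hF' i, hG i] with ε hε hε' hGε
  have := eLpNorm_sub_le (p := 2) (hε.sub (hm h)) (hε'.sub (hm h')) (by norm_num)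
  refine le_trans (le_of_eq (eLpNorm_congr_ae ?_)) this
  have h3 := (Γ.quasiMeasurePreserving_curve i).ae (Lp.coeFn_sub h h')
  filter_upwards [hGε, h3] with x hx hx3
  change G (normalShift (Γ.curve i) s ε x) - _ = _
  rw [hx, hx3]
  simp only [Pi.sub_apply]
  abel

/-- In each component the operator is the scalar Cauchy integral minus its value at the pole,
divided by `2πi`. That value is a constant: it is bounded because the pole is off the contour, and
it drops out of the jump. The limits on the individual curves are then glued. -/
theorem exists_hasBoundaryValue (hζ : ∀ k, kernelPole ζ k ∉ Γ.carrier) :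
    ∃ B : ℝ≥0, ∀ f : ℂ → Fin 2 → ℂ, MemLp f 2 Γ.arcLength → ∃ h : ℝ → Γ.L2,
      (∀ s, s = 1 ∨ s = -1 → Γ.HasBoundaryValue s (Γ.cauchyOp ζ f) (h s) ∧
        ‖h s‖ₑ ≤ B * eLpNorm f 2 Γ.arcLength) ∧
      ∀ᵐ z ∂Γ.arcLength, h 1 z - h (-1) z = f z := by
  obtain ⟨B₁, hB₁⟩ := Γ.exists_boundary_cauchySum
  obtain ⟨C, hC, hCb⟩ := Γ.exists_enorm_cauchySum_le
  obtain ⟨D₁, hD₁⟩ := Γ.exists_eLpNorm_curve_le (E := Fin 2 → ℂ)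
  obtain ⟨D₂, hD₂⟩ := Γ.exists_eLpNorm_arcLength_le (E := Fin 2 → ℂ)
  choose δ hδ hδd using fun k => Γ.exists_dist_ge (hζ k)
  set c : ℂ := (2 * Real.pi * Complex.I)⁻¹ with hc
  have hpi : (2 * Real.pi * Complex.I : ℂ) ≠ 0 := by
    simp [Real.pi_ne_zero]
  refine ⟨D₂ * ∑ i : Fin n, ∑ k : Fin 2, ‖c‖₊ * (B₁ * (n * D₁) + (C / δ k).toNNReal * (n * D₁)),
    fun f hf => ?_⟩
  have hS : ∀ k, ∑ j, eLpNorm (Γ.pullback f k j) 2 unitMeasure ≤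
      (n * D₁ : ℝ≥0) * eLpNorm f 2 Γ.arcLength := by
    intro k
    calc ∑ j, eLpNorm (Γ.pullback f k j) 2 unitMeasure
        ≤ ∑ j : Fin n, D₁ * eLpNorm f 2 Γ.arcLength :=
          Finset.sum_le_sum fun j _ => (eLpNorm_apply_le _ k).trans (hD₁ f hf.1 j)
      _ = _ := by simp [mul_assoc]
  choose v hv hvj using fun k => hB₁ (Γ.pullback f k) (Γ.memLp_pullback hf k)
  set P : Fin 2 → ℂ := fun k => Γ.cauchySum (Γ.pullback f k) (kernelPole ζ k) with hP
  set V : ℝ → Fin n → ℝ → Fin 2 → ℂ := fun s i x k => c * (v k s i x - P k) with hV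
  have hVm : ∀ s, s = 1 ∨ s = -1 → ∀ i k, MemLp (fun x => V s i x k) 2 unitMeasure :=
    fun s hs i k => (((hv k s hs i).1).sub (memLp_const (P k))).const_mul c
  have hVb : ∀ s, s = 1 ∨ s = -1 → ∀ i, eLpNorm (V s i) 2 unitMeasure ≤
      (∑ k : Fin 2, ‖c‖₊ * (B₁ * (n * D₁) + (C / δ k).toNNReal * (n * D₁)) : ℝ≥0) *
        eLpNorm f 2 Γ.arcLength := by
    intro s hs i
    refine (eLpNorm_pi_le fun k => (hVm s hs i k).1).trans ?_
    rw [ENNReal.ofNNReal_finsetSum, Finset.sum_mul]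
    refine Finset.sum_le_sum fun k _ => ?_
    have h1 : eLpNorm (fun x => V s i x k) 2 unitMeasure =
        ‖c‖ₑ * eLpNorm (fun x => v k s i x - P k) 2 unitMeasure :=
      eLpNorm_const_smul c (fun x => v k s i x - P k) 2 unitMeasure
    have h2 : eLpNorm (fun x => v k s i x - P k) 2 unitMeasure ≤
        eLpNorm (v k s i) 2 unitMeasure + ‖P k‖ₑ := by
      refine (eLpNorm_sub_le (hv k s hs i).1.1 aestronglyMeasurable_const (by norm_num)).trans ?_
      rw [eLpNorm_const _ (by norm_num) (IsProbabilityMeasure.ne_zero _)]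
      simp [hP]
    have h3 : ‖P k‖ₑ ≤ (C / δ k).toNNReal * ((n * D₁ : ℝ≥0) * eLpNorm f 2 Γ.arcLength) :=
      (hCb _ (Γ.memLp_pullback hf k) (δ k) (hδ k) _ (hδd k)).trans (by
        gcongr
        · exact le_rfl
        · exact hS k)
    have h4 : eLpNorm (v k s i) 2 unitMeasure ≤ B₁ * ((n * D₁ : ℝ≥0) * eLpNorm f 2 Γ.arcLength) :=
      ((hv k s hs i).2.1).trans (by gcongr; exact hS k)
    rw [h1]
    calc ‖c‖ₑ * eLpNorm (fun x => v k s i x - P k) 2 unitMeasure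
        ≤ ‖c‖ₑ * (B₁ * ((n * D₁ : ℝ≥0) * eLpNorm f 2 Γ.arcLength) +
          (C / δ k).toNNReal * ((n * D₁ : ℝ≥0) * eLpNorm f 2 Γ.arcLength)) := by
          gcongr
          exact h2.trans (add_le_add h4 h3)
      _ = _ := by
          push_cast
          rw [enorm_eq_nnnorm]
          ring
  have hex : ∀ s, ∃ h : Γ.L2, s = 1 ∨ s = -1 → (∀ i, ∀ᵐ x ∂unitMeasure,
      h (Γ.curve i x) = V s i x) := by
    intro s
    by_cases hs : s = 1 ∨ s = -1
    · obtain ⟨h, hm, hh⟩ := Γ.exists_strongly_measurable_glue (V s)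
        (fun i => aestronglyMeasurable_pi fun k => (hVm s hs i k).1)
      have hmem : MemLp h 2 Γ.arcLength := Γ.memLp_arcLength hm.aestronglyMeasurable fun i =>
        (memLp_pi_iff.2 fun k => hVm s hs i k).ae_eq (ae_eq_symm (hh i))
      refine ⟨hmem.toLp h, fun _ i => ?_⟩
      filter_upwards [hh i, (Γ.quasiMeasurePreserving_curve i).ae hmem.coeFn_toLp] with x h1 h2
      rw [h2, h1]
    · exact ⟨0, fun h => absurd h hs⟩
  choose h hh using hex
  refine ⟨h, fun s hs => ⟨fun i => ?_, ?_⟩, ?_⟩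
  · have hlim : Tendsto (fun ε => ∑ k, ‖c‖ₑ * eLpNorm (fun x => Γ.cauchySum (Γ.pullback f k)
        (normalShift (Γ.curve i) s ε x) - v k s i x) 2 unitMeasure) (𝓝[>] 0) (𝓝 0) := by
      have : (0 : ℝ≥0∞) = ∑ k : Fin 2, ‖c‖ₑ * 0 := by simp
      rw [this]
      exact tendsto_finsetSum _ fun k _ =>
        ENNReal.Tendsto.const_mul (hv k s hs i).2.2 (Or.inr enorm_ne_top)
    refine tendsto_of_tendsto_of_tendsto_of_le_of_le' tendsto_const_nhds hlim
      (Eventually.of_forall fun _ => bot_le) ?_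
    filter_upwards [Γ.cauchyOp_normalShift hζ hf hs i] with ε hε
    have hae : (fun x => Γ.cauchyOp ζ f (normalShift (Γ.curve i) s ε x) - h s (Γ.curve i x))
        =ᵐ[unitMeasure] fun x k => c • (Γ.cauchySum (Γ.pullback f k)
          (normalShift (Γ.curve i) s ε x) - v k s i x) := by
      filter_upwards [hε, hh s hs i] with x h1 h2
      ext k
      rw [Pi.sub_apply, h1 k, h2]
      simp only [hV, hP, smul_eq_mul]
      ring
    calc _ = _ := eLpNorm_congr_ae hae
      _ ≤ _ := by
        refine (eLpNorm_pi_le fun k => ?_).trans (Finset.sum_le_sum fun k _ => ?_)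
        · exact ((Γ.aestronglyMeasurable_cauchySum_normalShift (Γ.memLp_pullback hf k) i s ε).sub
            (hv k s hs i).1.1).const_smul c
        · exact le_of_eq (eLpNorm_const_smul c (fun x => Γ.cauchySum (Γ.pullback f k)
            (normalShift (Γ.curve i) s ε x) - v k s i x) 2 unitMeasure)
  · rw [Lp.enorm_def]
    refine (hD₂ _ (Lp.aestronglyMeasurable _)).trans ?_
    rw [ENNReal.coe_mul, mul_assoc, ENNReal.ofNNReal_finsetSum, Finset.sum_mul]
    gcongr with i
    rw [eLpNorm_congr_ae (hh s hs i)]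
    exact hVb s hs i
  · refine Γ.ae_arcLength_iff.2 fun i => ?_
    filter_upwards [hh 1 (Or.inl rfl) i, hh (-1) (Or.inr rfl) i, ae_all_iff.2 fun k => hvj k i]
      with x h1 h2 h3
    ext k
    rw [h1, h2]
    simp only [Pi.sub_apply, hV]
    rw [← mul_sub, sub_sub_sub_cancel_right, h3 k, hc, inv_mul_cancel_left₀ hpi, pullback]

/-- The boundary value is defined by choice, with default `0`. Existence excludes the default, and
uniqueness identifies the choice with the limit constructed before. -/
theorem exists_boundaryValue_cauchyOp (hζ : ∀ k, kernelPole ζ k ∉ Γ.carrier) :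
    ∃ B : ℝ≥0, ∀ f : ℂ → Fin 2 → ℂ, MemLp f 2 Γ.arcLength →
      (∀ s, s = 1 ∨ s = -1 →
        Γ.HasBoundaryValue s (Γ.cauchyOp ζ f) (Γ.boundaryValue s (Γ.cauchyOp ζ f)) ∧
        ‖Γ.boundaryValue s (Γ.cauchyOp ζ f)‖ₑ ≤ B * eLpNorm f 2 Γ.arcLength) ∧
      ∀ᵐ z ∂Γ.arcLength, Γ.boundaryValue 1 (Γ.cauchyOp ζ f) z -
        Γ.boundaryValue (-1) (Γ.cauchyOp ζ f) z = f z := by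
  obtain ⟨B, hB⟩ := exists_hasBoundaryValue hζ
  refine ⟨B, fun f hf => ?_⟩
  obtain ⟨h, h1, h2⟩ := hB f hf
  have key : ∀ s, s = 1 ∨ s = -1 →
      Γ.HasBoundaryValue s (Γ.cauchyOp ζ f) (Γ.boundaryValue s (Γ.cauchyOp ζ f)) := by
    intro s hs
    have hex : ∃ g : Γ.L2, Γ.HasBoundaryValue s (Γ.cauchyOp ζ f) g := ⟨h s, (h1 s hs).1⟩
    rw [boundaryValue, dif_pos hex]
    exact hex.choose_spec
  have heq : ∀ s, s = 1 ∨ s = -1 → Γ.boundaryValue s (Γ.cauchyOp ζ f) = h s := fun s hs =>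
    (key s hs).unique (aestronglyMeasurable_cauchyOp_normalShift hζ hf hs) (h1 s hs).1
  refine ⟨fun s hs => ⟨key s hs, ?_⟩, ?_⟩
  · rw [heq s hs]
    exact (h1 s hs).2
  · rw [heq 1 (Or.inl rfl), heq (-1) (Or.inr rfl)]
    exact h2

theorem HasBoundaryValue.eq_boundaryValue (hζ : ∀ k, kernelPole ζ k ∉ Γ.carrier)
    {f : ℂ → Fin 2 → ℂ} (hf : MemLp f 2 Γ.arcLength) {s : ℝ} (hs : s = 1 ∨ s = -1) {h : Γ.L2}
    (H : Γ.HasBoundaryValue s (Γ.cauchyOp ζ f) h) :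
    Γ.boundaryValue s (Γ.cauchyOp ζ f) = h := by
  obtain ⟨B, hB⟩ := exists_boundaryValue_cauchyOp hζ
  exact (((hB f hf).1 s hs).1).unique (aestronglyMeasurable_cauchyOp_normalShift hζ hf hs) H

theorem lineIntegral_congr {f g : ℂ → Fin 2 → ℂ} (h : f =ᵐ[Γ.arcLength] g) :
    Γ.lineIntegral f = Γ.lineIntegral g := by
  refine Finset.sum_congr rfl fun j _ => ?_
  rw [intervalIntegral.integral_of_le zero_le_one, ← integral_Icc_eq_integral_Ioc,
    intervalIntegral.integral_of_le zero_le_one, ← integral_Icc_eq_integral_Ioc]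
  refine integral_congr_ae ?_
  filter_upwards [Γ.ae_arcLength_iff.1 h j] with y hy
  rw [hy]

theorem cauchyOp_congr {f g : ℂ → Fin 2 → ℂ} (h : f =ᵐ[Γ.arcLength] g) :
    Γ.cauchyOp ζ f = Γ.cauchyOp ζ g := by
  ext z : 1
  rw [cauchyOp, cauchyOp]
  congr 1
  refine lineIntegral_congr ?_
  filter_upwards [h] with s hs
  rw [hs]

theorem cauchyOp_normalShift_sub (hζ : ∀ k, kernelPole ζ k ∉ Γ.carrier) {f g : ℂ → Fin 2 → ℂ}
    (hf : MemLp f 2 Γ.arcLength) (hg : MemLp g 2 Γ.arcLength) {s : ℝ} (hs : s = 1 ∨ s = -1)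
    (i : Fin n) :
    ∀ᶠ ε in 𝓝[>] 0, ∀ᵐ x ∂unitMeasure, Γ.cauchyOp ζ (f - g) (normalShift (Γ.curve i) s ε x) =
      Γ.cauchyOp ζ f (normalShift (Γ.curve i) s ε x) -
        Γ.cauchyOp ζ g (normalShift (Γ.curve i) s ε x) := by
  have h := eventually_all.2 fun j => Γ.eventually_ae_integrable_cauchy hs i j
  filter_upwards [h] with ε hε
  have h2 : ∀ f : ℂ → Fin 2 → ℂ, MemLp f 2 Γ.arcLength →
      ∀ᵐ x ∂unitMeasure, ∀ j k, Integrable (fun y => deriv (Γ.curve j) y *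
        Γ.pullback f k j y / (Γ.curve j y - normalShift (Γ.curve i) s ε x)) unitMeasure := by
    intro f hf
    rw [ae_all_iff]
    intro j
    rw [ae_all_iff]
    exact fun k => hε j _ (Γ.memLp_pullback hf k j)
  have hsub : ∀ k z, (∀ j k, Integrable (fun y => deriv (Γ.curve j) y *
      Γ.pullback f k j y / (Γ.curve j y - z)) unitMeasure) →
      (∀ j k, Integrable (fun y => deriv (Γ.curve j) y *
      Γ.pullback g k j y / (Γ.curve j y - z)) unitMeasure) →
      Γ.cauchySum (Γ.pullback (f - g) k) z =
        Γ.cauchySum (Γ.pullback f k) z - Γ.cauchySum (Γ.pullback g k) z := by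
    intro k z h1 h2
    simp only [cauchySum]
    rw [← Finset.sum_sub_distrib]
    refine Finset.sum_congr rfl fun j _ => ?_
    rw [← integral_sub (h1 j k) (h2 j k)]
    congr 1
    ext y
    simp only [pullback, Pi.sub_apply]
    ring
  filter_upwards [h2 f hf, h2 g hg, h2 (f - g) (hf.sub hg)] with x h1 h2 h3
  ext k
  rw [Pi.sub_apply, Γ.cauchyOp_apply hζ (hf.sub hg) h3, Γ.cauchyOp_apply hζ hf h1,
    Γ.cauchyOp_apply hζ hg h2, hsub k _ h1 h2, hsub k (kernelPole ζ k)]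
  · ring
  · exact fun j k' => Γ.integrable_cauchy_of_dist_ge ((Γ.memLp_pullback hf k' j).integrable
      (by norm_num)) j (hζ k)
  · exact fun j k' => Γ.integrable_cauchy_of_dist_ge ((Γ.memLp_pullback hg k' j).integrable
      (by norm_num)) j (hζ k)

theorem boundaryValue_cauchyOp_sub (hζ : ∀ k, kernelPole ζ k ∉ Γ.carrier) {f g : ℂ → Fin 2 → ℂ}
    (hf : MemLp f 2 Γ.arcLength) (hg : MemLp g 2 Γ.arcLength) {s : ℝ} (hs : s = 1 ∨ s = -1) :
    Γ.boundaryValue s (Γ.cauchyOp ζ (f - g)) =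
      Γ.boundaryValue s (Γ.cauchyOp ζ f) - Γ.boundaryValue s (Γ.cauchyOp ζ g) := by
  obtain ⟨B, hB⟩ := exists_boundaryValue_cauchyOp hζ
  refine HasBoundaryValue.eq_boundaryValue hζ (hf.sub hg) hs ?_
  exact ((hB f hf).1 s hs).1.sub (aestronglyMeasurable_cauchyOp_normalShift hζ hf hs)
    (aestronglyMeasurable_cauchyOp_normalShift hζ hg hs) ((hB g hg).1 s hs).1
    (cauchyOp_normalShift_sub hζ hf hg hs)

end OrientedContour

/-! ### Inversion in the curve parameters -/

/-- A continuous real function is differentiable if its composition with a regular curve is, with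
tangential derivative. -/
theorem HasDerivAt.hasDerivWithinAt_of_comp {h ψ : ℝ → ℂ} {φ : ℝ → ℝ} {s : Set ℝ} {x a : ℝ} {e : ℂ}
    (hh : HasDerivAt h e (φ x)) (he : e ≠ 0) (hψ : HasDerivWithinAt ψ (a * e) s x)
    (hφ : ContinuousWithinAt φ s x) (hx : x ∈ s) (heq : ∀ y ∈ s, h (φ y) = ψ y) :
    HasDerivWithinAt φ a s x := by
  rw [hasDerivWithinAt_iff_tendsto_slope] at hψ ⊢
  have hD : Tendsto (fun y => dslope h (φ x) (φ y)) (𝓝[s \ {x}] x) (𝓝 e) := by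
    have h1 : ContinuousAt (dslope h (φ x)) (φ x) :=
      continuousAt_dslope_same.2 hh.differentiableAt
    have h2 := h1.tendsto
    rw [dslope_same, hh.deriv] at h2
    exact h2.comp (hφ.tendsto.mono_left (nhdsWithin_mono x sdiff_subset))
  have hlim := hψ.div hD he
  rw [mul_div_cancel_right₀ _ he] at hlim
  have hre := (Complex.continuous_re.tendsto _).comp hlim
  rw [Complex.ofReal_re] at hre
  refine hre.congr' ?_
  filter_upwards [self_mem_nhdsWithin, hD.eventually_ne he] with y hy hne
  have h3 : slope ψ x y = (slope φ x y : ℂ) * dslope h (φ x) (φ y) := by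
    have h4 := sub_smul_dslope h (φ x) (φ y)
    rw [heq y hy.1, heq x hx] at h4
    rw [slope, vsub_eq_sub, ← h4, slope, vsub_eq_sub, Complex.real_smul, Complex.real_smul,
      smul_eq_mul]
    push_cast
    ring
  simp only [Function.comp_apply, Pi.div_apply]
  rw [h3, mul_div_cancel_right₀ _ hne, Complex.ofReal_re]

namespace OrientedContour

variable {n : ℕ} {Γ : OrientedContour n} {ζ : ℝ}

variable (Γ) in
/-- The regular parameters of the `i`-th curve whose points are mapped to the `j`-th curve by
inversion. -/
def overlap (i j : Fin n) : Set ℝ :=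
  {x ∈ Γ.regularParams i | (Γ.curve i x)⁻¹ ∈ Γ.curve j '' Icc (0 : ℝ) 1}

variable (Γ) in
/-- The parameter on the `j`-th curve of the inverse of a point of the `i`-th curve. -/
noncomputable def invParam (i j : Fin n) (x : ℝ) : ℝ :=
  Function.invFunOn (Γ.curve j) (Icc 0 1) (Γ.curve i x)⁻¹

theorem measurableSet_overlap (i j : Fin n) : MeasurableSet (Γ.overlap i j) :=
  (Γ.measurableSet_regularParams i).inter ((Γ.continuous_curve i).measurable.inv
    (isCompact_Icc.image (Γ.continuous_curve j)).measurableSet)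

theorem invParam_mem_Icc {i j : Fin n} {x : ℝ} (hx : x ∈ Γ.overlap i j) :
    Γ.invParam i j x ∈ Icc (0 : ℝ) 1 :=
  Function.invFunOn_mem hx.2

theorem curve_invParam {i j : Fin n} {x : ℝ} (hx : x ∈ Γ.overlap i j) :
    Γ.curve j (Γ.invParam i j x) = (Γ.curve i x)⁻¹ :=
  Function.invFunOn_eq hx.2

theorem invParam_mem_overlap {i j : Fin n} {x : ℝ} (hx : x ∈ Γ.overlap i j) :
    Γ.invParam i j x ∈ Γ.overlap j i := by
  refine ⟨⟨invParam_mem_Icc hx, ?_⟩, ?_⟩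
  · rw [curve_invParam hx, inv_mem_exceptional]
    exact hx.1.2
  · rw [curve_invParam hx, inv_inv]
    exact mem_image_of_mem _ hx.1.1

theorem invParam_invParam {i j : Fin n} {x : ℝ} (hx : x ∈ Γ.overlap i j) :
    Γ.invParam j i (Γ.invParam i j x) = x := by
  have h := invParam_mem_overlap hx
  refine (eq_of_curve_eq (i := i) (invParam_mem_Icc h) hx.1.1 ?_ hx.1.2).2
  rw [curve_invParam h, curve_invParam hx, inv_inv]

theorem injOn_invParam (i j : Fin n) : InjOn (Γ.invParam i j) (Γ.overlap i j) :=
  fun x hx y hy h => by rw [← invParam_invParam hx, h, invParam_invParam hy]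

theorem image_invParam (i j : Fin n) : Γ.invParam i j '' Γ.overlap i j = Γ.overlap j i := by
  refine Subset.antisymm (image_subset_iff.2 fun x hx => invParam_mem_overlap hx) fun y hy => ?_
  exact ⟨Γ.invParam j i y, invParam_mem_overlap hy, invParam_invParam hy⟩

/-- The inverse of a continuous injection of a compact set is continuous: the parameters outside a
neighbourhood have a compact image, which misses the point. -/
theorem continuousWithinAt_invParam {i j : Fin n} {x : ℝ} (h0 : Γ.curve i x ≠ 0)
    (hx : x ∈ Γ.overlap i j) : ContinuousWithinAt (Γ.invParam i j) (Γ.overlap i j) x := by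
  intro U hU
  have hK : IsCompact (Γ.curve j '' (Icc 0 1 \ interior U)) :=
    (isCompact_Icc.diff isOpen_interior).image (Γ.continuous_curve j)
  have hnot : (Γ.curve i x)⁻¹ ∉ Γ.curve j '' (Icc 0 1 \ interior U) := by
    rintro ⟨y, hy, hyx⟩
    have := (eq_of_curve_eq hy.1 (invParam_mem_Icc hx) (by rw [hyx, curve_invParam hx])
      (invParam_mem_overlap hx).1.2).2
    exact hy.2 (this ▸ mem_interior_iff_mem_nhds.2 hU)
  have hc : ContinuousAt (fun x => (Γ.curve i x)⁻¹) x :=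
    (Γ.continuous_curve i).continuousAt.inv₀ h0
  have hev := hc.eventually (hK.isClosed.isOpen_compl.mem_nhds hnot)
  refine mem_map.2 ?_
  filter_upwards [self_mem_nhdsWithin, nhdsWithin_le_nhds hev] with y hy hy'
  by_contra hn
  exact hy' ⟨Γ.invParam i j y, ⟨invParam_mem_Icc hy, fun h => hn (interior_subset (s := U) h)⟩,
    curve_invParam hy⟩

namespace IsSymmetric

theorem curve_ne_zero (hΓ : Γ.IsSymmetric ζ) (i : Fin n) {x : ℝ} (hx : x ∈ Icc (0 : ℝ) 1) :
    Γ.curve i x ≠ 0 := fun h => hΓ.zero_notMem (h ▸ Γ.curve_mem_carrier i hx)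

theorem inv_mem_carrier (hΓ : Γ.IsSymmetric ζ) {z : ℂ} : z⁻¹ ∈ Γ.carrier ↔ z ∈ Γ.carrier := by
  have h : ∀ z ∈ Γ.carrier, z⁻¹ ∈ Γ.carrier := by
    intro z hz
    obtain ⟨i, x, hx, rfl⟩ := mem_iUnion.1 hz
    obtain ⟨j, y, hy, h1, -⟩ := hΓ.inversion i x hx
    exact h1 ▸ Γ.curve_mem_carrier j hy
  exact ⟨fun hz => by simpa using h _ hz, h z⟩

theorem exists_mem_overlap (hΓ : Γ.IsSymmetric ζ) {i : Fin n} {x : ℝ}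
    (hx : x ∈ Γ.regularParams i) : ∃ j, x ∈ Γ.overlap i j := by
  obtain ⟨j, y, hy, h1, -⟩ := hΓ.inversion i x hx.1
  exact ⟨j, hx, y, hy, h1⟩

/-- Differentiate `γ_j(φ(x)) = 1 / γ_i(x)` and compare with the symmetry assumption `γ_j' = c γ_i' /
γ_i²`. The derivative `-1 / c` is negative because inversion reverses the orientation. -/
theorem exists_deriv_invParam (hΓ : Γ.IsSymmetric ζ) {i j : Fin n} {x : ℝ}
    (hx : x ∈ Γ.overlap i j) : ∃ c : ℝ, 0 < c ∧
      deriv (Γ.curve j) (Γ.invParam i j x) = c * (deriv (Γ.curve i) x / Γ.curve i x ^ 2) ∧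
      HasDerivWithinAt (Γ.invParam i j) (-c⁻¹) (Γ.overlap i j) x := by
  obtain ⟨j', y, hy, h1, c, hc, h2⟩ := hΓ.inversion i x hx.1.1
  obtain ⟨rfl, rfl⟩ := eq_of_curve_eq hy (invParam_mem_Icc hx) (by rw [h1, curve_invParam hx])
    (invParam_mem_overlap hx).1.2
  refine ⟨c, hc, h2, ?_⟩
  have h0 := hΓ.curve_ne_zero i hx.1.1
  have hd : HasDerivAt (Γ.curve i) (deriv (Γ.curve i) x) x :=
    (Γ.differentiable_curve i x).hasDerivAt
  refine HasDerivAt.hasDerivWithinAt_of_comp (ψ := fun x => (Γ.curve i x)⁻¹)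
    (Γ.differentiable_curve j' _).hasDerivAt
    (Γ.regular j' _ (invParam_mem_Icc hx)) ?_ (continuousWithinAt_invParam h0 hx) hx
    (fun y hy => curve_invParam hy)
  refine (hd.fun_inv h0).hasDerivWithinAt.congr_deriv ?_
  rw [h2]
  have : (c : ℂ) ≠ 0 := by exact_mod_cast hc.ne'
  push_cast
  field_simp

theorem iUnion_overlap (hΓ : Γ.IsSymmetric ζ) (i : Fin n) :
    ⋃ j, Γ.overlap i j = Γ.regularParams i := by
  refine Subset.antisymm (iUnion_subset fun j x hx => hx.1) fun x hx => mem_iUnion.2 ?_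
  exact hΓ.exists_mem_overlap hx

end IsSymmetric

theorem pairwise_disjoint_overlap (i : Fin n) :
    Pairwise (Function.onFun Disjoint (Γ.overlap i)) := by
  intro j k hjk
  refine disjoint_left.2 fun x hx hx' => hjk ?_
  refine (eq_of_curve_eq (invParam_mem_Icc hx) (invParam_mem_Icc hx') ?_
    (invParam_mem_overlap hx').1.2).1
  rw [curve_invParam hx, curve_invParam hx']

theorem unitMeasure_restrict_regularParams (i : Fin n) :
    unitMeasure.restrict (Γ.regularParams i) = unitMeasure :=
  Measure.restrict_eq_self_of_ae_mem (Γ.ae_notMem_exceptionalParams i)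

theorem restrict_regularParams (i : Fin n) :
    (volume : Measure ℝ).restrict (Γ.regularParams i) = unitMeasure := by
  rw [← unitMeasure_restrict_regularParams (Γ := Γ) i, Measure.restrict_restrict
    (Γ.measurableSet_regularParams i), inter_eq_left.2 fun x hx => hx.1]

namespace IsSymmetric

theorem lintegral_eq_sum_overlap (hΓ : Γ.IsSymmetric ζ) (i : Fin n) (g : ℝ → ℝ≥0∞) :
    ∫⁻ x, g x ∂unitMeasure = ∑ j, ∫⁻ x in Γ.overlap i j, g x := by
  rw [← Γ.restrict_regularParams i, ← hΓ.iUnion_overlap i,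
    lintegral_iUnion (fun j => measurableSet_overlap i j) (pairwise_disjoint_overlap i),
    tsum_fintype]

theorem integral_eq_sum_overlap (hΓ : Γ.IsSymmetric ζ) (i : Fin n) {g : ℝ → ℂ}
    (hg : Integrable g unitMeasure) :
    ∫ x, g x ∂unitMeasure = ∑ j, ∫ x in Γ.overlap i j, g x := by
  rw [← Γ.restrict_regularParams i, ← hΓ.iUnion_overlap i] at hg ⊢
  rw [integral_iUnion (fun j => measurableSet_overlap i j) (pairwise_disjoint_overlap i) hg,
    tsum_fintype]

theorem lintegral_overlap (hΓ : Γ.IsSymmetric ζ) (i j : Fin n) (G : ℂ → ℝ≥0∞) :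
    ∫⁻ y in Γ.overlap j i, ‖deriv (Γ.curve j) y‖ₑ * G (Γ.curve j y) =
      ∫⁻ x in Γ.overlap i j, ‖deriv (Γ.curve i) x / Γ.curve i x ^ 2‖ₑ * G (Γ.curve i x)⁻¹ := by
  choose! c hc h1 h2 using fun x hx => hΓ.exists_deriv_invParam (i := i) (j := j) (x := x) hx
  rw [← image_invParam i j, lintegral_image_eq_lintegral_abs_deriv_mul
    (measurableSet_overlap i j) h2 (injOn_invParam i j)]
  refine setLIntegral_congr_fun (measurableSet_overlap i j) fun x hx => ?_
  rw [curve_invParam hx, h1 x hx, ← mul_assoc, abs_neg, abs_of_pos (inv_pos.2 (hc x hx)),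
    ← ofReal_norm, norm_mul, ← ENNReal.ofReal_mul (inv_pos.2 (hc x hx)).le,
    Complex.norm_of_nonneg (hc x hx).le, inv_mul_cancel_left₀ (hc x hx).ne', ofReal_norm]

/-- Under `s ↦ 1/s` the form `ds` becomes `-ds / s²`. The reversed orientation supplies a second
minus sign, so none remains. -/
theorem integral_overlap (hΓ : Γ.IsSymmetric ζ) (i j : Fin n) (G : ℂ → ℂ) :
    ∫ y in Γ.overlap j i, deriv (Γ.curve j) y * G (Γ.curve j y) =
      ∫ x in Γ.overlap i j, deriv (Γ.curve i) x * (G (Γ.curve i x)⁻¹ / Γ.curve i x ^ 2) := by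
  choose! c hc h1 h2 using fun x hx => hΓ.exists_deriv_invParam (i := i) (j := j) (x := x) hx
  rw [← image_invParam i j, integral_image_eq_integral_abs_deriv_smul
    (measurableSet_overlap i j) h2 (injOn_invParam i j)]
  refine setIntegral_congr_fun (measurableSet_overlap i j) fun x hx => ?_
  have : (c x : ℂ) ≠ 0 := by exact_mod_cast (hc x hx).ne'
  have h0 := hΓ.curve_ne_zero i hx.1.1
  rw [curve_invParam hx, h1 x hx, abs_neg, abs_of_pos (inv_pos.2 (hc x hx)), Complex.real_smul]
  push_cast
  field_simp

end IsSymmetric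

variable (Γ) in
/-- The line integral of a scalar function. -/
noncomputable def contourSum (g : ℂ → ℂ) : ℂ :=
  ∑ j, ∫ y, deriv (Γ.curve j) y * g (Γ.curve j y) ∂unitMeasure

namespace IsSymmetric

theorem contourSum_inv (hΓ : Γ.IsSymmetric ζ) {g : ℂ → ℂ}
    (hg : ∀ j, Integrable (fun y => deriv (Γ.curve j) y * g (Γ.curve j y)) unitMeasure)
    (hg' : ∀ j, Integrable (fun y => deriv (Γ.curve j) y *
      (g (Γ.curve j y)⁻¹ / Γ.curve j y ^ 2)) unitMeasure) :
    Γ.contourSum g = Γ.contourSum fun z => g z⁻¹ / z ^ 2 := by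
  rw [contourSum, contourSum,
    Finset.sum_congr rfl fun j _ => hΓ.integral_eq_sum_overlap j (hg j),
    Finset.sum_congr rfl fun j _ => hΓ.integral_eq_sum_overlap j (hg' j), Finset.sum_comm]
  exact Finset.sum_congr rfl fun i _ => Finset.sum_congr rfl fun j _ => hΓ.integral_overlap i j g

end IsSymmetric

theorem exists_norm_le (Γ : OrientedContour n) : ∃ D > 0, ∀ z ∈ Γ.carrier, ‖z‖ ≤ D := by
  obtain ⟨D, hD⟩ := Γ.isCompact_carrier.isBounded.exists_norm_le
  exact ⟨max D 1, by positivity, fun z hz => (hD z hz).trans (le_max_left _ _)⟩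

theorem arcLength_apply (Γ : OrientedContour n) {A : Set ℂ} (hA : MeasurableSet A) :
    Γ.arcLength A =
      ∑ i, ∫⁻ x, ‖deriv (Γ.curve i) x‖ₑ * A.indicator 1 (Γ.curve i x) ∂unitMeasure := by
  rw [arcLength_eq, Measure.finsetSum_apply]
  refine Finset.sum_congr rfl fun i _ => ?_
  have hpre := (Γ.continuous_curve i).measurable hA
  rw [Measure.map_apply (Γ.continuous_curve i).measurable hA, speedMeasure,
    withDensity_apply _ hpre, ← lintegral_indicator hpre]
  refine lintegral_congr fun x => ?_
  by_cases hx : Γ.curve i x ∈ A <;> simp [hx, ofReal_norm]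

namespace IsSymmetric

/-- Inversion changes arc length by the factor `1 / |z|²`, and `|z| ≤ D` on the contour. In
particular it respects null sets and acts boundedly on `L²`. -/
theorem exists_map_inv_le (hΓ : Γ.IsSymmetric ζ) :
    ∃ B : ℝ≥0, Measure.map (fun z : ℂ => z⁻¹) Γ.arcLength ≤ B • Γ.arcLength := by
  obtain ⟨D, hD0, hD⟩ := exists_norm_le Γ
  refine ⟨(D ^ 2).toNNReal, Measure.le_iff.2 fun A hA => ?_⟩
  have hA' : MeasurableSet ((fun z : ℂ => z⁻¹) ⁻¹' A) := measurable_inv hA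
  rw [Measure.map_apply measurable_inv hA, arcLength_apply Γ hA', Measure.smul_apply,
    arcLength_apply Γ hA,
    Finset.sum_congr rfl fun i _ => hΓ.lintegral_eq_sum_overlap i _,
    Finset.sum_congr rfl fun i _ => hΓ.lintegral_eq_sum_overlap i _, Finset.sum_comm,
    ENNReal.smul_def, smul_eq_mul, Finset.mul_sum]
  refine Finset.sum_le_sum fun j _ => ?_
  rw [Finset.mul_sum]
  refine Finset.sum_le_sum fun i _ => ?_
  rw [hΓ.lintegral_overlap i j, ← lintegral_const_mul' _ _ ENNReal.coe_ne_top]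
  refine lintegral_mono_ae ?_
  filter_upwards [ae_restrict_mem (measurableSet_overlap i j)] with x hx
  have h0 := hΓ.curve_ne_zero i hx.1.1
  have h1 : A.indicator (1 : ℂ → ℝ≥0∞) (Γ.curve i x)⁻¹ =
    ((fun z : ℂ => z⁻¹) ⁻¹' A).indicator 1 (Γ.curve i x) := rfl
  rw [← h1, ← mul_assoc]
  gcongr
  rw [← ofReal_norm, ← ofReal_norm]
  change _ ≤ ENNReal.ofReal (D ^ 2) * _
  rw [← ENNReal.ofReal_mul (by positivity)]
  apply ENNReal.ofReal_le_ofReal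
  have h2 := hD _ (Γ.curve_mem_carrier i hx.1.1)
  have h3 : 0 < ‖Γ.curve i x‖ := norm_pos_iff.2 h0
  rw [norm_div, norm_pow, ← mul_div_assoc, le_div_iff₀ (by positivity), mul_comm]
  gcongr

theorem quasiMeasurePreserving_inv (hΓ : Γ.IsSymmetric ζ) :
    Measure.QuasiMeasurePreserving (fun z : ℂ => z⁻¹) Γ.arcLength Γ.arcLength := by
  obtain ⟨B, hB⟩ := hΓ.exists_map_inv_le
  exact ⟨measurable_inv, (Measure.absolutelyContinuous_of_le hB).trans
    (Measure.AbsolutelyContinuous.rfl.smul_left _)⟩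

theorem exists_eLpNorm_inv_le (hΓ : Γ.IsSymmetric ζ) : ∃ B : ℝ≥0, ∀ f : ℂ → Fin 2 → ℂ,
    AEStronglyMeasurable f Γ.arcLength →
      eLpNorm (fun z => f z⁻¹) 2 Γ.arcLength ≤ B * eLpNorm f 2 Γ.arcLength := by
  obtain ⟨B, hB⟩ := hΓ.exists_map_inv_le
  refine ⟨B ^ (1 / 2 : ℝ), fun f hf => ?_⟩
  have h1 : AEStronglyMeasurable f (Measure.map (fun z : ℂ => z⁻¹) Γ.arcLength) :=
    hf.mono_ac hΓ.quasiMeasurePreserving_inv.absolutelyContinuous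
  have h2 := eLpNorm_map_measure (p := 2) h1 measurable_inv.aemeasurable
  change eLpNorm (f ∘ fun z : ℂ => z⁻¹) 2 Γ.arcLength ≤ _
  rw [← h2]
  refine (eLpNorm_mono_measure _ hB).trans ?_
  change eLpNorm f 2 ((B : ℝ≥0∞) • Γ.arcLength) ≤ _
  rw [eLpNorm_smul_measure_of_ne_top (by norm_num)]
  simp [ENNReal.coe_rpow_of_nonneg]

end IsSymmetric

end OrientedContour

/-! ### Non-tangential approach to regular points -/

namespace OrientedContour

variable {n : ℕ} {Γ : OrientedContour n} {ζ : ℝ}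

/-- Points close to the normal at a regular point see the contour under a positive angle. -/
theorem exists_cone_bound {i : Fin n} {x : ℝ} (hx : x ∈ Γ.regularParams i) {s : ℝ}
    (hs : s = 1 ∨ s = -1) : ∃ κ > 0, ∃ R > 0, ∀ ε, 0 < ε → ε < R → ∀ q : ℂ,
      ‖q - normalShift (Γ.curve i) s ε x‖ ≤ κ * ε → ∀ z ∈ Γ.carrier,
        κ * (‖z - Γ.curve i x‖ + ε) ≤ ‖z - q‖ := by
  obtain ⟨c, hc, r, hr, hb⟩ :=
    exists_norm_sub_normalShift_ge (Γ.smooth i) hs (Γ.regular i x hx.1)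
  obtain ⟨m, M, hm, hM, hsp⟩ := Γ.exists_speed_bounds
  -- The contour without a short arc around the point. It stays at a positive distance, because the
  -- point is not exceptional.
  set K : Set ℂ := (⋃ j ∈ {j | j ≠ i}, Γ.curve j '' Icc 0 1) ∪
    Γ.curve i '' (Icc 0 1 \ Metric.ball x r) with hK
  have hKc : IsClosed K := by
    refine IsCompact.isClosed (IsCompact.union ?_ ?_)
    · exact (toFinite _).isCompact_biUnion fun j _ => isCompact_Icc.image (Γ.continuous_curve j)
    · exact (isCompact_Icc.diff Metric.isOpen_ball).image (Γ.continuous_curve i)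
  have hpK : Γ.curve i x ∉ K := by
    rintro (h | ⟨y, hy, hyx⟩)
    · simp only [mem_iUnion] at h
      obtain ⟨j, hj, y, hy, hyx⟩ := h
      exact hj (eq_of_curve_eq hy hx.1 hyx hx.2).1
    · refine hy.2 ?_
      rw [(eq_of_curve_eq hy.1 hx.1 hyx hx.2).2]
      exact Metric.mem_ball_self hr
  obtain ⟨δ, hδ, hδK⟩ := Metric.isOpen_iff.1 hKc.isOpen_compl _ hpK
  have hfar : ∀ z ∈ K, δ ≤ ‖z - Γ.curve i x‖ := by
    intro z hz
    by_contra hlt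
    exact hδK (mem_ball_iff_norm.2 (not_le.1 hlt)) hz
  have hlip : ∀ y ∈ Icc (0 : ℝ) 1, ‖Γ.curve i y - Γ.curve i x‖ ≤ M * |y - x| := fun y hy =>
    (convex_Icc (0 : ℝ) 1).norm_image_sub_le_of_norm_deriv_le
      (fun t _ => Γ.differentiable_curve i t) (fun t ht => (hsp i t ht).2) hx.1 hy
  -- The factor `1 / 2` serves the distant part `K`. The factor `c / (M + 2)` serves the nearby arc,
  -- where `‖z - γ(x)‖ ≤ M |y - x|` and the distance to `q` costs another `κ ε`.
  refine ⟨min (1 / 2) (c / (M + 2)), by positivity, min r (δ / (2 * (1 + M))), by positivity,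
    fun ε hε hεR q hq z hz => ?_⟩
  set κ := min (1 / 2) (c / (M + 2)) with hκ
  have hκ1 : κ ≤ 1 / 2 := min_le_left _ _
  have hκ2 : κ * (M + 2) ≤ c := (le_div_iff₀ (by positivity)).1 (min_le_right _ _)
  have hκ0 : 0 < κ := by positivity
  have hcase : z ∈ K ∨ ∃ y ∈ Icc (0 : ℝ) 1, |y - x| < r ∧ Γ.curve i y = z := by
    obtain ⟨j, y, hy, rfl⟩ := mem_iUnion.1 hz
    by_cases hj : j = i
    · subst hj
      by_cases hyr : |y - x| < r
      · exact Or.inr ⟨y, hy, hyr, rfl⟩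
      · exact Or.inl (Or.inr ⟨y, ⟨hy, fun h => hyr (by rwa [Metric.mem_ball, Real.dist_eq] at h)⟩,
          rfl⟩)
    · exact Or.inl (Or.inl (by simp only [mem_iUnion]; exact ⟨j, hj, y, hy, rfl⟩))
  rcases hcase with hzK | ⟨y, hy, hyr, rfl⟩
  · have h1 := hfar z hzK
    have h2 : ‖normalShift (Γ.curve i) s ε x - Γ.curve i x‖ ≤ M * ε := by
      rw [normalShift, add_sub_cancel_left, norm_mul, norm_mul, norm_mul, Complex.norm_I,
        Complex.norm_real, Complex.norm_real, Real.norm_eq_abs, Real.norm_eq_abs, abs_of_pos hε]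
      have : |s| = 1 := by rcases hs with rfl | rfl <;> simp
      rw [this, one_mul, mul_one, mul_comm]
      gcongr
      exact (hsp i x hx.1).2
    have h3 : ‖z - Γ.curve i x‖ ≤ ‖z - q‖ + ‖q - normalShift (Γ.curve i) s ε x‖ +
        ‖normalShift (Γ.curve i) s ε x - Γ.curve i x‖ := by
      refine le_trans (le_of_eq ?_) (norm_add₃_le (a := z - q)
        (b := q - normalShift (Γ.curve i) s ε x) (c := normalShift (Γ.curve i) s ε x - Γ.curve i x))
      congr 1
      ring
    have h4 : ε * (2 * (1 + M)) ≤ δ :=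
      (le_div_iff₀ (by positivity)).1 (hεR.le.trans (min_le_right _ _))
    have h5 : κ * ‖z - Γ.curve i x‖ ≤ 1 / 2 * ‖z - Γ.curve i x‖ := by gcongr
    have h6 : κ * ε ≤ 1 / 2 * ε := by gcongr
    nlinarith
  · have h1 := hb ε x y (by rw [abs_of_pos hε]; exact hεR.trans_le (min_le_left _ _)) (by simpa)
      hyr
    rw [abs_of_pos hε] at h1
    have h3 : ‖Γ.curve i y - normalShift (Γ.curve i) s ε x‖ ≤
        ‖Γ.curve i y - q‖ + ‖q - normalShift (Γ.curve i) s ε x‖ := by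
      refine le_trans (le_of_eq ?_) (norm_add_le _ _)
      congr 1
      ring
    have h4 : κ * ‖Γ.curve i y - Γ.curve i x‖ ≤ κ * (M * |y - x|) := by
      gcongr
      exact hlip y hy
    have h5 : κ * (M + 2) * |y - x| ≤ c * |y - x| := by gcongr
    have h6 : κ * (M + 2) * ε ≤ c * ε := by gcongr
    have h7 : 0 ≤ κ * |y - x| := by positivity
    have h8 : 0 ≤ κ * M * ε := by positivity
    nlinarith

theorem hasDerivAt_cauchySum {u : Fin n → ℝ → ℂ} (hu : ∀ j, Integrable (u j) unitMeasure) {z : ℂ}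
    (hz : z ∉ Γ.carrier) : HasDerivAt (Γ.cauchySum u)
      (∑ j, ∫ y, deriv (Γ.curve j) y * u j y / (Γ.curve j y - z) ^ 2 ∂unitMeasure) z := by
  obtain ⟨m, M, hm, hM, hsp⟩ := Γ.exists_speed_bounds
  obtain ⟨δ, hδ, hd⟩ := Γ.exists_dist_ge hz
  unfold cauchySum
  refine HasDerivAt.fun_sum fun j _ => ?_
  have hball : ∀ z' ∈ Metric.ball z (δ / 2), ∀ s ∈ Γ.carrier, δ / 2 ≤ ‖s - z'‖ := by
    intro z' hz' s hs
    have h1 := hd s hs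
    have h2 := dist_triangle z z' s
    rw [Metric.mem_ball, dist_comm] at hz'
    rw [← dist_eq_norm, dist_comm s z']
    linarith
  have hnot : ∀ z' ∈ Metric.ball z (δ / 2), z' ∉ Γ.carrier := fun z' hz' h => by
    have := hball z' hz' z' h
    rw [sub_self, norm_zero] at this
    linarith
  have hc1 := (Γ.continuous_curve j)
  have hc2 := (Γ.continuous_deriv_curve j)
  refine (hasDerivAt_integral_of_dominated_loc_of_deriv_le
    (F := fun z y => deriv (Γ.curve j) y * u j y / (Γ.curve j y - z))
    (F' := fun z y => deriv (Γ.curve j) y * u j y / (Γ.curve j y - z) ^ 2)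
    (bound := fun y => M / (δ / 2) ^ 2 * ‖u j y‖) (Metric.ball_mem_nhds z (half_pos hδ))
    ?_ (Γ.integrable_cauchy_of_dist_ge (hu j) j hz) ?_ ?_ ((hu j).norm.const_mul _) ?_).2
  · filter_upwards [Metric.ball_mem_nhds z (half_pos hδ)] with z' hz'
    exact (Γ.integrable_cauchy_of_dist_ge (hu j) j (hnot z' hz')).1
  · have h1 := (hu j).1.aemeasurable
    have h2 := hc1.measurable
    have h3 := hc2.measurable
    exact AEMeasurable.aestronglyMeasurable (by fun_prop)
  · filter_upwards [ae_restrict_mem measurableSet_Icc] with y hy z' hz'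
    rw [norm_div, norm_mul, norm_pow, div_mul_eq_mul_div]
    gcongr
    · exact (hsp j y hy).2
    · exact hball z' hz' _ (Γ.curve_mem_carrier j hy)
  · filter_upwards [ae_restrict_mem measurableSet_Icc] with y hy z' hz'
    have hne : Γ.curve j y - z' ≠ 0 := fun h => hnot z' hz' (by
      rw [← sub_eq_zero.1 h]; exact Γ.curve_mem_carrier j hy)
    have h1 : HasDerivAt (fun w => Γ.curve j y - w) (-1) z' := (hasDerivAt_id z').const_sub _
    refine ((hasDerivAt_const z' (deriv (Γ.curve j) y * u j y)).div h1 hne).congr_deriv ?_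
    simp

/-- The derivative of the Cauchy integral of the constant `1` involves only the end points of the
curves, so it stays bounded near interior points of the contour. -/
theorem integral_deriv_div_sq (j : Fin n) {z : ℂ} (hz : z ∉ Γ.carrier) :
    ∫ y, deriv (Γ.curve j) y * 1 / (Γ.curve j y - z) ^ 2 ∂unitMeasure =
      (Γ.curve j 0 - z)⁻¹ - (Γ.curve j 1 - z)⁻¹ := by
  have hne : ∀ y ∈ uIcc (0 : ℝ) 1, Γ.curve j y - z ≠ 0 := fun y hy h => by
    rw [uIcc_of_le zero_le_one] at hy
    exact hz (by rw [← sub_eq_zero.1 h]; exact Γ.curve_mem_carrier j hy)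
  have hd : ∀ y ∈ uIcc (0 : ℝ) 1, HasDerivAt (fun y => -(Γ.curve j y - z)⁻¹)
      (deriv (Γ.curve j) y * 1 / (Γ.curve j y - z) ^ 2) y := by
    intro y hy
    have h1 : HasDerivAt (fun y => Γ.curve j y - z) (deriv (Γ.curve j) y) y :=
      (Γ.differentiable_curve j y).hasDerivAt.sub_const z
    refine (h1.fun_inv (hne y hy)).neg.congr_deriv ?_
    ring
  have hint : IntervalIntegrable (fun y => deriv (Γ.curve j) y * 1 / (Γ.curve j y - z) ^ 2)
      volume 0 1 := by
    refine ContinuousOn.intervalIntegrable ?_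
    refine ContinuousOn.div ?_ ?_ fun y hy => pow_ne_zero 2 (hne y hy)
    · exact ((Γ.continuous_deriv_curve j).mul continuous_const).continuousOn
    · exact (((Γ.continuous_curve j).sub continuous_const).pow 2).continuousOn
  rw [integral_Icc_eq_integral_Ioc, ← intervalIntegral.integral_of_le zero_le_one,
    intervalIntegral.integral_eq_sub_of_hasDerivAt hd hint]
  ring

/-- Along two paths that approach a point of the contour under a positive angle from the same
side, the Cauchy integral of a Lipschitz function has the same limiting behaviour. -/
theorem tendsto_cauchySum_sub {f : ℂ → ℂ} {L : ℝ≥0} (hf : LipschitzWith L f) {p : ℂ}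
    (hp : p ∉ Γ.exceptional) {q₁ q₂ : ℝ → ℂ} (h₁ : Tendsto q₁ (𝓝[>] 0) (𝓝 p))
    (h₂ : Tendsto q₂ (𝓝[>] 0) (𝓝 p)) {κ : ℝ} (hκ : 0 < κ)
    (hq : ∀ᶠ ε in 𝓝[>] 0, ∀ q ∈ segment ℝ (q₁ ε) (q₂ ε), q ∉ Γ.carrier ∧
      ∀ z ∈ Γ.carrier, κ * ‖z - p‖ ≤ ‖z - q‖) :
    Tendsto (fun ε => Γ.cauchySum (fun j y => f (Γ.curve j y)) (q₁ ε) -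
      Γ.cauchySum (fun j y => f (Γ.curve j y)) (q₂ ε)) (𝓝[>] 0) (𝓝 0) := by
  obtain ⟨m, M, hm, hM, hsp⟩ := Γ.exists_speed_bounds
  -- Split off the constant `f p`. The remaining density vanishes at `p` to first order, and under a
  -- positive angle this compensates the singularity: `A` is continuous along both paths.
  set A := Γ.cauchySum (fun j y => f (Γ.curve j y) - f p) with hA
  set W := Γ.cauchySum (fun _ _ => 1) with hW
  have hfc : ∀ j, Integrable (fun y => f (Γ.curve j y)) unitMeasure := fun j =>
    (hf.continuous.comp (Γ.continuous_curve j)).continuousOn.integrableOn_compact isCompact_Icc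
  have hsplit : ∀ z ∉ Γ.carrier,
      Γ.cauchySum (fun j y => f (Γ.curve j y)) z = A z + f p * W z := by
    intro z hz
    simp only [hA, hW, cauchySum]
    rw [Finset.mul_sum, ← Finset.sum_add_distrib]
    refine Finset.sum_congr rfl fun j _ => ?_
    rw [← integral_const_mul, ← integral_add]
    · congr 1
      ext y
      ring
    · exact Γ.integrable_cauchy_of_dist_ge ((hfc j).sub (integrable_const _)) j hz
    · exact (Γ.integrable_cauchy_of_dist_ge (integrable_const _) j hz).const_mul _
  have hAlim : ∀ q : ℝ → ℂ, Tendsto q (𝓝[>] 0) (𝓝 p) →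
      (∀ᶠ ε in 𝓝[>] 0, ∀ z ∈ Γ.carrier, κ * ‖z - p‖ ≤ ‖z - q ε‖) →
      Tendsto (fun ε => A (q ε)) (𝓝[>] 0) (𝓝 (A p)) := by
    intro q hq hcone
    refine tendsto_finsetSum _ fun j _ => ?_
    have hc1 := (Γ.continuous_curve j).measurable
    have hc2 := (Γ.continuous_deriv_curve j).measurable
    have hc3 := (hf.continuous.comp (Γ.continuous_curve j)).measurable
    refine tendsto_integral_filter_of_dominated_convergence (fun _ => M * (L / κ)) ?_ ?_
      (integrable_const _) ?_
    · refine Eventually.of_forall fun ε => AEMeasurable.aestronglyMeasurable ?_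
      exact ((hc2.mul (hc3.sub_const _)).div (hc1.sub_const _)).aemeasurable
    · filter_upwards [hcone] with ε hε
      filter_upwards [ae_restrict_mem measurableSet_Icc] with y hy
      rw [mul_div_assoc, norm_mul]
      refine mul_le_mul (hsp j y hy).2 ?_ (norm_nonneg _) hM.le
      have h1 := hε _ (Γ.curve_mem_carrier j hy)
      have h2 := hf.norm_sub_le (Γ.curve j y) p
      rw [norm_div]
      refine div_le_of_le_mul₀ (norm_nonneg _) (by positivity) (h2.trans ?_)
      calc (L : ℝ) * ‖Γ.curve j y - p‖ = L / κ * (κ * ‖Γ.curve j y - p‖) := by field_simp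
        _ ≤ _ := by gcongr
    · refine Eventually.of_forall fun y => ?_
      by_cases hy : Γ.curve j y = p
      · simp [hy]
      · exact tendsto_const_nhds.div (tendsto_const_nhds.sub hq) (sub_ne_zero.2 hy)
  have hp0 : ∀ j, Γ.curve j 0 ≠ p := fun j h => hp (h ▸ Γ.curve_zero_mem_exceptional j)
  have hp1 : ∀ j, Γ.curve j 1 ≠ p := fun j h => hp (h ▸ Γ.curve_one_mem_exceptional j)
  -- A bound for the derivative of `W` on the segments, depending only on the distances from `p` to
  -- the end points. As the segments avoid the contour, the mean value inequality gives `W (q₁ ε) -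
  -- W (q₂ ε) → 0`.
  set B := ∑ j, ((κ * ‖Γ.curve j 0 - p‖)⁻¹ + (κ * ‖Γ.curve j 1 - p‖)⁻¹) with hB
  have hWlim : Tendsto (fun ε => W (q₁ ε) - W (q₂ ε)) (𝓝[>] 0) (𝓝 0) := by
    have hlim : Tendsto (fun ε => B * ‖q₁ ε - q₂ ε‖) (𝓝[>] 0) (𝓝 0) := by
      have := ((h₁.sub h₂).norm).const_mul B
      simpa using this
    refine squeeze_zero_norm' ?_ hlim
    filter_upwards [hq] with ε hε
    refine (convex_segment (𝕜 := ℝ) (q₁ ε) (q₂ ε)).norm_image_sub_le_of_norm_hasDerivWithin_le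
      (f' := fun z => ∑ j, ((Γ.curve j 0 - z)⁻¹ - (Γ.curve j 1 - z)⁻¹)) (fun z hz => ?_)
      (fun z hz => ?_) (right_mem_segment ℝ _ _) (left_mem_segment ℝ _ _)
    · have := hasDerivAt_cauchySum (Γ := Γ) (u := fun _ _ => 1) (fun j => integrable_const _)
        (hε z hz).1
      rw [Finset.sum_congr rfl fun j _ => integral_deriv_div_sq j (hε z hz).1] at this
      exact this.hasDerivWithinAt
    · refine (norm_sum_le _ _).trans (Finset.sum_le_sum fun j _ => (norm_sub_le _ _).trans ?_)
      rw [norm_inv, norm_inv]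
      have h0 : 0 < ‖Γ.curve j 0 - p‖ := norm_pos_iff.2 (sub_ne_zero.2 (hp0 j))
      have h1 : 0 < ‖Γ.curve j 1 - p‖ := norm_pos_iff.2 (sub_ne_zero.2 (hp1 j))
      gcongr
      · exact (hε z hz).2 _ (Γ.curve_mem_carrier j (by simp))
      · exact (hε z hz).2 _ (Γ.curve_mem_carrier j (by simp))
  have hA₁ := hAlim q₁ h₁ (hq.mono fun ε h => (h _ (left_mem_segment ℝ _ _)).2)
  have hA₂ := hAlim q₂ h₂ (hq.mono fun ε h => (h _ (right_mem_segment ℝ _ _)).2)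
  have htot := (hA₁.sub hA₂).add (hWlim.const_mul (f p))
  rw [sub_self, mul_zero, add_zero] at htot
  refine htot.congr' ?_
  filter_upwards [hq] with ε hε
  rw [hsplit _ (hε _ (left_mem_segment ℝ _ _)).1, hsplit _ (hε _ (right_mem_segment ℝ _ _)).1]
  ring

end OrientedContour

/-! ### Reflection of Cauchy integrals under inversion -/

theorem vecMul_swapMatrix_apply (v : Fin 2 → ℂ) (k : Fin 2) : (v ᵥ* swapMatrix) k = v (1 - k) := by
  fin_cases k <;> simp [swapMatrix, Matrix.vecMul, dotProduct]

theorem vecMul_swapMatrix_swapMatrix (v : Fin 2 → ℂ) : v ᵥ* swapMatrix ᵥ* swapMatrix = v := by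
  ext k
  rw [vecMul_swapMatrix_apply, vecMul_swapMatrix_apply, sub_sub_cancel]

theorem norm_vecMul_swapMatrix (v : Fin 2 → ℂ) : ‖v ᵥ* swapMatrix‖ = ‖v‖ := by
  have h : ∀ v : Fin 2 → ℂ, ‖v ᵥ* swapMatrix‖ ≤ ‖v‖ := fun v =>
    (pi_norm_le_iff_of_nonneg (norm_nonneg _)).2 fun k => by
      rw [vecMul_swapMatrix_apply]
      exact norm_le_pi_norm v _
  refine le_antisymm (h v) ?_
  conv_lhs => rw [← vecMul_swapMatrix_swapMatrix v]
  exact h _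

theorem kernelPole_one_sub (ζ : ℝ) (k : Fin 2) : kernelPole ζ (1 - k) = (kernelPole ζ k)⁻¹ := by
  fin_cases k <;> simp [kernelPole]

theorem continuous_vecMul_swapMatrix : Continuous fun v : Fin 2 → ℂ => v ᵥ* swapMatrix := by
  fun_prop

/-- The density whose Cauchy integral is the reflection of the Cauchy integral of `f`. -/
noncomputable def invertDensity (f : ℂ → Fin 2 → ℂ) (z : ℂ) : Fin 2 → ℂ := -(f z⁻¹ ᵥ* swapMatrix)

theorem invertDensity_sub (f g : ℂ → Fin 2 → ℂ) :
    invertDensity (f - g) = invertDensity f - invertDensity g := by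
  ext z : 1
  simp only [invertDensity, Pi.sub_apply, Matrix.sub_vecMul]
  abel

namespace OrientedContour

variable {n : ℕ} {Γ : OrientedContour n} {ζ : ℝ}

theorem cauchyOp_eq_contourSum (hζ : ∀ k, kernelPole ζ k ∉ Γ.carrier) {f : ℂ → Fin 2 → ℂ}
    (hf : MemLp f 2 Γ.arcLength) {z : ℂ} (hz : z ∉ Γ.carrier) (k : Fin 2) :
    Γ.cauchyOp ζ f z k = (2 * Real.pi * Complex.I)⁻¹ *
      Γ.contourSum fun s => f s k * (1 / (s - z) - 1 / (s - kernelPole ζ k)) := by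
  rw [Γ.cauchyOp_apply_of_notMem hζ hf hz, cauchySum, cauchySum, contourSum,
    ← Finset.sum_sub_distrib]
  congr 1
  refine Finset.sum_congr rfl fun j _ => ?_
  have hint := (Γ.memLp_pullback hf k j).integrable (by norm_num)
  rw [← integral_sub (Γ.integrable_cauchy_of_dist_ge hint j hz)
    (Γ.integrable_cauchy_of_dist_ge hint j (hζ k))]
  congr 1
  ext y
  simp only [pullback]
  ring

theorem integrable_contourSum_kernel (hζ : ∀ k, kernelPole ζ k ∉ Γ.carrier) {f : ℂ → Fin 2 → ℂ}
    (hf : MemLp f 2 Γ.arcLength) {z : ℂ} (hz : z ∉ Γ.carrier) (k l : Fin 2) (j : Fin n) :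
    Integrable (fun y => deriv (Γ.curve j) y * (f (Γ.curve j y) k *
      (1 / (Γ.curve j y - z) - 1 / (Γ.curve j y - kernelPole ζ l)))) unitMeasure := by
  have hint := (Γ.memLp_pullback hf k j).integrable (by norm_num)
  refine ((Γ.integrable_cauchy_of_dist_ge hint j hz).sub
    (Γ.integrable_cauchy_of_dist_ge hint j (hζ l))).congr (Eventually.of_forall fun y => ?_)
  simp only [Pi.sub_apply, pullback]
  ring

theorem sub_ne_zero_of_notMem_carrier {a : ℂ} (ha : a ∉ Γ.carrier) {z : ℂ} (hz : z ∈ Γ.carrier) :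
    z - a ≠ 0 := fun h => ha (sub_eq_zero.1 h ▸ hz)

namespace IsSymmetric

theorem memLp_invertDensity (hΓ : Γ.IsSymmetric ζ) {f : ℂ → Fin 2 → ℂ}
    (hf : MemLp f 2 Γ.arcLength) : MemLp (invertDensity f) 2 Γ.arcLength := by
  obtain ⟨B, hB⟩ := hΓ.exists_eLpNorm_inv_le
  have h1 : MemLp (fun z => f z⁻¹) 2 Γ.arcLength :=
    ⟨hf.1.comp_quasiMeasurePreserving hΓ.quasiMeasurePreserving_inv,
      (hB f hf.1).trans_lt (ENNReal.mul_lt_top ENNReal.coe_lt_top hf.2)⟩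
  refine h1.of_le ((continuous_vecMul_swapMatrix.comp_aestronglyMeasurable h1.1).neg)
    (Eventually.of_forall fun z => ?_)
  rw [invertDensity, norm_neg, norm_vecMul_swapMatrix]

/-- Substituting `s ↦ 1/s` turns the difference of Cauchy kernels into its negative, because the
additive constants cancel between the two terms. Inversion also interchanges the poles `ζ` and
`ζ⁻¹`, which matches the exchange of the components. -/
theorem cauchyOp_invertDensity (hΓ : Γ.IsSymmetric ζ) (hζ : ζ ≠ 0) {f : ℂ → Fin 2 → ℂ}
    (hf : MemLp f 2 Γ.arcLength) {z : ℂ} (hz : z ∉ Γ.carrier) (hz0 : z ≠ 0) :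
    Γ.cauchyOp ζ (invertDensity f) z = Γ.cauchyOp ζ f z⁻¹ ᵥ* swapMatrix := by
  have hpole := hΓ.kernelPole_notMem
  have hz' : z⁻¹ ∉ Γ.carrier := fun h => hz (hΓ.inv_mem_carrier.1 h)
  ext k
  have hk0 : kernelPole ζ k ≠ 0 := by fin_cases k <;> simp [kernelPole, hζ]
  have hker : ∀ s ∈ Γ.carrier, f s⁻¹ (1 - k) * (1 / (s⁻¹ - z⁻¹) -
      1 / (s⁻¹ - kernelPole ζ (1 - k))) / s ^ 2 = invertDensity f s k *
      (1 / (s - z) - 1 / (s - kernelPole ζ k)) := by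
    intro s hs
    have hs0 : s ≠ 0 := fun h => hΓ.zero_notMem (h ▸ hs)
    have h1 : s - z ≠ 0 := sub_ne_zero_of_notMem_carrier hz hs
    have h2 : s - kernelPole ζ k ≠ 0 := sub_ne_zero_of_notMem_carrier (hpole k) hs
    have h3 : ∀ a : ℂ, a ≠ 0 → s - a ≠ 0 → 1 / (s⁻¹ - a⁻¹) = -(s * a / (s - a)) := by
      intro a ha hsa
      have : s⁻¹ - a⁻¹ = -((s - a) / (s * a)) := by
        field_simp
        ring
      rw [this, one_div, inv_neg, inv_div]
    rw [kernelPole_one_sub, h3 z hz0 h1, h3 _ hk0 h2, invertDensity, Pi.neg_apply,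
      vecMul_swapMatrix_apply]
    field_simp
    ring
  rw [vecMul_swapMatrix_apply, cauchyOp_eq_contourSum hpole hf hz',
    cauchyOp_eq_contourSum hpole (hΓ.memLp_invertDensity hf) hz]
  congr 1
  have hcongr : ∀ j, (fun y => deriv (Γ.curve j) y * (invertDensity f (Γ.curve j y) k *
      (1 / (Γ.curve j y - z) - 1 / (Γ.curve j y - kernelPole ζ k)))) =ᵐ[unitMeasure]
      fun y => deriv (Γ.curve j) y * (f (Γ.curve j y)⁻¹ (1 - k) * (1 / ((Γ.curve j y)⁻¹ - z⁻¹) -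
      1 / ((Γ.curve j y)⁻¹ - kernelPole ζ (1 - k))) / (Γ.curve j y) ^ 2) := by
    intro j
    filter_upwards [ae_restrict_mem measurableSet_Icc] with y hy
    rw [hker _ (Γ.curve_mem_carrier j hy)]
  rw [hΓ.contourSum_inv (g := fun s => f s (1 - k) *
    (1 / (s - z⁻¹) - 1 / (s - kernelPole ζ (1 - k))))]
  · exact Finset.sum_congr rfl fun j _ => integral_congr_ae (hcongr j)
  · exact fun j => integrable_contourSum_kernel hpole hf hz' (1 - k) (1 - k) j
  · exact fun j => (integrable_contourSum_kernel hpole (hΓ.memLp_invertDensity hf) hz k k j).congr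
      (hcongr j)

end IsSymmetric

theorem tendsto_normalShift (g : ℝ → ℂ) (s x : ℝ) :
    Tendsto (fun ε => normalShift g s ε x) (𝓝[>] 0) (𝓝 (g x)) := by
  have h : Continuous fun ε => normalShift g s ε x := by
    unfold normalShift
    fun_prop
  have := (h.tendsto 0).mono_left (nhdsWithin_le_nhds (s := Ioi 0))
  rwa [normalShift_zero] at this

namespace IsSymmetric

/-- Inversion maps a normal at a regular point to a path that stays on the opposite side, close to
the normal at the image point. -/
theorem exists_segment_bound (hΓ : Γ.IsSymmetric ζ) {i j : Fin n} {x : ℝ}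
    (hx : x ∈ Γ.overlap i j) {s : ℝ} (hs : s = 1 ∨ s = -1) : ∃ κ > 0, ∀ᶠ ε in 𝓝[>] 0,
      ∀ q ∈ segment ℝ (normalShift (Γ.curve j) (-s) ε (Γ.invParam i j x))⁻¹
        (normalShift (Γ.curve i) s ε x), q ∉ Γ.carrier ∧
        ∀ z ∈ Γ.carrier, κ * ‖z - Γ.curve i x‖ ≤ ‖z - q‖ := by
  obtain ⟨κ, hκ, R, hR, hcone⟩ := exists_cone_bound hx.1 hs
  obtain ⟨c, hc, hcd, -⟩ := hΓ.exists_deriv_invParam hx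
  have h0 := hΓ.curve_ne_zero i hx.1.1
  set p := Γ.curve i x with hp
  set a : ℂ := s * Complex.I * deriv (Γ.curve i) x / p with ha
  have hN : ∀ ε : ℝ, normalShift (Γ.curve i) s ε x = p * (1 + ε * a) := by
    intro ε
    rw [normalShift, ha, ← hp]
    field_simp
  -- With `1 / (1 - cεa) = 1 + cεa + O(ε²)`, the inverted normal agrees to second order with the
  -- normal at `p` on the side `s`, at height `cε`.
  have hN' : ∀ ε : ℝ, (normalShift (Γ.curve j) (-s) ε (Γ.invParam i j x))⁻¹ =
      p * (1 - c * ε * a)⁻¹ := by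
    intro ε
    have : normalShift (Γ.curve j) (-s) ε (Γ.invParam i j x) = p⁻¹ * (1 - c * ε * a) := by
      rw [normalShift, hcd, curve_invParam hx, ← hp, ha]
      push_cast
      field_simp
      ring
    rw [this, mul_inv, inv_inv]
  have hm : 0 < min c 1 := by positivity
  have hcont : ContinuousAt (fun ε : ℝ => 1 - (c : ℂ) * ε * a) 0 := by fun_prop
  have hne : ∀ᶠ ε : ℝ in 𝓝[>] 0, 1 - (c : ℂ) * ε * a ≠ 0 := by
    refine nhdsWithin_le_nhds (hcont.eventually_ne ?_)
    simp
  have hsmall : ∀ᶠ ε : ℝ in 𝓝[>] 0,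
      ‖p * c ^ 2 * ε * a ^ 2 * (1 - (c : ℂ) * ε * a)⁻¹‖ < κ * min c 1 := by
    have h1 : ContinuousAt (fun ε : ℝ => ‖p * c ^ 2 * ε * a ^ 2 * (1 - (c : ℂ) * ε * a)⁻¹‖) 0 := by
      refine ContinuousAt.norm (ContinuousAt.mul (by fun_prop) (hcont.inv₀ (by simp)))
    have h2 := h1.tendsto
    simp only [Complex.ofReal_zero, mul_zero, zero_mul, norm_zero] at h2
    exact nhdsWithin_le_nhds (h2.eventually_lt_const (by positivity))
  have hRε : ∀ᶠ ε : ℝ in 𝓝[>] 0, ε * max c 1 < R := by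
    have h1 : ContinuousAt (fun ε : ℝ => ε * max c 1) 0 := by fun_prop
    have h2 := h1.tendsto
    simp only [zero_mul] at h2
    exact nhdsWithin_le_nhds (h2.eventually_lt_const hR)
  refine ⟨κ, hκ, ?_⟩
  filter_upwards [hne, hsmall, hRε, self_mem_nhdsWithin] with ε hne hsm hRε hε q hq
  have hε0 : (0 : ℝ) < ε := hε
  obtain ⟨θ₁, θ₂, hθ₁, hθ₂, hθ, rfl⟩ := hq
  -- The convex combination of the two heights. The point of the segment lies within `O(ε²)` of the
  -- normal at this height, hence in the cone.
  set ε' := θ₁ * (c * ε) + θ₂ * ε with hε'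
  have hlow : min c 1 * ε ≤ ε' := by
    calc min c 1 * ε = θ₁ * (min c 1 * ε) + θ₂ * (min c 1 * ε) := by rw [← add_mul, hθ, one_mul]
      _ ≤ θ₁ * (c * ε) + θ₂ * (1 * ε) := by
        gcongr
        · exact min_le_left _ _
        · exact min_le_right _ _
      _ = ε' := by rw [one_mul]
  have hup : ε' ≤ ε * max c 1 := by
    calc ε' = θ₁ * (c * ε) + θ₂ * (1 * ε) := by rw [one_mul]
      _ ≤ θ₁ * (max c 1 * ε) + θ₂ * (max c 1 * ε) := by
        gcongr
        · exact le_max_left _ _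
        · exact le_max_right _ _
      _ = ε * max c 1 := by rw [← add_mul, hθ, one_mul, mul_comm]
  have hε'0 : 0 < ε' := lt_of_lt_of_le (by positivity) hlow
  have hdist : ‖θ₁ • (normalShift (Γ.curve j) (-s) ε (Γ.invParam i j x))⁻¹ +
      θ₂ • normalShift (Γ.curve i) s ε x - normalShift (Γ.curve i) s ε' x‖ ≤ κ * ε' := by
    have hθc : (θ₁ : ℂ) = 1 - θ₂ := by
      rw [← Complex.ofReal_one, ← hθ]
      push_cast
      ring
    have heq : θ₁ • (normalShift (Γ.curve j) (-s) ε (Γ.invParam i j x))⁻¹ +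
        θ₂ • normalShift (Γ.curve i) s ε x - normalShift (Γ.curve i) s ε' x =
        θ₁ * ε * (p * c ^ 2 * ε * a ^ 2 * (1 - (c : ℂ) * ε * a)⁻¹) := by
      rw [hN, hN, hN', hε', Complex.real_smul, Complex.real_smul]
      push_cast
      rw [hθc]
      field_simp
      ring
    rw [heq, norm_mul, norm_mul, Complex.norm_of_nonneg hθ₁, Complex.norm_of_nonneg hε0.le]
    calc θ₁ * ε * ‖p * c ^ 2 * ε * a ^ 2 * (1 - (c : ℂ) * ε * a)⁻¹‖ ≤ 1 * ε * (κ * min c 1) := by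
          gcongr
          linarith
      _ = κ * (min c 1 * ε) := by ring
      _ ≤ κ * ε' := by gcongr
  have hb := hcone ε' hε'0 (hup.trans_lt hRε) _ hdist
  refine ⟨fun h => ?_, fun z hz => ?_⟩
  · have := hb _ h
    rw [sub_self, norm_zero] at this
    have h2 : 0 < κ * (‖(θ₁ • (normalShift (Γ.curve j) (-s) ε (Γ.invParam i j x))⁻¹ +
      θ₂ • normalShift (Γ.curve i) s ε x) - p‖ + ε') := by positivity
    linarith
  · refine le_trans ?_ (hb z hz)
    gcongr
    linarith

end IsSymmetric

theorem memLp_of_continuous {f : ℂ → Fin 2 → ℂ} (hf : Continuous f) : MemLp f 2 Γ.arcLength := by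
  refine Γ.memLp_arcLength hf.aestronglyMeasurable fun i => ?_
  have hc := hf.comp (Γ.continuous_curve i)
  obtain ⟨C, hC⟩ := isCompact_Icc.exists_bound_of_continuousOn (hc.continuousOn (s := Icc (0 : ℝ) 1))
  exact MemLp.of_bound hc.aestronglyMeasurable C
    ((ae_restrict_mem measurableSet_Icc).mono fun x hx => hC x hx)

namespace IsSymmetric

theorem tendsto_cauchyOp_sub (hΓ : Γ.IsSymmetric ζ) {f : ℂ → Fin 2 → ℂ} {L : ℝ≥0}
    (hf : LipschitzWith L f) {i j : Fin n} {x : ℝ} (hx : x ∈ Γ.overlap i j) {s : ℝ}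
    (hs : s = 1 ∨ s = -1) :
    Tendsto (fun ε =>
      Γ.cauchyOp ζ f (normalShift (Γ.curve j) (-s) ε (Γ.invParam i j x))⁻¹ -
      Γ.cauchyOp ζ f (normalShift (Γ.curve i) s ε x)) (𝓝[>] 0) (𝓝 0) := by
  obtain ⟨κ, hκ, hq⟩ := hΓ.exists_segment_bound hx hs
  have h0 := hΓ.curve_ne_zero i hx.1.1
  have h1 : Tendsto (fun ε => (normalShift (Γ.curve j) (-s) ε (Γ.invParam i j x))⁻¹) (𝓝[>] 0)
      (𝓝 (Γ.curve i x)) := by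
    have := tendsto_normalShift (Γ.curve j) (-s) (Γ.invParam i j x)
    rw [curve_invParam hx] at this
    simpa using this.inv₀ (inv_ne_zero h0)
  refine tendsto_pi_nhds.2 fun k => ?_
  have hfk : LipschitzWith L fun z => f z k := by
    have h := (LipschitzWith.eval (α := fun _ : Fin 2 => ℂ) k).comp hf
    rwa [one_mul] at h
  have hlim := (tendsto_cauchySum_sub hfk hx.1.2 h1 (tendsto_normalShift (Γ.curve i) s x) hκ
    hq).const_mul (2 * Real.pi * Complex.I : ℂ)⁻¹
  rw [mul_zero] at hlim
  refine hlim.congr' ?_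
  filter_upwards [hq] with ε hε
  rw [Pi.sub_apply,
    Γ.cauchyOp_apply_of_notMem hΓ.kernelPole_notMem (memLp_of_continuous hf.continuous)
      (hε _ (left_mem_segment ℝ _ _)).1,
    Γ.cauchyOp_apply_of_notMem hΓ.kernelPole_notMem (memLp_of_continuous hf.continuous)
      (hε _ (right_mem_segment ℝ _ _)).1]
  have hpb : Γ.pullback f k = fun j y => f (Γ.curve j y) k := rfl
  rw [hpb]
  ring

end IsSymmetric

end OrientedContour

/-! ### Inversion exchanges the boundary values -/

namespace OrientedContour

variable {n : ℕ} {Γ : OrientedContour n} {ζ : ℝ}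

instance isFiniteMeasure_arcLength : IsFiniteMeasure Γ.arcLength := by
  have h : MemLp (fun _ => (1 : ℂ)) 2 Γ.arcLength :=
    Γ.memLp_arcLength aestronglyMeasurable_const fun i => memLp_const 1
  exact ⟨((memLp_const_iff (by norm_num) (by norm_num)).1 h).resolve_left one_ne_zero⟩

/-- Convergence in `L²` gives almost sure convergence along a subsequence; dropping the first `N`
terms secures measurability. -/
theorem HasBoundaryValue.exists_seq_tendsto_ae {s : ℝ} {F : ℂ → Fin 2 → ℂ} {h : Γ.L2}
    (hF : ∀ i, ∀ᶠ ε in 𝓝[>] 0,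
      AEStronglyMeasurable (fun x => F (normalShift (Γ.curve i) s ε x)) unitMeasure)
    (H : Γ.HasBoundaryValue s F h) (i : Fin n) {ns : ℕ → ℝ} (hns : Tendsto ns atTop (𝓝[>] 0)) :
    ∃ φ : ℕ → ℕ, Tendsto φ atTop atTop ∧ ∀ᵐ x ∂unitMeasure,
      Tendsto (fun k => F (normalShift (Γ.curve i) s (ns (φ k)) x)) atTop
        (𝓝 (h (Γ.curve i x))) := by
  obtain ⟨N, hN⟩ := eventually_atTop.1 (hns.eventually (hF i))
  have hT : TendstoInMeasure unitMeasure
      (fun k x => F (normalShift (Γ.curve i) s (ns (k + N)) x)) atTop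
      (fun x => h (Γ.curve i x)) := by
    refine tendstoInMeasure_of_tendsto_eLpNorm (p := 2) (by norm_num)
      (fun k => hN _ (Nat.le_add_left _ _)) (Γ.memLp_curve (Lp.memLp h) i).1 ?_
    exact (H i).comp (hns.comp (tendsto_add_atTop_nat N))
  obtain ⟨ms, hms, hlim⟩ := hT.exists_seq_tendsto_ae
  exact ⟨fun k => ms k + N, (tendsto_add_atTop_nat N).comp hms.tendsto_atTop, hlim⟩

theorem ae_arcLength_of_ae_param (i : Fin n) {p : ℝ → Prop} (hp : ∀ᵐ x ∂unitMeasure, p x) :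
    ∀ᵐ z ∂Γ.arcLength, ∀ x ∈ Γ.regularParams i, Γ.curve i x = z → p x := by
  refine Γ.ae_arcLength_iff.2 fun l => ?_
  filter_upwards [hp, ae_restrict_mem measurableSet_Icc] with y hy hy01 x hx hxy
  obtain ⟨-, rfl⟩ := eq_of_curve_eq hy01 hx.1 hxy.symm hx.2
  exact hy

namespace IsSymmetric

/-- The reflection formula evaluates the Cauchy integral along inverted normals, whereas boundary
values refer to normals. For Lipschitz densities both paths have the same limit at almost every
point. -/
theorem boundaryValue_invertDensity_of_lipschitz (hΓ : Γ.IsSymmetric ζ) (hζ : ζ ≠ 0)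
    {f : ℂ → Fin 2 → ℂ} {L : ℝ≥0} (hf : LipschitzWith L f) {s : ℝ} (hs : s = 1 ∨ s = -1) :
    ∀ᵐ z ∂Γ.arcLength, Γ.boundaryValue (-s) (Γ.cauchyOp ζ (invertDensity f)) z =
      Γ.boundaryValue s (Γ.cauchyOp ζ f) z⁻¹ ᵥ* swapMatrix := by
  have hpole := hΓ.kernelPole_notMem
  have hfm : MemLp f 2 Γ.arcLength := memLp_of_continuous hf.continuous
  have hgm := hΓ.memLp_invertDensity hfm
  have hs' : -s = 1 ∨ -s = -1 := by rcases hs with rfl | rfl <;> simp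
  obtain ⟨B, hB⟩ := exists_boundaryValue_cauchyOp hpole
  refine Γ.ae_arcLength_iff.2 fun j => ?_
  suffices h : ∀ i, ∀ᵐ y ∂unitMeasure, y ∈ Γ.overlap j i →
      Γ.boundaryValue (-s) (Γ.cauchyOp ζ (invertDensity f)) (Γ.curve j y) =
      Γ.boundaryValue s (Γ.cauchyOp ζ f) (Γ.curve j y)⁻¹ ᵥ* swapMatrix by
    filter_upwards [ae_all_iff.2 h, Γ.ae_notMem_exceptionalParams j] with y hy hreg
    obtain ⟨i, hi⟩ := hΓ.exists_mem_overlap hreg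
    exact hy i hi
  intro i
  -- Successive subsequences give one sequence of heights along which the limits at the point and at
  -- its inverse both hold pointwise.
  obtain ⟨e, he⟩ := exists_seq_tendsto (𝓝[>] (0 : ℝ))
  obtain ⟨φ, hφ, hlim⟩ := ((hB f hfm).1 s hs).1.exists_seq_tendsto_ae
    (aestronglyMeasurable_cauchyOp_normalShift hpole hfm hs) i he
  obtain ⟨ψ, hψ, hlim'⟩ := ((hB _ hgm).1 (-s) hs').1.exists_seq_tendsto_ae
    (aestronglyMeasurable_cauchyOp_normalShift hpole hgm hs') j (he.comp hφ)
  have hinv := (Γ.quasiMeasurePreserving_curve j).ae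
    (hΓ.quasiMeasurePreserving_inv.ae (ae_arcLength_of_ae_param i hlim))
  filter_upwards [hlim', hinv] with y hy1 hy2 hyo
  have hxo := invParam_mem_overlap hyo
  have hx := hy2 (Γ.invParam j i y) hxo.1 (curve_invParam hyo)
  rw [curve_invParam hyo] at hx
  have hcmp := hΓ.tendsto_cauchyOp_sub hf hxo hs
  obtain ⟨κ, -, hseg⟩ := hΓ.exists_segment_bound hxo hs
  rw [invParam_invParam hyo] at hcmp hseg
  have hne : ∀ᶠ ε in 𝓝[>] 0, normalShift (Γ.curve j) (-s) ε y ≠ 0 :=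
    (tendsto_normalShift (Γ.curve j) (-s) y).eventually_ne (hΓ.curve_ne_zero j hyo.1.1)
  have hseq : Tendsto (fun k => e (φ (ψ k))) atTop (𝓝[>] 0) := he.comp (hφ.comp hψ)
  have h1 : Tendsto (fun k => Γ.cauchyOp ζ f
      (normalShift (Γ.curve j) (-s) (e (φ (ψ k))) y)⁻¹) atTop
      (𝓝 (Γ.boundaryValue s (Γ.cauchyOp ζ f) (Γ.curve j y)⁻¹)) := by
    have := (hcmp.comp hseq).add (hx.comp hψ)
    rw [zero_add] at this
    refine this.congr fun k => ?_
    simp only [Function.comp_apply, sub_add_cancel]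
  refine tendsto_nhds_unique hy1 ?_
  refine ((continuous_vecMul_swapMatrix.tendsto _).comp h1).congr' ?_
  filter_upwards [hseq.eventually hne, hseq.eventually hseg] with k hk1 hk2
  have hnot := (hk2 _ (left_mem_segment ℝ _ _)).1
  rw [hΓ.inv_mem_carrier] at hnot
  exact (hΓ.cauchyOp_invertDensity hζ hfm hnot hk1).symm

/-- Inversion exchanges the two boundary values of Cauchy integrals. -/
theorem boundaryValue_invertDensity (hΓ : Γ.IsSymmetric ζ) (hζ : ζ ≠ 0)
    {f : ℂ → Fin 2 → ℂ} (hf : MemLp f 2 Γ.arcLength) {s : ℝ} (hs : s = 1 ∨ s = -1) :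
    ∀ᵐ z ∂Γ.arcLength, Γ.boundaryValue (-s) (Γ.cauchyOp ζ (invertDensity f)) z =
      Γ.boundaryValue s (Γ.cauchyOp ζ f) z⁻¹ ᵥ* swapMatrix := by
  have hpole := hΓ.kernelPole_notMem
  have hs' : -s = 1 ∨ -s = -1 := by rcases hs with rfl | rfl <;> simp
  obtain ⟨B, hB⟩ := exists_boundaryValue_cauchyOp hpole
  obtain ⟨D, hD⟩ := hΓ.exists_eLpNorm_inv_le
  have hqmp := hΓ.quasiMeasurePreserving_inv
  have hDnorm : ∀ g : ℂ → Fin 2 → ℂ, AEStronglyMeasurable g Γ.arcLength →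
      eLpNorm (fun z => g z⁻¹ ᵥ* swapMatrix) 2 Γ.arcLength ≤ D * eLpNorm g 2 Γ.arcLength := by
    intro g hg
    refine le_trans (le_of_eq ?_) (hD g hg)
    exact eLpNorm_congr_norm_ae (Eventually.of_forall fun z => norm_vecMul_swapMatrix _)
  have hmeas : ∀ g : ℂ → Fin 2 → ℂ, AEStronglyMeasurable g Γ.arcLength →
      AEStronglyMeasurable (fun z => g z⁻¹ ᵥ* swapMatrix) Γ.arcLength := fun g hg =>
    continuous_vecMul_swapMatrix.comp_aestronglyMeasurable (hg.comp_quasiMeasurePreserving hqmp)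
  set b := Γ.boundaryValue s (Γ.cauchyOp ζ f) with hb
  set b' := Γ.boundaryValue (-s) (Γ.cauchyOp ζ (invertDensity f)) with hb'
  have hae : AEStronglyMeasurable (fun z => b' z - b z⁻¹ ᵥ* swapMatrix) Γ.arcLength :=
    (Lp.aestronglyMeasurable b').sub (hmeas b (Lp.aestronglyMeasurable b))
  have hbound : ∀ η : ℝ, 0 < η → eLpNorm (fun z => b' z - b z⁻¹ ᵥ* swapMatrix) 2 Γ.arcLength ≤
      (2 * B * D : ℝ≥0) * ENNReal.ofReal η := by
    intro η hη
    -- Smooth functions with compact support are Lipschitz and dense. Both sides of the claim depend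
    -- boundedly on the density, so the defect is at most `2 B D η` for every `η > 0`.
    obtain ⟨g, hgc, hg, hfg⟩ := hf.exist_eLpNorm_sub_le (by norm_num) (by norm_num) hη
    obtain ⟨L, hL⟩ := ContDiff.lipschitzWith_of_hasCompactSupport hgc hg (by simp)
    have hgm : MemLp g 2 Γ.arcLength := memLp_of_continuous hL.continuous
    have hG := hΓ.boundaryValue_invertDensity_of_lipschitz hζ hL hs
    have h1 := boundaryValue_cauchyOp_sub hpole hf hgm hs
    have h2 := boundaryValue_cauchyOp_sub hpole (hΓ.memLp_invertDensity hf)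
      (hΓ.memLp_invertDensity hgm) hs'
    rw [← invertDensity_sub] at h2
    set d := Γ.boundaryValue s (Γ.cauchyOp ζ (f - g)) with hd
    set d' := Γ.boundaryValue (-s) (Γ.cauchyOp ζ (invertDensity (f - g))) with hd'
    have hcongr : (fun z => b' z - b z⁻¹ ᵥ* swapMatrix) =ᵐ[Γ.arcLength]
        fun z => d' z - d z⁻¹ ᵥ* swapMatrix := by
      rw [h1, h2]
      filter_upwards [hG, Lp.coeFn_sub b' (Γ.boundaryValue (-s) (Γ.cauchyOp ζ (invertDensity g))),
        hqmp.ae (Lp.coeFn_sub b (Γ.boundaryValue s (Γ.cauchyOp ζ g)))] with z hz1 hz2 hz3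
      rw [hz2, hz3, Pi.sub_apply, Pi.sub_apply, Matrix.sub_vecMul, hz1]
      abel
    have hn1 : eLpNorm d 2 Γ.arcLength ≤ B * ENNReal.ofReal η := by
      rw [← Lp.enorm_def]
      exact ((hB _ (hf.sub hgm)).1 s hs).2.trans (by gcongr)
    have hn2 : eLpNorm d' 2 Γ.arcLength ≤ B * (D * ENNReal.ofReal η) := by
      rw [← Lp.enorm_def]
      refine ((hB _ (hΓ.memLp_invertDensity (hf.sub hgm))).1 (-s) hs').2.trans ?_
      gcongr
      refine le_trans (le_of_eq ?_) ((hDnorm (f - g) (hf.sub hgm).1).trans (by gcongr))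
      exact eLpNorm_congr_norm_ae (Eventually.of_forall fun z => by rw [invertDensity, norm_neg])
    rw [eLpNorm_congr_ae hcongr]
    refine (eLpNorm_sub_le (Lp.aestronglyMeasurable d') (hmeas d (Lp.aestronglyMeasurable d))
      (by norm_num)).trans ?_
    refine (add_le_add hn2 ((hDnorm d (Lp.aestronglyMeasurable d)).trans
      (mul_le_mul_right hn1 _))).trans (le_of_eq ?_)
    push_cast
    ring
  have hzero : eLpNorm (fun z => b' z - b z⁻¹ ᵥ* swapMatrix) 2 Γ.arcLength = 0 := by
    have hlim : Tendsto (fun η : ℝ => ((2 * B * D : ℝ≥0) : ℝ≥0∞) * ENNReal.ofReal η) (𝓝[>] 0)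
        (𝓝 0) := by
      have h1 : Tendsto (fun η : ℝ => ENNReal.ofReal η) (𝓝[>] 0) (𝓝 0) := by
        have := (ENNReal.continuous_ofReal.tendsto 0).mono_left
          (nhdsWithin_le_nhds (s := Ioi (0 : ℝ)))
        rwa [ENNReal.ofReal_zero] at this
      have := ENNReal.Tendsto.const_mul (a := ((2 * B * D : ℝ≥0) : ℝ≥0∞)) h1
        (Or.inr ENNReal.coe_ne_top)
      rwa [mul_zero] at this
    exact le_antisymm (ge_of_tendsto hlim (eventually_nhdsWithin_of_forall hbound)) bot_le
  filter_upwards [(eLpNorm_eq_zero_iff hae (by norm_num)).1 hzero] with z hz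
  exact sub_eq_zero.1 hz

end IsSymmetric

end OrientedContour

/-! ### The operator `C_w` -/

theorem norm_vecMul_le (v : Fin 2 → ℂ) (A : Matrix (Fin 2) (Fin 2) ℂ) :
    ‖v ᵥ* A‖ ≤ 2 * ‖Matrix.of.symm A‖ * ‖v‖ := by
  refine (pi_norm_le_iff_of_nonneg (by positivity)).2 fun k => ?_
  have h : ∀ i, ‖v i * A i k‖ ≤ ‖Matrix.of.symm A‖ * ‖v‖ := fun i => by
    rw [norm_mul, mul_comm]
    gcongr
    · exact (norm_le_pi_norm (Matrix.of.symm A i) k).trans (norm_le_pi_norm (Matrix.of.symm A) i)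
    · exact norm_le_pi_norm v i
  rw [Matrix.vecMul, dotProduct, Fin.sum_univ_two]
  exact (norm_add_le _ _).trans (by linarith [h 0, h 1])

theorem swapMatrix_mul_self : swapMatrix * swapMatrix = 1 := by
  ext i j
  fin_cases i <;> fin_cases j <;> simp [swapMatrix]

namespace OrientedContour

variable {n : ℕ} {Γ : OrientedContour n} {ζ : ℝ}

theorem ae_mem_carrier : ∀ᵐ z ∂Γ.arcLength, z ∈ Γ.carrier :=
  Γ.ae_arcLength_iff.2 fun i => (ae_restrict_mem measurableSet_Icc).mono fun _ hx =>
    Γ.curve_mem_carrier i hx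

theorem restrict_carrier : Γ.arcLength.restrict Γ.carrier = Γ.arcLength :=
  Measure.restrict_eq_self_of_ae_mem ae_mem_carrier

theorem memLp_of_continuousOn {E : Type*} [NormedAddCommGroup E] [SecondCountableTopology E]
    {f : ℂ → E} (hf : ContinuousOn f Γ.carrier) (p : ℝ≥0∞) : MemLp f p Γ.arcLength := by
  obtain ⟨C, hC⟩ := Γ.isCompact_carrier.exists_bound_of_continuousOn hf
  refine MemLp.of_bound ?_ C (ae_mem_carrier.mono hC)
  rw [← restrict_carrier (Γ := Γ)]
  exact hf.aestronglyMeasurable Γ.isCompact_carrier.measurableSet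

variable (Γ) in
/-- The two factors are essentially bounded. -/
structure IsBoundedData (w : JumpData) : Prop where
  plus : MemLp (fun z => Matrix.of.symm (w.plus z)) ∞ Γ.arcLength
  minus : MemLp (fun z => Matrix.of.symm (w.minus z)) ∞ Γ.arcLength

theorem IsJumpData.isBoundedData {w : JumpData} (hw : Γ.IsJumpData w) : Γ.IsBoundedData w :=
  ⟨memLp_of_continuousOn hw.continuousOn_plus _, memLp_of_continuousOn hw.continuousOn_minus _⟩

namespace IsBoundedData

variable {w w' : JumpData}

theorem sub (hw : Γ.IsBoundedData w) (hw' : Γ.IsBoundedData w') : Γ.IsBoundedData (w - w') :=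
  ⟨hw.plus.sub hw'.plus, hw.minus.sub hw'.minus⟩

theorem supNorm_ne_top (hw : Γ.IsBoundedData w) : Γ.supNorm w ≠ ⊤ :=
  (ENNReal.add_lt_top.2 ⟨hw.plus.2, hw.minus.2⟩).ne

theorem supNorm_sub_le (hw : Γ.IsBoundedData w) (hw' : Γ.IsBoundedData w') :
    Γ.supNorm w ≤ Γ.supNorm w' + Γ.supNorm (w - w') := by
  have h1 := eLpNorm_add_le (p := ∞) hw'.plus.1 (hw.plus.sub hw'.plus).1 le_top
  have h2 := eLpNorm_add_le (p := ∞) hw'.minus.1 (hw.minus.sub hw'.minus).1 le_top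
  rw [add_sub_cancel] at h1 h2
  refine (add_le_add h1 h2).trans (le_of_eq ?_)
  rw [supNorm, supNorm, add_add_add_comm]
  rfl

theorem add (hw : Γ.IsBoundedData w) :
    MemLp (fun z => Matrix.of.symm (w.plus z + w.minus z)) ∞ Γ.arcLength ∧
    eLpNorm (fun z => Matrix.of.symm (w.plus z + w.minus z)) ∞ Γ.arcLength ≤ Γ.supNorm w :=
  ⟨hw.plus.add hw.minus, eLpNorm_add_le hw.plus.1 hw.minus.1 le_top⟩

end IsBoundedData

theorem memLp_vecMul {A : ℂ → Matrix (Fin 2) (Fin 2) ℂ}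
    (hA : MemLp (fun z => Matrix.of.symm (A z)) ∞ Γ.arcLength) {f : ℂ → Fin 2 → ℂ}
    (hf : MemLp f 2 Γ.arcLength) :
    MemLp (fun z => f z ᵥ* A z) 2 Γ.arcLength ∧ eLpNorm (fun z => f z ᵥ* A z) 2 Γ.arcLength ≤
      2 * eLpNorm (fun z => Matrix.of.symm (A z)) ∞ Γ.arcLength * eLpNorm f 2 Γ.arcLength := by
  have hm : AEStronglyMeasurable (fun z => f z ᵥ* A z) Γ.arcLength := by
    refine aestronglyMeasurable_pi fun k => ?_
    have h1 : ∀ i, AEMeasurable (fun z => f z i) Γ.arcLength := fun i =>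
      aemeasurable_pi_iff.1 hf.1.aemeasurable i
    have h2 : ∀ i, AEMeasurable (fun z => A z i k) Γ.arcLength := fun i =>
      aemeasurable_pi_iff.1 (aemeasurable_pi_iff.1 hA.1.aemeasurable i) k
    have h3 : AEMeasurable (fun z => ∑ i, f z i * A z i k) Γ.arcLength :=
      Finset.aemeasurable_fun_sum _ fun i _ => (h1 i).mul (h2 i)
    exact h3.aestronglyMeasurable
  have hle := eLpNorm_le_eLpNorm_top_mul_eLpNorm 2 (fun z => Matrix.of.symm (A z)) hf.1
    (fun B v => v ᵥ* Matrix.of B) 2 (Eventually.of_forall fun z => norm_vecMul_le (f z) (A z))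
  exact ⟨⟨hm, hle.trans_lt (ENNReal.mul_lt_top (ENNReal.mul_lt_top (by simp) hA.2) hf.2)⟩, hle⟩

theorem cauchyW_sub (hζ : ∀ k, kernelPole ζ k ∉ Γ.carrier) {w : JumpData}
    (hw : Γ.IsBoundedData w) (f g : Γ.L2) :
    Γ.cauchyW ζ w (f - g) = Γ.cauchyW ζ w f - Γ.cauchyW ζ w g := by
  have h : ∀ A : ℂ → Matrix (Fin 2) (Fin 2) ℂ,
      MemLp (fun z => Matrix.of.symm (A z)) ∞ Γ.arcLength → ∀ s, s = 1 ∨ s = -1 →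
      Γ.boundaryValue s (Γ.cauchyOp ζ fun z => (f - g : Γ.L2) z ᵥ* A z) =
        Γ.boundaryValue s (Γ.cauchyOp ζ fun z => f z ᵥ* A z) -
        Γ.boundaryValue s (Γ.cauchyOp ζ fun z => g z ᵥ* A z) := by
    intro A hA s hs
    rw [← boundaryValue_cauchyOp_sub hζ (memLp_vecMul hA (Lp.memLp f)).1
      (memLp_vecMul hA (Lp.memLp g)).1 hs]
    congr 1
    refine cauchyOp_congr ?_
    filter_upwards [Lp.coeFn_sub f g] with z hz
    rw [hz, Pi.sub_apply, Pi.sub_apply, Matrix.sub_vecMul]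
  rw [cauchyW, cauchyW, cauchyW, h _ hw.minus 1 (Or.inl rfl), h _ hw.plus (-1) (Or.inr rfl)]
  abel

theorem cauchyW_sub_data (hζ : ∀ k, kernelPole ζ k ∉ Γ.carrier) {w w' : JumpData}
    (hw : Γ.IsBoundedData w) (hw' : Γ.IsBoundedData w') (f : Γ.L2) :
    Γ.cauchyW ζ (w - w') f = Γ.cauchyW ζ w f - Γ.cauchyW ζ w' f := by
  have h : ∀ A A' : ℂ → Matrix (Fin 2) (Fin 2) ℂ,
      MemLp (fun z => Matrix.of.symm (A z)) ∞ Γ.arcLength →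
      MemLp (fun z => Matrix.of.symm (A' z)) ∞ Γ.arcLength → ∀ s, s = 1 ∨ s = -1 →
      Γ.boundaryValue s (Γ.cauchyOp ζ fun z => f z ᵥ* (A - A') z) =
        Γ.boundaryValue s (Γ.cauchyOp ζ fun z => f z ᵥ* A z) -
        Γ.boundaryValue s (Γ.cauchyOp ζ fun z => f z ᵥ* A' z) := by
    intro A A' hA hA' s hs
    rw [← boundaryValue_cauchyOp_sub hζ (memLp_vecMul hA (Lp.memLp f)).1
      (memLp_vecMul hA' (Lp.memLp f)).1 hs]
    congr 1
    refine cauchyOp_congr (Eventually.of_forall fun z => ?_)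
    exact Matrix.vecMul_sub _ _ _
  rw [cauchyW, cauchyW, cauchyW]
  change Γ.boundaryValue 1 (Γ.cauchyOp ζ fun z => f z ᵥ* (w.minus - w'.minus) z) +
    Γ.boundaryValue (-1) (Γ.cauchyOp ζ fun z => f z ᵥ* (w.plus - w'.plus) z) = _
  rw [h _ _ hw.minus hw'.minus 1 (Or.inl rfl), h _ _ hw.plus hw'.plus (-1) (Or.inr rfl)]
  abel

theorem exists_norm_cauchyW_le (hζ : ∀ k, kernelPole ζ k ∉ Γ.carrier) : ∃ C > 0,
    ∀ w, Γ.IsBoundedData w → ∀ f : Γ.L2,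
      ‖Γ.cauchyW ζ w f‖ ≤ C * (Γ.supNorm w).toReal * ‖f‖ := by
  obtain ⟨B, hB⟩ := exists_boundaryValue_cauchyOp hζ
  refine ⟨2 * (B + 1), by positivity, fun w hw f => ?_⟩
  have h : ∀ A : ℂ → Matrix (Fin 2) (Fin 2) ℂ,
      MemLp (fun z => Matrix.of.symm (A z)) ∞ Γ.arcLength → ∀ s, s = 1 ∨ s = -1 →
      ‖Γ.boundaryValue s (Γ.cauchyOp ζ fun z => f z ᵥ* A z)‖ₑ ≤ (2 * (B + 1) : ℝ≥0) *
        eLpNorm (fun z => Matrix.of.symm (A z)) ∞ Γ.arcLength * ‖f‖ₑ := by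
    intro A hA s hs
    obtain ⟨h1, h2⟩ := memLp_vecMul hA (Lp.memLp f)
    refine ((hB _ h1).1 s hs).2.trans ?_
    rw [Lp.enorm_def]
    refine (mul_le_mul_right h2 _).trans ?_
    rw [← mul_assoc, ← mul_assoc]
    gcongr
    push_cast
    rw [mul_comm]
    gcongr
    exact le_self_add
  have hsum : ‖Γ.cauchyW ζ w f‖ₑ ≤ (2 * (B + 1) : ℝ≥0) * Γ.supNorm w * ‖f‖ₑ := by
    refine (enorm_add_le _ _).trans ((add_le_add (h _ hw.minus 1 (Or.inl rfl))
      (h _ hw.plus (-1) (Or.inr rfl))).trans (le_of_eq ?_))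
    rw [supNorm]
    ring
  have := ENNReal.toReal_mono (ENNReal.mul_ne_top (ENNReal.mul_ne_top ENNReal.coe_ne_top
    hw.supNorm_ne_top) enorm_ne_top) hsum
  rw [ENNReal.toReal_mul, ENNReal.toReal_mul, ENNReal.coe_toReal, toReal_enorm, toReal_enorm] at this
  exact_mod_cast this

/-- An almost everywhere convergent subsequence converges at `z` and at `z⁻¹` simultaneously, since
inversion preserves null sets. -/
theorem isClosed_L2s (hΓ : Γ.IsSymmetric ζ) : IsClosed Γ.L2s := by
  refine IsSeqClosed.isClosed fun u f hu hf => ?_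
  obtain ⟨ns, -, hns⟩ := (tendstoInMeasure_of_tendsto_Lp hf).exists_seq_tendsto_ae
  change ∀ᵐ z ∂Γ.arcLength, f z⁻¹ = f z ᵥ* swapMatrix
  filter_upwards [hns, hΓ.quasiMeasurePreserving_inv.ae hns, ae_all_iff.2 fun k => hu (ns k)]
    with z h1 h2 h3
  refine tendsto_nhds_unique h2 ?_
  exact ((continuous_vecMul_swapMatrix.tendsto _).comp h1).congr fun k => (h3 k).symm

theorem sub_mem_L2s (hΓ : Γ.IsSymmetric ζ) {f g : Γ.L2} (hf : f ∈ Γ.L2s) (hg : g ∈ Γ.L2s) :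
    f - g ∈ Γ.L2s := by
  change ∀ᵐ z ∂Γ.arcLength, (f - g : Γ.L2) z⁻¹ = (f - g : Γ.L2) z ᵥ* swapMatrix
  filter_upwards [hf, hg, Lp.coeFn_sub f g, hΓ.quasiMeasurePreserving_inv.ae (Lp.coeFn_sub f g)]
    with z h1 h2 h3 h4
  rw [h3, h4, Pi.sub_apply, Pi.sub_apply, h1, h2, Matrix.sub_vecMul]

theorem add_mem_L2s (hΓ : Γ.IsSymmetric ζ) {f g : Γ.L2} (hf : f ∈ Γ.L2s) (hg : g ∈ Γ.L2s) :
    f + g ∈ Γ.L2s := by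
  change ∀ᵐ z ∂Γ.arcLength, (f + g : Γ.L2) z⁻¹ = (f + g : Γ.L2) z ᵥ* swapMatrix
  filter_upwards [hf, hg, Lp.coeFn_add f g, hΓ.quasiMeasurePreserving_inv.ae (Lp.coeFn_add f g)]
    with z h1 h2 h3 h4
  rw [h3, h4, Pi.add_apply, Pi.add_apply, h1, h2, Matrix.add_vecMul]

/-- The minus sign in the symmetry of the jump data cancels the minus sign that inversion produces
in the density. -/
theorem invertDensity_vecMul {f : ℂ → Fin 2 → ℂ} {A A' : ℂ → Matrix (Fin 2) (Fin 2) ℂ}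
    (hf : ∀ᵐ z ∂Γ.arcLength, f z⁻¹ = f z ᵥ* swapMatrix)
    (hA : ∀ z ∈ Γ.carrier, A z⁻¹ = -(swapMatrix * A' z * swapMatrix)) :
    invertDensity (fun z => f z ᵥ* A z) =ᵐ[Γ.arcLength] fun z => f z ᵥ* A' z := by
  filter_upwards [hf, ae_mem_carrier] with z h1 h2
  rw [invertDensity, h1, hA z h2, Matrix.vecMul_vecMul, Matrix.vecMul_vecMul, ← Matrix.vecMul_neg]
  congr 1
  rw [Matrix.neg_mul, Matrix.mul_neg, neg_neg, Matrix.mul_assoc, Matrix.mul_assoc,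
    swapMatrix_mul_self, Matrix.mul_one, ← Matrix.mul_assoc, swapMatrix_mul_self, Matrix.one_mul]

/-- Inversion exchanges the sides and turns `f w_-` into `f w_+`, so it swaps the two summands
`C_+(f w_-)` and `C_-(f w_+)`. -/
theorem cauchyW_mem_L2s (hΓ : Γ.IsSymmetric ζ) (hζ : ζ ≠ 0) {w : JumpData} (hw : Γ.IsJumpData w)
    {f : Γ.L2} (hf : f ∈ Γ.L2s) : Γ.cauchyW ζ w f ∈ Γ.L2s := by
  have hb := hw.isBoundedData
  have h1 := hΓ.boundaryValue_invertDensity hζ (memLp_vecMul hb.minus (Lp.memLp f)).1 (s := 1)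
    (Or.inl rfl)
  have h2 := hΓ.boundaryValue_invertDensity hζ (memLp_vecMul hb.plus (Lp.memLp f)).1 (s := -1)
    (Or.inr rfl)
  rw [cauchyOp_congr (invertDensity_vecMul hf hw.minus_inv)] at h1
  rw [cauchyOp_congr (invertDensity_vecMul hf hw.plus_inv), neg_neg] at h2
  set b₁ := Γ.boundaryValue 1 (Γ.cauchyOp ζ fun z => f z ᵥ* w.minus z)
  set b₂ := Γ.boundaryValue (-1) (Γ.cauchyOp ζ fun z => f z ᵥ* w.plus z)
  change ∀ᵐ z ∂Γ.arcLength, (b₁ + b₂ : Γ.L2) z⁻¹ = (b₁ + b₂ : Γ.L2) z ᵥ* swapMatrix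
  filter_upwards [h1, h2, Lp.coeFn_add b₁ b₂,
    hΓ.quasiMeasurePreserving_inv.ae (Lp.coeFn_add b₁ b₂)] with z h1 h2 h3 h4
  rw [h3, h4, Pi.add_apply, Pi.add_apply, h1, h2, Matrix.add_vecMul,
    vecMul_swapMatrix_swapMatrix, vecMul_swapMatrix_swapMatrix, add_comm]

end OrientedContour

/-! ### Stability of the bounded inverse -/

namespace OrientedContour

variable {n : ℕ} {Γ : OrientedContour n} {ζ : ℝ}

/-- An operator close to one with a bounded inverse has a bounded inverse. -/
theorem HasInverseBound.of_small (hΓ : Γ.IsSymmetric ζ) (hζ : ζ ≠ 0) {w₀ w : JumpData}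
    (hw₀ : Γ.IsJumpData w₀) (hw : Γ.IsJumpData w) {K δ : ℝ} (hK : 0 < K)
    (h₀ : Γ.HasInverseBound ζ w₀ K)
    (hδ : ∀ f : Γ.L2, ‖Γ.cauchyW ζ (w - w₀) f‖ ≤ δ * ‖f‖) (hδK : K * δ ≤ 1 / 2) :
    Γ.HasInverseBound ζ w (2 * K) := by
  have hpole := hΓ.kernelPole_notMem
  have hb := hw.isBoundedData
  have hb₀ := hw₀.isBoundedData
  have hD := cauchyW_sub_data hpole hb hb₀
  have hsubD := cauchyW_sub hpole (hb.sub hb₀)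
  have hmem : ∀ f ∈ Γ.L2s, Γ.cauchyW ζ (w - w₀) f ∈ Γ.L2s := fun f hf => by
    rw [hD]
    exact sub_mem_L2s hΓ (cauchyW_mem_L2s hΓ hζ hw hf) (cauchyW_mem_L2s hΓ hζ hw₀ hf)
  have hδ' : ∀ f : Γ.L2, K * ‖Γ.cauchyW ζ (w - w₀) f‖ ≤ 1 / 2 * ‖f‖ := fun f =>
    calc K * ‖Γ.cauchyW ζ (w - w₀) f‖ ≤ K * (δ * ‖f‖) := by gcongr; exact hδ f
      _ = K * δ * ‖f‖ := by ring
      _ ≤ 1 / 2 * ‖f‖ := by gcongr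
  have hbound : ∀ f ∈ Γ.L2s, ‖f‖ ≤ 2 * K * ‖f - Γ.cauchyW ζ w f‖ := by
    intro f hf
    have h1 := h₀.2 f hf
    have h2 : f - Γ.cauchyW ζ w₀ f = (f - Γ.cauchyW ζ w f) + Γ.cauchyW ζ (w - w₀) f := by
      rw [hD]
      abel
    have h3 : K * ‖f - Γ.cauchyW ζ w₀ f‖ ≤
        K * (‖f - Γ.cauchyW ζ w f‖ + ‖Γ.cauchyW ζ (w - w₀) f‖) := by
      gcongr
      rw [h2]
      exact norm_add_le _ _
    have h4 := hδ' f
    linarith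
  refine ⟨⟨fun f hf => sub_mem_L2s hΓ hf (cauchyW_mem_L2s hΓ hζ hw hf), fun f hf g hg hfg => ?_,
    fun g hg => ?_⟩, hbound⟩
  · have h1 := hbound (f - g) (sub_mem_L2s hΓ hf hg)
    have h2 : f - g - Γ.cauchyW ζ w (f - g) = 0 := by
      rw [cauchyW_sub hpole hb]
      have : f - Γ.cauchyW ζ w f = g - Γ.cauchyW ζ w g := hfg
      rw [← sub_eq_zero] at this
      rw [← this]
      abel
    rw [h2, norm_zero, mul_zero] at h1
    exact sub_eq_zero.1 (norm_le_zero_iff.1 h1)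
  -- Surjectivity by Banach's fixed point theorem: let `T f` solve `a - C_{w₀} a = g + C_{w - w₀}
  -- f`. A fixed point solves `a - C_w a = g`, and `T` contracts by `K δ ≤ 1 / 2`.
  · have hsurj : ∀ f : Γ.L2s, ∃ a : Γ.L2s,
        (a : Γ.L2) - Γ.cauchyW ζ w₀ a = g + Γ.cauchyW ζ (w - w₀) f := fun f => by
      obtain ⟨a, ha, hae⟩ := h₀.1.surjOn (add_mem_L2s hΓ hg (hmem f f.2))
      exact ⟨⟨a, ha⟩, hae⟩
    choose T hT using hsurj
    have hlip : ContractingWith (1 / 2) T := by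
      refine ⟨by rw [← NNReal.coe_lt_coe]; norm_num, LipschitzWith.of_dist_le_mul fun a b => ?_⟩
      rw [Subtype.dist_eq, Subtype.dist_eq, dist_eq_norm, dist_eq_norm]
      refine (h₀.2 _ (sub_mem_L2s hΓ (T a).2 (T b).2)).trans ?_
      have h1 : (T a : Γ.L2) - T b - Γ.cauchyW ζ w₀ (T a - T b) =
          Γ.cauchyW ζ (w - w₀) (a - b) := by
        rw [cauchyW_sub hpole hb₀, sub_sub_sub_comm, hT, hT, hsubD]
        abel
      rw [h1]
      simpa using hδ' (a - b)
    have : CompleteSpace Γ.L2s := (isClosed_L2s hΓ).completeSpace_coe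
    have : Nonempty Γ.L2s := ⟨⟨g, hg⟩⟩
    have hfix := hlip.fixedPoint_isFixedPt
    set a := ContractingWith.fixedPoint T hlip
    have h1 := hT a
    rw [hfix.eq, hD] at h1
    refine ⟨a, a.2, ?_⟩
    simp only
    rw [← sub_eq_zero] at h1 ⊢
    rw [← h1]
    abel

end OrientedContour

/-! ### The one soliton solution -/

theorem measurable_soliton (ζ γ : ℝ) : Measurable (soliton ζ γ) := by
  refine measurable_pi_iff.2 fun k => ?_
  fin_cases k
  · simp only [soliton]
    fun_prop
  · simp only [soliton]
    fun_prop

theorem soliton_inv {ζ : ℝ} (hζ : ζ ≠ 0) (γ : ℝ) {z : ℂ} (h0 : z ≠ 0) (h1 : z ≠ ζ)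
    (h2 : z ≠ (ζ : ℂ)⁻¹) : soliton ζ γ z⁻¹ = soliton ζ γ z ᵥ* swapMatrix := by
  have hζ' : (ζ : ℂ) ≠ 0 := by exact_mod_cast hζ
  have h3 : z - ζ ≠ 0 := sub_ne_zero.2 h1
  have h4 : 1 - ζ * z ≠ 0 := fun h => h2 (by field_simp; linear_combination -h)
  have e1 : (z⁻¹ - (ζ : ℂ)⁻¹) / (z⁻¹ - ζ) = (1 - (ζ : ℂ)⁻¹ * z) / (1 - ζ * z) := by
    have : z⁻¹ - ζ = (1 - ζ * z) / z := by field_simp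
    rw [this]
    field_simp
  have e2 : (1 - (ζ : ℂ)⁻¹ * z⁻¹) / (1 - ζ * z⁻¹) = (z - (ζ : ℂ)⁻¹) / (z - ζ) := by
    have : 1 - ζ * z⁻¹ = (z - ζ) / z := by field_simp
    rw [this]
    field_simp
  ext k
  rw [vecMul_swapMatrix_apply]
  fin_cases k
  · simp [soliton, e1]
  · simp [soliton, e2]

/-- Each component is `(γ q + (1 - ζ²)) / (γ + (1 - ζ²))`, a convex combination of `q` and `1`,
where `q` does not involve `γ` and is bounded away from the poles. Hence the bound is independent of
`γ`. -/
theorem norm_soliton_le {ζ γ ε : ℝ} (hζ0 : ζ ≠ 0) (hζ1 : ζ ^ 2 < 1) (hγ : 0 ≤ γ) (hε : 0 < ε)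
    {z : ℂ} (h1 : ε ≤ dist z ζ) (h2 : ε ≤ dist z (ζ : ℂ)⁻¹) :
    ‖soliton ζ γ z‖ ≤ 2 + (1 + |ζ - ζ⁻¹|) / ε := by
  have hζ' : (ζ : ℂ) ≠ 0 := by exact_mod_cast hζ0
  rw [dist_eq_norm] at h1 h2
  have h3 : z - ζ ≠ 0 := norm_pos_iff.1 (hε.trans_le h1)
  have h4 : z - (ζ : ℂ)⁻¹ ≠ 0 := norm_pos_iff.1 (hε.trans_le h2)
  have hden : 0 < 1 - ζ ^ 2 + γ := by linarith
  have hden' : ((1 - ζ ^ 2 + γ : ℝ) : ℂ) = 1 - (ζ : ℂ) ^ 2 + γ := by push_cast; ring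
  have hζn : ‖(ζ : ℂ) - (ζ : ℂ)⁻¹‖ = |ζ - ζ⁻¹| := by
    rw [← Complex.ofReal_inv, ← Complex.ofReal_sub, Complex.norm_real, Real.norm_eq_abs]
  have key : ∀ q : ℂ, ‖q‖ ≤ 1 + |ζ - ζ⁻¹| / ε →
      ‖(γ * q + 1 - (ζ : ℂ) ^ 2) / (1 - (ζ : ℂ) ^ 2 + γ)‖ ≤ 2 + (1 + |ζ - ζ⁻¹|) / ε := by
    intro q hq
    rw [← hden', norm_div, Complex.norm_of_nonneg hden.le, div_le_iff₀ hden]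
    have h5 : ‖(γ * q + 1 - (ζ : ℂ) ^ 2)‖ ≤ γ * ‖q‖ + (1 - ζ ^ 2) := by
      have : γ * q + 1 - (ζ : ℂ) ^ 2 = γ * q + ((1 - ζ ^ 2 : ℝ) : ℂ) := by push_cast; ring
      rw [this]
      refine (norm_add_le _ _).trans (le_of_eq ?_)
      rw [norm_mul, Complex.norm_of_nonneg hγ, Complex.norm_of_nonneg (by linarith)]
    have h6 : 0 ≤ |ζ - ζ⁻¹| / ε := by positivity
    have h7 : (1 + |ζ - ζ⁻¹|) / ε = 1 / ε + |ζ - ζ⁻¹| / ε := add_div _ _ _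
    have h8 : 0 < 1 / ε := by positivity
    have h9 : γ * ‖q‖ ≤ γ * (1 + |ζ - ζ⁻¹| / ε) := by gcongr
    rw [h7]
    nlinarith [mul_nonneg hγ h8.le, mul_nonneg hγ h6]
  have hq : ∀ a : ℂ, ε ≤ ‖a‖ → ‖1 + ((ζ : ℂ) - (ζ : ℂ)⁻¹) / a‖ ≤ 1 + |ζ - ζ⁻¹| / ε := by
    intro a ha
    refine (norm_add_le _ _).trans ?_
    rw [norm_one, norm_div, hζn]
    gcongr
  refine (pi_norm_le_iff_of_nonneg (by positivity)).2 fun k => ?_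
  fin_cases k
  · have e : (γ : ℂ) * (ζ : ℂ) ^ 2 * ((z - (ζ : ℂ)⁻¹) / (z - ζ)) =
        γ * ((ζ : ℂ) ^ 2 * (1 + ((ζ : ℂ) - (ζ : ℂ)⁻¹) / (z - ζ))) := by
      field_simp
      ring
    simp only [soliton]
    change ‖(γ * (ζ : ℂ) ^ 2 * ((z - (ζ : ℂ)⁻¹) / (z - ζ)) + 1 - (ζ : ℂ) ^ 2) /
      (1 - (ζ : ℂ) ^ 2 + γ)‖ ≤ _
    rw [e]
    refine key _ ?_
    rw [norm_mul, norm_pow, Complex.norm_real, Real.norm_eq_abs, sq_abs]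
    exact (mul_le_of_le_one_left (norm_nonneg _) hζ1.le).trans (hq _ h1)
  · have e : (γ : ℂ) * (ζ : ℂ) ^ 2 * ((1 - (ζ : ℂ)⁻¹ * z) / (1 - ζ * z)) =
        γ * (1 + ((ζ : ℂ) - (ζ : ℂ)⁻¹) / ((ζ : ℂ)⁻¹ - z)) := by
      have h5 : (ζ : ℂ)⁻¹ - z ≠ 0 := by rw [← neg_sub]; exact neg_ne_zero.2 h4
      have h6 : 1 - ζ * z = ζ * ((ζ : ℂ)⁻¹ - z) := by field_simp
      have h7 : 1 - ζ * z ≠ 0 := h6 ▸ mul_ne_zero hζ' h5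
      field_simp
      ring
    change ‖(γ * (ζ : ℂ) ^ 2 * ((1 - (ζ : ℂ)⁻¹ * z) / (1 - ζ * z)) + 1 - (ζ : ℂ) ^ 2) /
      (1 - (ζ : ℂ) ^ 2 + γ)‖ ≤ _
    rw [e]
    exact key _ (hq _ (by rwa [norm_sub_rev]))

/-! ### Boundary values and the jump of the associated solution -/

namespace OrientedContour

variable {n : ℕ} {Γ : OrientedContour n} {ζ : ℝ}

theorem HasBoundaryValue.const_smul {s : ℝ} {F : ℂ → Fin 2 → ℂ} {h : Γ.L2} (a : ℂ)
    (H : Γ.HasBoundaryValue s F h) : Γ.HasBoundaryValue s (fun z => a • F z) (a • h) := by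
  intro i
  have h1 := ENNReal.Tendsto.const_mul (a := ‖a‖ₑ) (H i) (Or.inr enorm_ne_top)
  rw [mul_zero] at h1
  refine h1.congr fun ε => ?_
  rw [← eLpNorm_const_smul]
  refine eLpNorm_congr_ae ?_
  filter_upwards [(Γ.quasiMeasurePreserving_curve i).ae (Lp.coeFn_smul a h)] with x hx
  rw [hx, Pi.smul_apply, Pi.smul_apply, smul_sub]

theorem HasBoundaryValue.add {s : ℝ} {F F' : ℂ → Fin 2 → ℂ} {h h' : Γ.L2}
    (hF : ∀ i, ∀ᶠ ε in 𝓝[>] 0,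
      AEStronglyMeasurable (fun x => F (normalShift (Γ.curve i) s ε x)) unitMeasure)
    (hF' : ∀ i, ∀ᶠ ε in 𝓝[>] 0,
      AEStronglyMeasurable (fun x => F' (normalShift (Γ.curve i) s ε x)) unitMeasure)
    (H : Γ.HasBoundaryValue s F h) (H' : Γ.HasBoundaryValue s F' h') :
    Γ.HasBoundaryValue s (fun z => F z + F' z) (h + h') := by
  have := H.sub (G := fun z => F z + F' z) hF
    (fun i => (hF' i).mono fun ε hε => hε.const_smul (-1 : ℂ)) (H'.const_smul (-1))
    (fun i => Eventually.of_forall fun ε => Eventually.of_forall fun x => by simp)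
  simpa using this

namespace IsSymmetric

theorem exists_le_dist_zeta (hΓ : Γ.IsSymmetric ζ) :
    ∃ δ > 0, ∀ z ∈ Γ.carrier, δ ≤ dist z ζ ∧ δ ≤ dist z (ζ : ℂ)⁻¹ := by
  obtain ⟨δ₁, h1, H1⟩ := Γ.exists_dist_ge (hΓ.kernelPole_notMem 1)
  obtain ⟨δ₂, h2, H2⟩ := Γ.exists_dist_ge (hΓ.kernelPole_notMem 0)
  refine ⟨min δ₁ δ₂, by positivity, fun z hz => ⟨?_, ?_⟩⟩
  · rw [dist_comm]
    exact (min_le_left _ _).trans (H1 z hz)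
  · rw [dist_comm]
    exact (min_le_right _ _).trans (H2 z hz)

theorem exists_memLp_soliton (hΓ : Γ.IsSymmetric ζ) (hζ0 : ζ ≠ 0) (hζ1 : ζ ^ 2 < 1) :
    ∃ S : ℝ≥0, ∀ γ : ℝ, 0 ≤ γ → MemLp (soliton ζ γ) 2 Γ.arcLength ∧
      eLpNorm (soliton ζ γ) 2 Γ.arcLength ≤ S := by
  obtain ⟨δ, hδ, hd⟩ := hΓ.exists_le_dist_zeta
  have hb : ∀ γ : ℝ, 0 ≤ γ → ∀ᵐ z ∂Γ.arcLength,
      ‖soliton ζ γ z‖ ≤ 2 + (1 + |ζ - ζ⁻¹|) / δ := fun γ hγ => by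
    filter_upwards [ae_mem_carrier] with z hz
    exact norm_soliton_le hζ0 hζ1 hγ hδ (hd z hz).1 (hd z hz).2
  set S := Γ.arcLength univ ^ (ENNReal.toReal 2)⁻¹ *
    ENNReal.ofReal (2 + (1 + |ζ - ζ⁻¹|) / δ) with hS
  have hS' : S ≠ ⊤ := ENNReal.mul_ne_top
    (ENNReal.rpow_ne_top_of_nonneg (by positivity) (measure_ne_top _ _)) ENNReal.ofReal_ne_top
  refine ⟨S.toNNReal, fun γ hγ => ⟨?_, ?_⟩⟩
  · exact MemLp.of_bound (measurable_soliton ζ γ).aestronglyMeasurable _ (hb γ hγ)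
  · rw [ENNReal.coe_toNNReal hS']
    exact eLpNorm_le_of_ae_bound (hb γ hγ)

theorem soliton_mem_L2s (hΓ : Γ.IsSymmetric ζ) (hζ0 : ζ ≠ 0) {γ : ℝ}
    (h : MemLp (soliton ζ γ) 2 Γ.arcLength) : h.toLp (soliton ζ γ) ∈ Γ.L2s := by
  change ∀ᵐ z ∂Γ.arcLength, _
  filter_upwards [h.coeFn_toLp, hΓ.quasiMeasurePreserving_inv.ae h.coeFn_toLp, ae_mem_carrier]
    with z h1 h2 h3
  rw [h1, h2]
  refine soliton_inv hζ0 γ (fun h => hΓ.zero_notMem (h ▸ h3)) (fun h => hΓ.zeta_notMem (h ▸ h3))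
    fun h => ?_
  exact hΓ.kernelPole_notMem 0 (by rw [h] at h3; simpa [kernelPole] using h3)

theorem hasBoundaryValue_soliton (hΓ : Γ.IsSymmetric ζ) (hζ0 : ζ ≠ 0) (hζ1 : ζ ^ 2 < 1) {γ : ℝ}
    (hγ : 0 ≤ γ) (h : MemLp (soliton ζ γ) 2 Γ.arcLength) {s : ℝ} (hs : s = 1 ∨ s = -1) :
    Γ.HasBoundaryValue s (soliton ζ γ) (h.toLp (soliton ζ γ)) := by
  intro i
  obtain ⟨δ, hδ, hd⟩ := hΓ.exists_le_dist_zeta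
  obtain ⟨m, M, hm, hM, hsp⟩ := Γ.exists_speed_bounds
  have hmeas : ∀ ε, AEStronglyMeasurable
      (fun x => soliton ζ γ (normalShift (Γ.curve i) s ε x)) unitMeasure := fun ε => by
    have h1 : Measurable (normalShift (Γ.curve i) s ε) := by
      have := (continuous_normalShift (Γ.smooth i) s).comp
        (Continuous.prodMk_right ε)
      exact this.measurable
    exact ((measurable_soliton ζ γ).comp h1).aestronglyMeasurable
  have hclose : ∀ᶠ ε in 𝓝[>] (0 : ℝ), ∀ x ∈ Icc (0 : ℝ) 1,
      δ / 2 ≤ dist (normalShift (Γ.curve i) s ε x) ζ ∧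
      δ / 2 ≤ dist (normalShift (Γ.curve i) s ε x) (ζ : ℂ)⁻¹ := by
    have h1 : ∀ᶠ ε in 𝓝[>] (0 : ℝ), ε < δ / (2 * M) :=
      nhdsWithin_le_nhds (eventually_lt_nhds (by positivity))
    filter_upwards [h1, self_mem_nhdsWithin] with ε hε hε0 x hx
    have hε0 : (0 : ℝ) < ε := hε0
    have h2 : dist (normalShift (Γ.curve i) s ε x) (Γ.curve i x) ≤ δ / 2 := by
      rw [dist_eq_norm, normalShift, add_sub_cancel_left, norm_mul, norm_mul, norm_mul,
        Complex.norm_I, Complex.norm_real, Complex.norm_real, Real.norm_eq_abs, Real.norm_eq_abs,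
        abs_of_pos hε0]
      have : |s| = 1 := by rcases hs with rfl | rfl <;> simp
      rw [this, one_mul, mul_one]
      calc ε * ‖deriv (Γ.curve i) x‖ ≤ δ / (2 * M) * M := by
            gcongr
            exact (hsp i x hx).2
        _ = δ / 2 := by field_simp
    obtain ⟨h3, h4⟩ := hd _ (Γ.curve_mem_carrier i hx)
    constructor
    · have := dist_triangle_left (Γ.curve i x) (ζ : ℂ) (normalShift (Γ.curve i) s ε x)
      linarith
    · have := dist_triangle_left (Γ.curve i x) (ζ : ℂ)⁻¹ (normalShift (Γ.curve i) s ε x)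
      linarith
  set S := 2 + (1 + |ζ - ζ⁻¹|) / (δ / 2) with hS
  have hbd : ∀ x ∈ Icc (0 : ℝ) 1, ‖soliton ζ γ (Γ.curve i x)‖ ≤ S := fun x hx =>
    norm_soliton_le hζ0 hζ1 hγ (half_pos hδ)
      ((half_le_self hδ.le).trans (hd _ (Γ.curve_mem_carrier i hx)).1)
      ((half_le_self hδ.le).trans (hd _ (Γ.curve_mem_carrier i hx)).2)
  have hlim : Tendsto (fun ε => eLpNorm (fun x => soliton ζ γ (normalShift (Γ.curve i) s ε x) -
      soliton ζ γ (Γ.curve i x)) 2 unitMeasure) (𝓝[>] 0) (𝓝 0) := by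
    refine tendsto_eLpNorm_two_of_dominated (fun _ => S + S)
      (Eventually.of_forall fun ε => hmeas ε) ?_ (memLp_const _) ?_ ?_
    · exact ((measurable_soliton ζ γ).comp (Γ.continuous_curve i).measurable).aestronglyMeasurable
    · filter_upwards [hclose] with ε hε
      filter_upwards [ae_restrict_mem measurableSet_Icc] with x hx
      exact (norm_sub_le _ _).trans (add_le_add (norm_soliton_le hζ0 hζ1 hγ (half_pos hδ)
        (hε x hx).1 (hε x hx).2) (hbd x hx))
    · filter_upwards [ae_restrict_mem measurableSet_Icc] with x hx
      have hz := hd _ (Γ.curve_mem_carrier i hx)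
      have h1 : Γ.curve i x - ζ ≠ 0 := sub_ne_zero.2 (dist_pos.1 (hδ.trans_le hz.1))
      have h2 : Γ.curve i x ≠ (ζ : ℂ)⁻¹ := dist_pos.1 (hδ.trans_le hz.2)
      have hζ' : (ζ : ℂ) ≠ 0 := by exact_mod_cast hζ0
      have h3 : 1 - ζ * Γ.curve i x ≠ 0 := fun h => h2 (by field_simp; linear_combination -h)
      have hc : ContinuousAt (soliton ζ γ) (Γ.curve i x) := by
        refine continuousAt_pi.2 fun k => ?_
        fin_cases k
        · exact ((continuousAt_const.mul ((continuousAt_id.sub continuousAt_const).div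
            (continuousAt_id.sub continuousAt_const) h1)).add continuousAt_const).sub
            continuousAt_const |>.div_const _
        · exact ((continuousAt_const.mul ((continuousAt_const.sub
            (continuousAt_const.mul continuousAt_id)).div
            (continuousAt_const.sub (continuousAt_const.mul continuousAt_id)) h3)).add
            continuousAt_const).sub continuousAt_const |>.div_const _
      exact hc.tendsto.comp (tendsto_normalShift (Γ.curve i) s x)
  refine hlim.congr fun ε => eLpNorm_congr_ae ?_
  filter_upwards [(Γ.quasiMeasurePreserving_curve i).ae h.coeFn_toLp] with x hx
  rw [hx]
  rfl

end IsSymmetric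

theorem memLp_density {w : JumpData} (hw : Γ.IsBoundedData w) (μ : Γ.L2) :
    MemLp (fun z => μ z ᵥ* (w.plus z + w.minus z)) 2 Γ.arcLength :=
  (memLp_vecMul hw.add.1 (Lp.memLp μ)).1

/-- Replace `C_+(μ w_+)` by `C_-(μ w_+) + μ w_+` for the positive side, and `C_-(μ w_-)` by `C_+(μ
w_-) - μ w_-` for the negative side. -/
theorem boundaryValue_cauchyPart (hζ : ∀ k, kernelPole ζ k ∉ Γ.carrier) {w : JumpData}
    (hw : Γ.IsBoundedData w) (μ : Γ.L2) :
    (∀ᵐ z ∂Γ.arcLength, Γ.boundaryValue 1 (Γ.cauchyPart ζ w μ) z =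
      Γ.cauchyW ζ w μ z + μ z ᵥ* w.plus z) ∧
    ∀ᵐ z ∂Γ.arcLength, Γ.boundaryValue (-1) (Γ.cauchyPart ζ w μ) z =
      Γ.cauchyW ζ w μ z - μ z ᵥ* w.minus z := by
  have hp := (memLp_vecMul hw.plus (Lp.memLp μ)).1
  have hm := (memLp_vecMul hw.minus (Lp.memLp μ)).1
  have hsum : ∀ s, s = 1 ∨ s = -1 → Γ.boundaryValue s (Γ.cauchyPart ζ w μ) =
      Γ.boundaryValue s (Γ.cauchyOp ζ fun z => μ z ᵥ* w.plus z) +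
      Γ.boundaryValue s (Γ.cauchyOp ζ fun z => μ z ᵥ* w.minus z) := by
    intro s hs
    rw [← sub_eq_iff_eq_add, cauchyPart, ← boundaryValue_cauchyOp_sub hζ (memLp_density hw μ) hm hs]
    congr 2
    ext z : 1
    rw [Pi.sub_apply, Matrix.vecMul_add, add_sub_cancel_right]
  obtain ⟨B, hB⟩ := exists_boundaryValue_cauchyOp hζ
  have hjp := (hB _ hp).2
  have hjm := (hB _ hm).2
  rw [hsum 1 (Or.inl rfl), hsum (-1) (Or.inr rfl), cauchyW]
  set p₁ := Γ.boundaryValue 1 (Γ.cauchyOp ζ fun z => μ z ᵥ* w.plus z)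
  set p₂ := Γ.boundaryValue (-1) (Γ.cauchyOp ζ fun z => μ z ᵥ* w.plus z)
  set m₁ := Γ.boundaryValue 1 (Γ.cauchyOp ζ fun z => μ z ᵥ* w.minus z)
  set m₂ := Γ.boundaryValue (-1) (Γ.cauchyOp ζ fun z => μ z ᵥ* w.minus z)
  constructor
  · filter_upwards [hjp, Lp.coeFn_add p₁ m₁, Lp.coeFn_add m₁ p₂] with z h1 h2 h3
    rw [h2, h3, Pi.add_apply, Pi.add_apply, ← h1]
    abel
  · filter_upwards [hjm, Lp.coeFn_add p₂ m₂, Lp.coeFn_add m₁ p₂] with z h1 h2 h3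
    rw [h2, h3, Pi.add_apply, Pi.add_apply, ← h1]
    abel

/-- Since `m₀ = μ - C_w μ`, the boundary values are `μ b_+` and `μ b_-` up to the common normalizing
factor. Their quotient is `v = b_-⁻¹ b_+`. -/
theorem exists_jump_associatedSolution (hΓ : Γ.IsSymmetric ζ) (hζ0 : ζ ≠ 0) (hζ1 : ζ ^ 2 < 1)
    {γ : ℝ} (hγ : 0 ≤ γ) {w : JumpData} (hw : Γ.IsJumpData w) {μ : Γ.L2}
    (hμ : Γ.IsMuTilde ζ γ w μ) :
    ∃ mp mm : Γ.L2, Γ.HasBoundaryValue 1 (Γ.associatedSolution ζ γ w μ) mp ∧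
      Γ.HasBoundaryValue (-1) (Γ.associatedSolution ζ γ w μ) mm ∧
      ∀ᵐ z ∂Γ.arcLength, mp z = mm z ᵥ* w.jump z := by
  have hpole := hΓ.kernelPole_notMem
  have hb := hw.isBoundedData
  obtain ⟨S, hS⟩ := hΓ.exists_memLp_soliton hζ0 hζ1
  have hsol := (hS γ hγ).1
  have hf := memLp_density hb μ
  obtain ⟨B, hB⟩ := exists_boundaryValue_cauchyOp hpole
  have hHBV : ∀ s, s = 1 ∨ s = -1 → Γ.HasBoundaryValue s (Γ.associatedSolution ζ γ w μ)
      ((1 + Γ.cTilde ζ w μ)⁻¹ • (hsol.toLp (soliton ζ γ) +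
        Γ.boundaryValue s (Γ.cauchyPart ζ w μ))) := by
    intro s hs
    refine HasBoundaryValue.const_smul _ (HasBoundaryValue.add (fun i => ?_)
      (aestronglyMeasurable_cauchyOp_normalShift hpole hf hs)
      (hΓ.hasBoundaryValue_soliton hζ0 hζ1 hγ hsol hs) ((hB _ hf).1 s hs).1)
    refine Eventually.of_forall fun ε => ?_
    have h1 : Measurable (normalShift (Γ.curve i) s ε) :=
      ((continuous_normalShift (Γ.smooth i) s).comp (Continuous.prodMk_right ε)).measurable
    exact ((measurable_soliton ζ γ).comp h1).aestronglyMeasurable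
  refine ⟨_, _, hHBV 1 (Or.inl rfl), hHBV (-1) (Or.inr rfl), ?_⟩
  obtain ⟨h1, h2⟩ := boundaryValue_cauchyPart hpole hb μ
  filter_upwards [h1, h2, hμ.2, hsol.coeFn_toLp, Lp.coeFn_sub μ (Γ.cauchyW ζ w μ), ae_mem_carrier,
    Lp.coeFn_smul (1 + Γ.cTilde ζ w μ)⁻¹ (hsol.toLp (soliton ζ γ) +
      Γ.boundaryValue 1 (Γ.cauchyPart ζ w μ)),
    Lp.coeFn_smul (1 + Γ.cTilde ζ w μ)⁻¹ (hsol.toLp (soliton ζ γ) +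
      Γ.boundaryValue (-1) (Γ.cauchyPart ζ w μ)),
    Lp.coeFn_add (hsol.toLp (soliton ζ γ)) (Γ.boundaryValue 1 (Γ.cauchyPart ζ w μ)),
    Lp.coeFn_add (hsol.toLp (soliton ζ γ)) (Γ.boundaryValue (-1) (Γ.cauchyPart ζ w μ))]
    with z h1 h2 h3 h4 h5 h6 h7 h8 h9 h10
  rw [h7, h8, Pi.smul_apply, Pi.smul_apply, h9, h10, Pi.add_apply, Pi.add_apply, h1, h2, h4, ← h3,
    h5, Pi.sub_apply, Matrix.smul_vecMul]
  congr 1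
  have e1 : μ z - Γ.cauchyW ζ w μ z + (Γ.cauchyW ζ w μ z + μ z ᵥ* w.plus z) =
      μ z ᵥ* (1 + w.plus z) := by
    rw [Matrix.vecMul_add, Matrix.vecMul_one]
    abel
  have e2 : μ z - Γ.cauchyW ζ w μ z + (Γ.cauchyW ζ w μ z - μ z ᵥ* w.minus z) =
      μ z ᵥ* (1 - w.minus z) := by
    rw [Matrix.vecMul_sub, Matrix.vecMul_one]
    abel
  rw [e1, e2, JumpData.jump, Matrix.vecMul_vecMul, ← Matrix.mul_assoc, Matrix.mul_nonsing_inv,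
    Matrix.one_mul]
  exact (Matrix.isUnit_iff_isUnit_det _).1 (hw.isUnit z h6)

end OrientedContour

/-! ### Residues, symmetry and normalization -/

theorem continuousAt_soliton_zero {ζ γ : ℝ} {z : ℂ} (h : z - ζ ≠ 0) :
    ContinuousAt (fun z => soliton ζ γ z 0) z :=
  ((continuousAt_const.mul ((continuousAt_id.sub continuousAt_const).div
    (continuousAt_id.sub continuousAt_const) h)).add continuousAt_const).sub
    continuousAt_const |>.div_const _

theorem continuousAt_soliton_one {ζ γ : ℝ} {z : ℂ} (h : 1 - ζ * z ≠ 0) :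
    ContinuousAt (fun z => soliton ζ γ z 1) z :=
  ((continuousAt_const.mul ((continuousAt_const.sub (continuousAt_const.mul continuousAt_id)).div
    (continuousAt_const.sub (continuousAt_const.mul continuousAt_id)) h)).add
    continuousAt_const).sub continuousAt_const |>.div_const _

theorem differentiableAt_soliton {ζ γ : ℝ} {z : ℂ} (h₀ : z - ζ ≠ 0) (h₁ : 1 - ζ * z ≠ 0) :
    DifferentiableAt ℂ (soliton ζ γ) z := by
  refine differentiableAt_pi.2 fun k => ?_
  fin_cases k
  · change DifferentiableAt ℂ (fun z : ℂ => (γ * ζ ^ 2 * ((z - (ζ : ℂ)⁻¹) / (z - ζ)) + 1 - ζ ^ 2) /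
      (1 - ζ ^ 2 + γ)) z
    have h2 : DifferentiableAt ℂ (fun z : ℂ => (z - (ζ : ℂ)⁻¹) / (z - ζ)) z :=
      DifferentiableAt.fun_div (by fun_prop) (by fun_prop) h₀
    fun_prop
  · change DifferentiableAt ℂ (fun z : ℂ => (γ * ζ ^ 2 * ((1 - (ζ : ℂ)⁻¹ * z) / (1 - ζ * z)) + 1 -
      ζ ^ 2) / (1 - ζ ^ 2 + γ)) z
    have h2 : DifferentiableAt ℂ (fun z : ℂ => (1 - (ζ : ℂ)⁻¹ * z) / (1 - ζ * z)) z :=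
      DifferentiableAt.fun_div (by fun_prop) (by fun_prop) h₁
    fun_prop

namespace OrientedContour

variable {n : ℕ} {Γ : OrientedContour n} {ζ : ℝ}

theorem differentiableAt_cauchyOp (hζ : ∀ k, kernelPole ζ k ∉ Γ.carrier) {f : ℂ → Fin 2 → ℂ}
    (hf : MemLp f 2 Γ.arcLength) {z : ℂ} (hz : z ∉ Γ.carrier) :
    DifferentiableAt ℂ (Γ.cauchyOp ζ f) z := by
  refine differentiableAt_pi.2 fun k => ?_
  have h1 := hasDerivAt_cauchySum (Γ := Γ) (u := Γ.pullback f k)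
    (fun j => (Γ.memLp_pullback hf k j).integrable (by norm_num)) hz
  refine (((h1.sub_const (Γ.cauchySum (Γ.pullback f k) (kernelPole ζ k))).const_mul
    (2 * Real.pi * Complex.I : ℂ)⁻¹).differentiableAt).congr_of_eventuallyEq ?_
  filter_upwards [Γ.isCompact_carrier.isClosed.isOpen_compl.mem_nhds hz] with z' hz'
  exact Γ.cauchyOp_apply_of_notMem hζ hf hz' k

theorem cauchyOp_kernelPole (hζ : ∀ k, kernelPole ζ k ∉ Γ.carrier) {f : ℂ → Fin 2 → ℂ}
    (hf : MemLp f 2 Γ.arcLength) (k : Fin 2) : Γ.cauchyOp ζ f (kernelPole ζ k) k = 0 := by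
  rw [Γ.cauchyOp_apply_of_notMem hζ hf (hζ k), sub_self, mul_zero]

/-- The second component of the Cauchy integral vanishes at `ζ` by the choice of the kernel, and its
first component is regular there. The residue condition is thus the one satisfied by the soliton,
scaled by `(1 + c̃₀)⁻¹`. -/
theorem residue_zeta_associatedSolution (hΓ : Γ.IsSymmetric ζ) (hζ0 : ζ ≠ 0) (hζ1 : ζ ^ 2 < 1)
    {γ : ℝ} (hγ : 0 ≤ γ) {w : JumpData} (hw : Γ.IsJumpData w) (μ : Γ.L2) :
    ∃ r : Fin 2 → ℂ, Tendsto (fun z => (z - (ζ : ℂ)) • Γ.associatedSolution ζ γ w μ z)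
      (𝓝[≠] (ζ : ℂ)) (𝓝 r) ∧
    Tendsto (fun z => Γ.associatedSolution ζ γ w μ z ᵥ* !![0, 0; -((ζ : ℂ) * γ), 0])
      (𝓝[≠] (ζ : ℂ)) (𝓝 r) := by
  have hpole := hΓ.kernelPole_notMem
  have hf := memLp_density hw.isBoundedData μ
  have hF : ∀ k, ContinuousAt (fun z => Γ.cauchyPart ζ w μ z k) ζ := fun k =>
    continuousAt_pi.1 (differentiableAt_cauchyOp hpole hf hΓ.zeta_notMem).continuousAt k
  have hF1 : Γ.cauchyPart ζ w μ ζ 1 = 0 := cauchyOp_kernelPole hpole hf 1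
  have hζ' : (ζ : ℂ) ≠ 0 := by exact_mod_cast hζ0
  have hD : (1 : ℂ) - ζ ^ 2 + γ ≠ 0 := by
    have : (1 - ζ ^ 2 + γ : ℝ) ≠ 0 := by linarith
    exact_mod_cast this
  have hone : 1 - (ζ : ℂ) * ζ ≠ 0 := by
    have : (1 - ζ * ζ : ℝ) ≠ 0 := by nlinarith
    exact_mod_cast this
  have hs1 := continuousAt_soliton_one (γ := γ) hone
  set c := (1 + Γ.cTilde ζ w μ)⁻¹ with hc
  have hm : ∀ z k, Γ.associatedSolution ζ γ w μ z k =
    c * (soliton ζ γ z k + Γ.cauchyPart ζ w μ z k) := fun z k => rfl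
  refine ⟨![c * (γ * ζ ^ 2 * (ζ - (ζ : ℂ)⁻¹) / (1 - ζ ^ 2 + γ)), 0],
    tendsto_pi_nhds.2 fun k => ?_, tendsto_pi_nhds.2 fun k => ?_⟩
  · fin_cases k
    · have h1 : ContinuousAt (fun z : ℂ => c * ((γ * ζ ^ 2 * (z - (ζ : ℂ)⁻¹) +
          (z - ζ) * (1 - ζ ^ 2)) / (1 - ζ ^ 2 + γ) + (z - ζ) * Γ.cauchyPart ζ w μ z 0)) ζ :=
        continuousAt_const.mul (ContinuousAt.add (by fun_prop)
          ((continuousAt_id.sub continuousAt_const).mul (hF 0)))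
      have h2 := h1.tendsto.mono_left (nhdsWithin_le_nhds (s := {(ζ : ℂ)}ᶜ))
      simp only [sub_self, zero_mul, add_zero] at h2
      refine h2.congr' ?_
      filter_upwards [self_mem_nhdsWithin] with z hz
      have hz' : z - ζ ≠ 0 := sub_ne_zero.2 hz
      change _ = (z - ζ) * (c * ((γ * ζ ^ 2 * ((z - (ζ : ℂ)⁻¹) / (z - ζ)) + 1 - ζ ^ 2) /
        (1 - ζ ^ 2 + γ) + Γ.cauchyPart ζ w μ z 0))
      field_simp
      ring
    · have h1 : ContinuousAt (fun z : ℂ => (z - ζ) * (c * (soliton ζ γ z 1 +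
          Γ.cauchyPart ζ w μ z 1))) ζ :=
        (continuousAt_id.sub continuousAt_const).mul (continuousAt_const.mul (hs1.add (hF 1)))
      have h2 := h1.tendsto.mono_left (nhdsWithin_le_nhds (s := {(ζ : ℂ)}ᶜ))
      rw [sub_self, zero_mul] at h2
      exact h2
  · fin_cases k
    · have h1 : ContinuousAt (fun z : ℂ => c * (soliton ζ γ z 1 + Γ.cauchyPart ζ w μ z 1) *
          -((ζ : ℂ) * γ)) ζ := (continuousAt_const.mul (hs1.add (hF 1))).mul continuousAt_const
      have h2 := h1.tendsto.mono_left (nhdsWithin_le_nhds (s := {(ζ : ℂ)}ᶜ))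
      have hval : c * (soliton ζ γ ζ 1 + Γ.cauchyPart ζ w μ ζ 1) * -((ζ : ℂ) * γ) =
          c * (γ * ζ ^ 2 * (ζ - (ζ : ℂ)⁻¹) / (1 - ζ ^ 2 + γ)) := by
        rw [hF1]
        change c * ((γ * ζ ^ 2 * ((1 - (ζ : ℂ)⁻¹ * ζ) / (1 - ζ * ζ)) + 1 - ζ ^ 2) /
          (1 - ζ ^ 2 + γ) + 0) * -((ζ : ℂ) * γ) = _
        rw [inv_mul_cancel₀ hζ', sub_self, zero_div, mul_zero]
        field_simp
        ring
      rw [hval] at h2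
      refine h2.congr fun z => ?_
      simp [Matrix.vecMul, dotProduct, hm]
    · refine (tendsto_const_nhds (x := (0 : ℂ))).congr fun z => ?_
      simp [Matrix.vecMul, dotProduct]

theorem residue_zeta_inv_associatedSolution (hΓ : Γ.IsSymmetric ζ) (hζ0 : ζ ≠ 0)
    (hζ1 : ζ ^ 2 < 1) {γ : ℝ} (hγ : 0 ≤ γ) {w : JumpData} (hw : Γ.IsJumpData w) (μ : Γ.L2) :
    ∃ r : Fin 2 → ℂ, Tendsto (fun z => (z - (ζ : ℂ)⁻¹) • Γ.associatedSolution ζ γ w μ z)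
      (𝓝[≠] (ζ : ℂ)⁻¹) (𝓝 r) ∧
    Tendsto (fun z => Γ.associatedSolution ζ γ w μ z ᵥ* !![0, (ζ : ℂ)⁻¹ * γ; 0, 0])
      (𝓝[≠] (ζ : ℂ)⁻¹) (𝓝 r) := by
  have hpole := hΓ.kernelPole_notMem
  have hf := memLp_density hw.isBoundedData μ
  have hF : ∀ k, ContinuousAt (fun z => Γ.cauchyPart ζ w μ z k) (ζ : ℂ)⁻¹ := fun k =>
    continuousAt_pi.1 (differentiableAt_cauchyOp hpole hf (hpole 0)).continuousAt k
  have hF0 : Γ.cauchyPart ζ w μ (ζ : ℂ)⁻¹ 0 = 0 := cauchyOp_kernelPole hpole hf 0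
  have hζ' : (ζ : ℂ) ≠ 0 := by exact_mod_cast hζ0
  have hD : (1 : ℂ) - ζ ^ 2 + γ ≠ 0 := by
    have : (1 - ζ ^ 2 + γ : ℝ) ≠ 0 := by linarith
    exact_mod_cast this
  have hone : (ζ : ℂ)⁻¹ - ζ ≠ 0 := by
    have h1 : (1 - ζ ^ 2 : ℝ) ≠ 0 := by linarith
    have h2 : (1 - (ζ : ℂ) ^ 2) ≠ 0 := by exact_mod_cast h1
    have : (ζ : ℂ)⁻¹ - ζ = (1 - (ζ : ℂ) ^ 2) / ζ := by field_simp
    rw [this]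
    exact div_ne_zero h2 hζ'
  have hs0 := continuousAt_soliton_zero (γ := γ) hone
  set c := (1 + Γ.cTilde ζ w μ)⁻¹ with hc
  have hm : ∀ z k, Γ.associatedSolution ζ γ w μ z k =
    c * (soliton ζ γ z k + Γ.cauchyPart ζ w μ z k) := fun z k => rfl
  refine ⟨![0, c * ((1 - ζ ^ 2) / (1 - ζ ^ 2 + γ)) * ((ζ : ℂ)⁻¹ * γ)],
    tendsto_pi_nhds.2 fun k => ?_, tendsto_pi_nhds.2 fun k => ?_⟩
  · fin_cases k
    · have h1 : ContinuousAt (fun z : ℂ => (z - (ζ : ℂ)⁻¹) * (c * (soliton ζ γ z 0 +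
          Γ.cauchyPart ζ w μ z 0))) (ζ : ℂ)⁻¹ :=
        (continuousAt_id.sub continuousAt_const).mul (continuousAt_const.mul (hs0.add (hF 0)))
      have h2 := h1.tendsto.mono_left (nhdsWithin_le_nhds (s := {(ζ : ℂ)⁻¹}ᶜ))
      rw [sub_self, zero_mul] at h2
      exact h2
    · have h1 : ContinuousAt (fun z : ℂ => c * ((-(γ * ζ) * (1 - (ζ : ℂ)⁻¹ * z) +
          (z - (ζ : ℂ)⁻¹) * (1 - ζ ^ 2)) / (1 - ζ ^ 2 + γ) +
          (z - (ζ : ℂ)⁻¹) * Γ.cauchyPart ζ w μ z 1)) (ζ : ℂ)⁻¹ :=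
        continuousAt_const.mul (ContinuousAt.add (by fun_prop)
          ((continuousAt_id.sub continuousAt_const).mul (hF 1)))
      have h2 := h1.tendsto.mono_left (nhdsWithin_le_nhds (s := {(ζ : ℂ)⁻¹}ᶜ))
      have hval : c * ((-(γ * ζ) * (1 - (ζ : ℂ)⁻¹ * (ζ : ℂ)⁻¹) +
          ((ζ : ℂ)⁻¹ - (ζ : ℂ)⁻¹) * (1 - ζ ^ 2)) / (1 - ζ ^ 2 + γ) +
          ((ζ : ℂ)⁻¹ - (ζ : ℂ)⁻¹) * Γ.cauchyPart ζ w μ (ζ : ℂ)⁻¹ 1) =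
          c * ((1 - ζ ^ 2) / (1 - ζ ^ 2 + γ)) * ((ζ : ℂ)⁻¹ * γ) := by
        rw [sub_self, zero_mul, zero_mul, add_zero, add_zero]
        field_simp
        ring
      rw [hval] at h2
      refine h2.congr' ?_
      filter_upwards [self_mem_nhdsWithin] with z hz
      have hz' : (z - (ζ : ℂ)⁻¹) ≠ 0 := sub_ne_zero.2 hz
      change _ = (z - (ζ : ℂ)⁻¹) * (c * ((γ * ζ ^ 2 * ((1 - (ζ : ℂ)⁻¹ * z) / (1 - ζ * z)) + 1 -
        ζ ^ 2) / (1 - ζ ^ 2 + γ) + Γ.cauchyPart ζ w μ z 1))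
      have h3 : 1 - ζ * z = -(ζ * (z - (ζ : ℂ)⁻¹)) := by
        rw [mul_sub, mul_inv_cancel₀ hζ']
        ring
      have h4 : γ * (ζ : ℂ) ^ 2 * ((1 - (ζ : ℂ)⁻¹ * z) / (1 - ζ * z)) =
          -(γ * ζ) * (1 - (ζ : ℂ)⁻¹ * z) / (z - (ζ : ℂ)⁻¹) := by
        rw [h3]
        generalize 1 - (ζ : ℂ)⁻¹ * z = b
        generalize z - (ζ : ℂ)⁻¹ = a at hz'
        field_simp
      have h5 : (z - (ζ : ℂ)⁻¹) * (-(γ * ζ) * (1 - (ζ : ℂ)⁻¹ * z) / (z - (ζ : ℂ)⁻¹)) =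
        -(γ * ζ) * (1 - (ζ : ℂ)⁻¹ * z) := mul_div_cancel₀ _ hz'
      rw [h4]
      generalize -(γ * ζ) * (1 - (ζ : ℂ)⁻¹ * z) / (z - (ζ : ℂ)⁻¹) = q at h5
      linear_combination (-(c / (1 - ζ ^ 2 + γ))) * h5
  · fin_cases k
    · refine (tendsto_const_nhds (x := (0 : ℂ))).congr fun z => ?_
      simp [Matrix.vecMul, dotProduct]
    · have h1 : ContinuousAt (fun z : ℂ => c * (soliton ζ γ z 0 + Γ.cauchyPart ζ w μ z 0) *
          ((ζ : ℂ)⁻¹ * γ)) (ζ : ℂ)⁻¹ :=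
        (continuousAt_const.mul (hs0.add (hF 0))).mul continuousAt_const
      have h2 := h1.tendsto.mono_left (nhdsWithin_le_nhds (s := {(ζ : ℂ)⁻¹}ᶜ))
      have hval : soliton ζ γ (ζ : ℂ)⁻¹ 0 + Γ.cauchyPart ζ w μ (ζ : ℂ)⁻¹ 0 =
          (1 - ζ ^ 2) / (1 - ζ ^ 2 + γ) := by
        rw [hF0]
        change (γ * ζ ^ 2 * (((ζ : ℂ)⁻¹ - (ζ : ℂ)⁻¹) / ((ζ : ℂ)⁻¹ - ζ)) + 1 - ζ ^ 2) /
          (1 - ζ ^ 2 + γ) + 0 = _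
        rw [sub_self, zero_div, mul_zero, zero_add, add_zero]
      rw [hval] at h2
      refine h2.congr fun z => ?_
      simp [Matrix.vecMul, dotProduct, hm]

/-- The associated solution solves the Riemann--Hilbert problem. -/
theorem isRHPSolution_associatedSolution (hΓ : Γ.IsSymmetric ζ) (hζ0 : ζ ≠ 0) (hζ1 : ζ ^ 2 < 1)
    {γ : ℝ} (hγ : 0 ≤ γ) {w : JumpData} (hw : Γ.IsJumpData w) {μ : Γ.L2}
    (hμ : Γ.IsMuTilde ζ γ w μ) (hc : Γ.cTilde ζ w μ ≠ -1) :
    Γ.IsRHPSolution ζ γ w (Γ.associatedSolution ζ γ w μ) := by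
  have hpole := hΓ.kernelPole_notMem
  have hf := memLp_density hw.isBoundedData μ
  have hζ' : (ζ : ℂ) ≠ 0 := by exact_mod_cast hζ0
  have hD : (1 : ℂ) - ζ ^ 2 + γ ≠ 0 := by
    have : (1 - ζ ^ 2 + γ : ℝ) ≠ 0 := by linarith
    exact_mod_cast this
  refine ⟨fun z hz => ?_, exists_jump_associatedSolution hΓ hζ0 hζ1 hγ hw hμ,
    residue_zeta_associatedSolution hΓ hζ0 hζ1 hγ hw μ,
    residue_zeta_inv_associatedSolution hΓ hζ0 hζ1 hγ hw μ, fun z hz => ?_, ?_⟩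
  · simp only [mem_compl_iff, mem_union, mem_insert_iff, mem_singleton_iff, not_or] at hz
    have h3 : 1 - ζ * z ≠ 0 := fun h => hz.2.2 (by field_simp; linear_combination -h)
    exact (((differentiableAt_soliton (γ := γ) (sub_ne_zero.2 hz.2.1) h3).fun_add
      (differentiableAt_cauchyOp hpole hf hz.1)).fun_const_smul
        (1 + Γ.cTilde ζ w μ)⁻¹).differentiableWithinAt
  · simp only [mem_union, mem_insert_iff, mem_singleton_iff, not_or] at hz
    obtain ⟨hz1, hz0, hz2, hz3⟩ := hz
    -- Inversion exchanges `w_+` and `w_-` up to sign and conjugation by `σ`, so the density built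
    -- from their sum is its own reflection.
    have hinv : invertDensity (fun z => μ z ᵥ* (w.plus z + w.minus z)) =ᵐ[Γ.arcLength]
        fun z => μ z ᵥ* (w.plus z + w.minus z) := by
      refine invertDensity_vecMul hμ.1 fun s hs => ?_
      rw [hw.plus_inv s hs, hw.minus_inv s hs, Matrix.mul_add, Matrix.add_mul]
      abel
    have h1 := hΓ.cauchyOp_invertDensity hζ0 hf hz1 hz0
    rw [cauchyOp_congr hinv] at h1
    have h2 : Γ.cauchyPart ζ w μ z⁻¹ = Γ.cauchyPart ζ w μ z ᵥ* swapMatrix := by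
      rw [cauchyPart, h1, vecMul_swapMatrix_swapMatrix]
    rw [associatedSolution, associatedSolution, h2, soliton_inv hζ0 γ hz0 hz2 hz3,
      Matrix.smul_vecMul, Matrix.add_vecMul]
  · have hc' : 1 + Γ.cTilde ζ w μ ≠ 0 := fun h => hc (by linear_combination h)
    change (1 + Γ.cTilde ζ w μ)⁻¹ * ((γ * ζ ^ 2 * ((0 - (ζ : ℂ)⁻¹) / (0 - ζ)) + 1 - ζ ^ 2) /
      (1 - ζ ^ 2 + γ) + Γ.cTilde ζ w μ) = 1
    -- The first component of the soliton at `0` is `1`, so that of the unnormalized solution is `1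
    -- + c̃₀`.
    have : (γ * (ζ : ℂ) ^ 2 * ((0 - (ζ : ℂ)⁻¹) / (0 - ζ)) + 1 - ζ ^ 2) / (1 - ζ ^ 2 + γ) = 1 := by
      rw [div_eq_one_iff_eq hD, zero_sub, zero_sub, neg_div_neg_eq]
      field_simp
      ring
    rw [this, inv_mul_cancel₀ hc']

end OrientedContour

/-! ### Dependence of the Cauchy integral on the data -/

namespace OrientedContour

variable {n : ℕ} {Γ : OrientedContour n} {ζ : ℝ}

theorem cauchyOp_sub_apply (hζ : ∀ k, kernelPole ζ k ∉ Γ.carrier) {f g : ℂ → Fin 2 → ℂ}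
    (hf : MemLp f 2 Γ.arcLength) (hg : MemLp g 2 Γ.arcLength) {z : ℂ} (hz : z ∉ Γ.carrier) :
    Γ.cauchyOp ζ (f - g) z = Γ.cauchyOp ζ f z - Γ.cauchyOp ζ g z := by
  ext k
  rw [Pi.sub_apply, cauchyOp_eq_contourSum hζ (hf.sub hg) hz, cauchyOp_eq_contourSum hζ hf hz,
    cauchyOp_eq_contourSum hζ hg hz, ← mul_sub]
  congr 1
  simp only [contourSum]
  rw [← Finset.sum_sub_distrib]
  refine Finset.sum_congr rfl fun j _ => ?_
  rw [← integral_sub (integrable_contourSum_kernel hζ hf hz k k j)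
    (integrable_contourSum_kernel hζ hg hz k k j)]
  congr 1
  ext y
  simp only [Pi.sub_apply]
  ring

theorem exists_enorm_cauchyOp_le (hζ : ∀ k, kernelPole ζ k ∉ Γ.carrier) {δ : ℝ} (hδ : 0 < δ) :
    ∃ E : ℝ≥0, ∀ f, MemLp f 2 Γ.arcLength → ∀ z, (∀ s ∈ Γ.carrier, δ ≤ dist z s) →
      ‖Γ.cauchyOp ζ f z‖ₑ ≤ E * eLpNorm f 2 Γ.arcLength := by
  obtain ⟨C, hC, hCb⟩ := Γ.exists_enorm_cauchySum_le
  obtain ⟨D, hD⟩ := Γ.exists_eLpNorm_curve_le (E := Fin 2 → ℂ)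
  choose δ' hδ' hδd using fun k => Γ.exists_dist_ge (hζ k)
  set c : ℂ := (2 * Real.pi * Complex.I)⁻¹ with hc
  refine ⟨∑ k : Fin 2, ‖c‖₊ * ((C / δ).toNNReal + (C / δ' k).toNNReal) * (n * D),
    fun f hf z hz => ?_⟩
  have hz' : z ∉ Γ.carrier := fun h => by
    have := hz z h
    rw [dist_self] at this
    linarith
  have hS : ∀ k, ∑ j, eLpNorm (Γ.pullback f k j) 2 unitMeasure ≤
      (n * D : ℝ≥0) * eLpNorm f 2 Γ.arcLength := by
    intro k
    calc ∑ j, eLpNorm (Γ.pullback f k j) 2 unitMeasure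
        ≤ ∑ j : Fin n, D * eLpNorm f 2 Γ.arcLength :=
          Finset.sum_le_sum fun j _ => (eLpNorm_apply_le _ k).trans (hD f hf.1 j)
      _ = _ := by simp [mul_assoc]
  have hk : ∀ k, ‖Γ.cauchyOp ζ f z k‖ₑ ≤
      (‖c‖₊ * ((C / δ).toNNReal + (C / δ' k).toNNReal) * (n * D) : ℝ≥0) *
        eLpNorm f 2 Γ.arcLength := by
    intro k
    have hm := Γ.memLp_pullback hf k
    have h1 : ‖Γ.cauchySum (Γ.pullback f k) z‖ₑ ≤
        (C / δ).toNNReal * ((n * D : ℝ≥0) * eLpNorm f 2 Γ.arcLength) :=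
      (hCb _ hm δ hδ z hz).trans (mul_le_mul' le_rfl (hS k))
    have h2 : ‖Γ.cauchySum (Γ.pullback f k) (kernelPole ζ k)‖ₑ ≤
        (C / δ' k).toNNReal * ((n * D : ℝ≥0) * eLpNorm f 2 Γ.arcLength) :=
      (hCb _ hm _ (hδ' k) _ (hδd k)).trans (mul_le_mul' le_rfl (hS k))
    rw [Γ.cauchyOp_apply_of_notMem hζ hf hz', enorm_mul]
    refine (mul_le_mul' le_rfl ((enorm_sub_le).trans (add_le_add h1 h2))).trans (le_of_eq ?_)
    rw [enorm_eq_nnnorm]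
    push_cast
    ring
  have hsum : ‖Γ.cauchyOp ζ f z‖ₑ ≤ ∑ k, ‖Γ.cauchyOp ζ f z k‖ₑ := by
    have h1 : ‖Γ.cauchyOp ζ f z‖ ≤ ∑ k, ‖Γ.cauchyOp ζ f z k‖ :=
      (pi_norm_le_iff_of_nonneg (by positivity)).2 fun k =>
        Finset.single_le_sum (f := fun k => ‖Γ.cauchyOp ζ f z k‖) (fun _ _ => norm_nonneg _)
          (Finset.mem_univ k)
    rw [← ofReal_norm]
    refine (ENNReal.ofReal_le_ofReal h1).trans (le_of_eq ?_)
    rw [ENNReal.ofReal_sum_of_nonneg fun _ _ => norm_nonneg _]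
    simp only [ofReal_norm]
  refine hsum.trans ?_
  rw [ENNReal.ofNNReal_finsetSum, Finset.sum_mul]
  exact Finset.sum_le_sum fun k _ => hk k

theorem exists_norm_cauchyPart_le (hζ : ∀ k, kernelPole ζ k ∉ Γ.carrier) {δ : ℝ} (hδ : 0 < δ) :
    ∃ E : ℝ, 0 ≤ E ∧ ∀ w, Γ.IsBoundedData w → ∀ μ : Γ.L2, ∀ z,
      (∀ s ∈ Γ.carrier, δ ≤ dist z s) →
        ‖Γ.cauchyPart ζ w μ z‖ ≤ E * (Γ.supNorm w).toReal * ‖μ‖ := by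
  obtain ⟨E, hE⟩ := exists_enorm_cauchyOp_le hζ hδ
  refine ⟨E * 2, by positivity, fun w hw μ z hz => ?_⟩
  have h1 : ‖Γ.cauchyPart ζ w μ z‖ₑ ≤ E * (2 * Γ.supNorm w * ‖μ‖ₑ) := by
    refine (hE _ (memLp_density hw μ) z hz).trans (mul_le_mul' le_rfl ?_)
    rw [Lp.enorm_def]
    exact (memLp_vecMul hw.add.1 (Lp.memLp μ)).2.trans
      (mul_le_mul' (mul_le_mul' le_rfl hw.add.2) le_rfl)
  have := ENNReal.toReal_mono (ENNReal.mul_ne_top ENNReal.coe_ne_top (ENNReal.mul_ne_top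
    (ENNReal.mul_ne_top (by simp) hw.supNorm_ne_top) enorm_ne_top)) h1
  rw [ENNReal.toReal_mul, ENNReal.toReal_mul, ENNReal.toReal_mul, ENNReal.coe_toReal, toReal_enorm,
    toReal_enorm, ENNReal.toReal_ofNat] at this
  linarith

/-- The Cauchy integral is bilinear in the jump data and `μ`; a mixed term is inserted so that each
summand contains one small factor. -/
theorem cauchyPart_sub (hζ : ∀ k, kernelPole ζ k ∉ Γ.carrier) {w w₀ : JumpData}
    (hw : Γ.IsBoundedData w) (hw₀ : Γ.IsBoundedData w₀) (μ μ₀ : Γ.L2) {z : ℂ}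
    (hz : z ∉ Γ.carrier) : Γ.cauchyPart ζ w μ z - Γ.cauchyPart ζ w₀ μ₀ z =
      Γ.cauchyPart ζ w (μ - μ₀) z + Γ.cauchyPart ζ (w - w₀) μ₀ z := by
  have h1 : Γ.cauchyPart ζ w (μ - μ₀) z = Γ.cauchyPart ζ w μ z - Γ.cauchyPart ζ w μ₀ z := by
    simp only [cauchyPart]
    rw [← cauchyOp_sub_apply hζ (memLp_density hw μ) (memLp_density hw μ₀) hz]
    refine congrFun (cauchyOp_congr ?_) z
    filter_upwards [Lp.coeFn_sub μ μ₀] with s hs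
    rw [hs, Pi.sub_apply, Pi.sub_apply, Matrix.sub_vecMul]
  have h2 : Γ.cauchyPart ζ (w - w₀) μ₀ z = Γ.cauchyPart ζ w μ₀ z - Γ.cauchyPart ζ w₀ μ₀ z := by
    simp only [cauchyPart]
    rw [← cauchyOp_sub_apply hζ (memLp_density hw μ₀) (memLp_density hw₀ μ₀) hz]
    refine congrFun (cauchyOp_congr (Eventually.of_forall fun s => ?_)) z
    change μ₀ s ᵥ* (w.plus s - w₀.plus s + (w.minus s - w₀.minus s)) = _
    rw [Pi.sub_apply, ← Matrix.vecMul_sub]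
    congr 1
    abel
  rw [h1, h2]
  abel

theorem IsMuTilde.sub_eq {γ : ℝ} {w : JumpData} {μ : Γ.L2} (hμ : Γ.IsMuTilde ζ γ w μ)
    (h : MemLp (soliton ζ γ) 2 Γ.arcLength) :
    μ - Γ.cauchyW ζ w μ = h.toLp (soliton ζ γ) := by
  refine Lp.ext ?_
  filter_upwards [hμ.2, h.coeFn_toLp] with z h1 h2
  rw [h1, h2]

theorem HasInverseBound.exists_isMuTilde (hΓ : Γ.IsSymmetric ζ) (hζ0 : ζ ≠ 0) {γ K : ℝ}
    {w : JumpData} (h : Γ.HasInverseBound ζ w K) (hs : MemLp (soliton ζ γ) 2 Γ.arcLength) :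
    ∃ μ, Γ.IsMuTilde ζ γ w μ := by
  obtain ⟨μ, hμ, hμe⟩ := h.1.surjOn (hΓ.soliton_mem_L2s hζ0 hs)
  refine ⟨μ, hμ, ?_⟩
  have : μ - Γ.cauchyW ζ w μ = hs.toLp (soliton ζ γ) := hμe
  rw [this]
  exact hs.coeFn_toLp

/-- Solutions of the singular integral equation depend continuously on the jump data. -/
theorem norm_isMuTilde_sub_le (hΓ : Γ.IsSymmetric ζ) {γ K K₀ S δ : ℝ}
    {w w₀ : JumpData} (hw : Γ.IsBoundedData w) (hw₀ : Γ.IsBoundedData w₀) (hK : 0 ≤ K)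
    (hK₀ : 0 ≤ K₀) (hδ0 : 0 ≤ δ) (h : Γ.HasInverseBound ζ w K) (h₀ : Γ.HasInverseBound ζ w₀ K₀)
    (hδ : ∀ f : Γ.L2, ‖Γ.cauchyW ζ (w - w₀) f‖ ≤ δ * ‖f‖)
    (hs : MemLp (soliton ζ γ) 2 Γ.arcLength) (hS : ‖hs.toLp (soliton ζ γ)‖ ≤ S) {μ μ₀ : Γ.L2}
    (hμ : Γ.IsMuTilde ζ γ w μ) (hμ₀ : Γ.IsMuTilde ζ γ w₀ μ₀) :
    ‖μ₀‖ ≤ K₀ * S ∧ ‖μ - μ₀‖ ≤ K * (δ * (K₀ * S)) := by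
  have hpole := hΓ.kernelPole_notMem
  have h1 : ‖μ₀‖ ≤ K₀ * S := by
    refine (h₀.2 μ₀ hμ₀.1).trans ?_
    rw [hμ₀.sub_eq hs]
    gcongr
  refine ⟨h1, (h.2 _ (sub_mem_L2s hΓ hμ.1 hμ₀.1)).trans ?_⟩
  -- Both equations have the same right-hand side `m₀`, so it cancels and only the difference of the
  -- operators, applied to `μ₀`, remains.
  have h2 : μ - μ₀ - Γ.cauchyW ζ w (μ - μ₀) = Γ.cauchyW ζ (w - w₀) μ₀ := by
    rw [cauchyW_sub hpole hw, cauchyW_sub_data hpole hw hw₀, sub_sub_sub_comm, hμ.sub_eq hs,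
      ← hμ₀.sub_eq hs]
    abel
  rw [h2]
  gcongr
  exact (hδ μ₀).trans (by gcongr)

end OrientedContour

/-! ### The comparison of the solutions -/

theorem norm_inv_smul_sub_inv_smul_le {E : Type*} [NormedAddCommGroup E] [NormedSpace ℂ E]
    {a b : ℂ} {x y : E} {d : ℝ} (hd : 0 < d) (ha : d / 2 ≤ ‖a‖) (hb : d ≤ ‖b‖) :
    ‖a⁻¹ • x - b⁻¹ • y‖ ≤ 2 / d * ‖x - y‖ + 2 / d ^ 2 * ‖a - b‖ * ‖y‖ := by
  have ha0 : a ≠ 0 := norm_pos_iff.1 ((half_pos hd).trans_le ha)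
  have hb0 : b ≠ 0 := norm_pos_iff.1 (hd.trans_le hb)
  have heq : a⁻¹ • x - b⁻¹ • y = a⁻¹ • (x - y) - (a⁻¹ * b⁻¹ * (a - b)) • y := by
    have : a⁻¹ * b⁻¹ * (a - b) = b⁻¹ - a⁻¹ := by
      field_simp
    rw [this, smul_sub, sub_smul]
    abel
  have h1 : ‖a⁻¹‖ ≤ 2 / d := by
    rw [norm_inv, ← inv_div]
    gcongr
  have h2 : ‖b⁻¹‖ ≤ 1 / d := by
    rw [norm_inv, one_div]
    gcongr
  rw [heq]
  refine (norm_sub_le _ _).trans ?_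
  rw [norm_smul, norm_smul, norm_mul, norm_mul]
  have h3 : ‖a⁻¹‖ * ‖b⁻¹‖ ≤ 2 / d ^ 2 :=
    (mul_le_mul h1 h2 (norm_nonneg _) (by positivity)).trans (le_of_eq (by field_simp))
  gcongr
theorem theoremA6 {n : ℕ} (Γ : OrientedContour n) (ζ : ℝ)
    (hζ : ζ ∈ Ioo (-1 : ℝ) 0 ∪ Ioo (0 : ℝ) 1) (hΓ : Γ.IsSymmetric ζ)
    (t₀ : ℝ) (γ : ℝ → ℝ) (hγ : ∀ t ≥ t₀, 0 ≤ γ t)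
    (w₀ w : ℝ → JumpData)
    (hw₀ : ∀ t ≥ t₀, Γ.IsJumpData (w₀ t)) (hw : ∀ t ≥ t₀, Γ.IsJumpData (w t))
    (hinv : ∃ K : ℝ, ∀ t ≥ t₀, Γ.HasInverseBound ζ (w₀ t) K)
    (hc : ∃ d > 0, ∀ t ≥ t₀, ∀ μ₀ : Γ.L2, Γ.IsMuTilde ζ (γ t) (w₀ t) μ₀ →
      d ≤ ‖Γ.cTilde ζ (w₀ t) μ₀ - (-1)‖)
    (α : ℝ → ℝ) (hα₀ : ∀ t ≥ t₀, 0 ≤ α t) (hα : Tendsto α atTop (𝓝 0))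
    (hdiff : ∀ t ≥ t₀, Γ.supNorm (w t - w₀ t) ≤ ENNReal.ofReal (α t)) :
    (∃ T ≥ t₀, ∃ K : ℝ, ∀ t ≥ T, Γ.HasInverseBound ζ (w t) K) ∧
    ((∃ M : ℝ≥0, ∀ t ≥ t₀, Γ.supNorm (w₀ t) ≤ M) →
      ∃ T ≥ t₀,
        (∀ t ≥ T, ∃ μ μ₀ : Γ.L2,
          Γ.IsMuTilde ζ (γ t) (w t) μ ∧ Γ.cTilde ζ (w t) μ ≠ -1 ∧
          Γ.IsRHPSolution ζ (γ t) (w t) (Γ.associatedSolution ζ (γ t) (w t) μ) ∧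
          Γ.IsMuTilde ζ (γ t) (w₀ t) μ₀ ∧ Γ.cTilde ζ (w₀ t) μ₀ ≠ -1 ∧
          Γ.IsRHPSolution ζ (γ t) (w₀ t) (Γ.associatedSolution ζ (γ t) (w₀ t) μ₀)) ∧
        ∀ ε > 0, ∃ B : ℝ, ∀ t ≥ T, ∀ μ μ₀ : Γ.L2,
          Γ.IsMuTilde ζ (γ t) (w t) μ → Γ.IsMuTilde ζ (γ t) (w₀ t) μ₀ →
          ∀ z : ℂ, (∀ s ∈ Γ.carrier ∪ {(ζ : ℂ), (ζ : ℂ)⁻¹}, ε ≤ dist z s) →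
            ‖Γ.associatedSolution ζ (γ t) (w t) μ z -
              Γ.associatedSolution ζ (γ t) (w₀ t) μ₀ z‖ ≤ B * α t) := by
  have hζ0 : ζ ≠ 0 := by
    rcases hζ with h | h
    · exact h.2.ne
    · exact h.1.ne'
  have hζ1 : ζ ^ 2 < 1 := by
    rcases hζ with h | h <;> nlinarith [h.1, h.2]
  have hpole := hΓ.kernelPole_notMem
  have hb₀ := fun t ht => (hw₀ t ht).isBoundedData
  have hb := fun t ht => (hw t ht).isBoundedData
  obtain ⟨K', hK'⟩ := hinv
  -- The given bound need not be positive; a positive one may be inverted.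
  set K := max K' 1 with hKdef
  have hK : 0 < K := by positivity
  have hinvK : ∀ t ≥ t₀, Γ.HasInverseBound ζ (w₀ t) K := fun t ht =>
    ⟨(hK' t ht).1, fun f hf => ((hK' t ht).2 f hf).trans (by gcongr; exact le_max_left _ _)⟩
  obtain ⟨C, hC, hCb⟩ := OrientedContour.exists_norm_cauchyW_le hpole
  have hsup : ∀ t ≥ t₀, (Γ.supNorm (w t - w₀ t)).toReal ≤ α t := fun t ht =>
    ENNReal.toReal_le_of_le_ofReal (hα₀ t ht) (hdiff t ht)
  have hδ : ∀ t ≥ t₀, ∀ f : Γ.L2, ‖Γ.cauchyW ζ (w t - w₀ t) f‖ ≤ C * α t * ‖f‖ := fun t ht f =>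
    (hCb _ ((hb t ht).sub (hb₀ t ht)) f).trans (by gcongr; exact hsup t ht)
  have hsmall : ∀ η > 0, ∃ T ≥ t₀, ∀ t ≥ T, α t ≤ η := fun η hη => by
    obtain ⟨T, hT⟩ := eventually_atTop.1 (hα.eventually_le_const hη)
    exact ⟨max T t₀, le_max_right _ _, fun t ht => hT t ((le_max_left _ _).trans ht)⟩
  -- The threshold makes `K` times the norm `C α` of the perturbation at most `1 / 2`.
  have hnear : ∀ t ≥ t₀, α t ≤ 1 / (2 * K * C) → Γ.HasInverseBound ζ (w t) (2 * K) := by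
    intro t ht hαt
    refine OrientedContour.HasInverseBound.of_small hΓ hζ0 (hw₀ t ht) (hw t ht) hK (hinvK t ht)
      (hδ t ht) ?_
    calc K * (C * α t) ≤ K * (C * (1 / (2 * K * C))) := by gcongr
      _ = 1 / 2 := by field_simp
  refine ⟨?_, ?_⟩
  · obtain ⟨T, hT, hTα⟩ := hsmall (1 / (2 * K * C)) (by positivity)
    exact ⟨T, hT, 2 * K, fun t ht => hnear t (hT.trans ht) (hTα t ht)⟩
  rintro ⟨M, hM⟩
  obtain ⟨d, hd, hcd⟩ := hc
  obtain ⟨S, hS⟩ := hΓ.exists_memLp_soliton hζ0 hζ1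
  have hsol := fun t (ht : t ≥ t₀) => (hS (γ t) (hγ t ht)).1
  have hsolS : ∀ t (ht : t ≥ t₀), ‖(hsol t ht).toLp (soliton ζ (γ t))‖ ≤ S := fun t ht => by
    rw [Lp.norm_toLp]
    exact ENNReal.toReal_le_coe_of_le_coe (hS (γ t) (hγ t ht)).2
  have hM₀ : ∀ t ≥ t₀, (Γ.supNorm (w₀ t)).toReal ≤ M := fun t ht =>
    ENNReal.toReal_le_coe_of_le_coe (hM t ht)
  have hM₁ : ∀ t ≥ t₀, α t ≤ 1 → (Γ.supNorm (w t)).toReal ≤ M + 1 := by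
    intro t ht h1
    have h2 := ENNReal.toReal_mono (ENNReal.add_ne_top.2 ⟨(hb₀ t ht).supNorm_ne_top,
      ((hb t ht).sub (hb₀ t ht)).supNorm_ne_top⟩) ((hb t ht).supNorm_sub_le (hb₀ t ht))
    rw [ENNReal.toReal_add (hb₀ t ht).supNorm_ne_top
      ((hb t ht).sub (hb₀ t ht)).supNorm_ne_top] at h2
    linarith [hM₀ t ht, hsup t ht]
  -- Per unit of `α`, the first term is `‖w‖ ‖μ - μ₀‖` and the second is `‖w - w₀‖ ‖μ₀‖`, with `‖μ₀‖
  -- ≤ K S` and `‖w‖_∞ ≤ M + 1` once `α ≤ 1`.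
  set Q : ℝ := (M + 1) * (2 * K * (C * (K * S))) + K * S with hQ
  have hQ0 : 0 ≤ Q := by positivity
  have hpart : ∀ δ > 0, ∃ E : ℝ, 0 ≤ E ∧ ∀ t ≥ t₀, α t ≤ 1 → α t ≤ 1 / (2 * K * C) →
      ∀ μ μ₀ : Γ.L2, Γ.IsMuTilde ζ (γ t) (w t) μ → Γ.IsMuTilde ζ (γ t) (w₀ t) μ₀ →
      ∀ z : ℂ, (∀ s ∈ Γ.carrier, δ ≤ dist z s) →
        ‖Γ.cauchyPart ζ (w t) μ z - Γ.cauchyPart ζ (w₀ t) μ₀ z‖ ≤ E * Q * α t ∧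
        ‖Γ.cauchyPart ζ (w₀ t) μ₀ z‖ ≤ E * M * (K * S) := by
    intro δ hδ0
    obtain ⟨E, hE0, hE⟩ := OrientedContour.exists_norm_cauchyPart_le hpole hδ0
    refine ⟨E, hE0, fun t ht h1 h2 μ μ₀ hμ hμ₀ z hz => ?_⟩
    have hz' : z ∉ Γ.carrier := fun h => by
      have := hz z h
      rw [dist_self] at this
      linarith
    have hαt := hα₀ t ht
    obtain ⟨hn₀, hn⟩ := OrientedContour.norm_isMuTilde_sub_le hΓ (hb t ht) (hb₀ t ht)
      (by positivity : 0 ≤ 2 * K) hK.le (by positivity : 0 ≤ C * α t) (hnear t ht h2)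
      (hinvK t ht) (hδ t ht) (hsol t ht) (hsolS t ht) hμ hμ₀
    refine ⟨?_, (hE _ (hb₀ t ht) μ₀ z hz).trans (by gcongr; exact hM₀ t ht)⟩
    rw [OrientedContour.cauchyPart_sub hpole (hb t ht) (hb₀ t ht) μ μ₀ hz']
    calc _ ≤ E * (Γ.supNorm (w t)).toReal * ‖μ - μ₀‖ +
          E * (Γ.supNorm (w t - w₀ t)).toReal * ‖μ₀‖ :=
          (norm_add_le _ _).trans (add_le_add (hE _ (hb t ht) _ z hz)
            (hE _ ((hb t ht).sub (hb₀ t ht)) _ z hz))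
      _ ≤ E * (M + 1) * (2 * K * (C * α t * (K * S))) + E * α t * (K * S) := by
          gcongr
          · exact hM₁ t ht h1
          · exact hsup t ht
      _ = E * Q * α t := by
          rw [hQ]
          ring
  -- The constants `c̃₀` are values at `z = 0`, so the estimate of the Cauchy integrals at distance
  -- `δ₀` compares them.
  obtain ⟨δ₀, hδ₀, hdist₀⟩ := Γ.exists_dist_ge hΓ.zero_notMem
  obtain ⟨E₀, hE₀, hpart₀⟩ := hpart δ₀ hδ₀
  -- Three demands on `α`: a bound for `‖w‖_∞`, invertibility, and a change of `c̃₀` by at most `d /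
  -- 2`. None involves `ε`, so `T` serves every `ε`. Adding `1` to `E₀ * Q` avoids a zero
  -- denominator.
  obtain ⟨T, hT, hTα⟩ := hsmall (min 1 (min (1 / (2 * K * C)) (d / 2 / (E₀ * Q + 1))))
    (by positivity)
  have hα1 : ∀ t ≥ T, α t ≤ 1 := fun t ht => (hTα t ht).trans (min_le_left _ _)
  have hα2 : ∀ t ≥ T, α t ≤ 1 / (2 * K * C) := fun t ht =>
    (hTα t ht).trans ((min_le_right _ _).trans (min_le_left _ _))
  have hα3 : ∀ t ≥ T, E₀ * Q * α t ≤ d / 2 := fun t ht => by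
    have h1 : α t * (E₀ * Q + 1) ≤ d / 2 := (le_div_iff₀ (by positivity)).1
      ((hTα t ht).trans ((min_le_right _ _).trans (min_le_right _ _)))
    nlinarith [hα₀ t (hT.trans ht)]
  have hconst : ∀ t ≥ T, ∀ μ μ₀ : Γ.L2, Γ.IsMuTilde ζ (γ t) (w t) μ →
      Γ.IsMuTilde ζ (γ t) (w₀ t) μ₀ →
      ‖(1 + Γ.cTilde ζ (w t) μ) - (1 + Γ.cTilde ζ (w₀ t) μ₀)‖ ≤ E₀ * Q * α t ∧
      d / 2 ≤ ‖1 + Γ.cTilde ζ (w t) μ‖ ∧ d ≤ ‖1 + Γ.cTilde ζ (w₀ t) μ₀‖ := by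
    intro t ht μ μ₀ hμ hμ₀
    have ht' := hT.trans ht
    have h1 := (norm_le_pi_norm _ 0).trans
      (hpart₀ t ht' (hα1 t ht) (hα2 t ht) μ μ₀ hμ hμ₀ 0 hdist₀).1
    have h2 := hcd t ht' μ₀ hμ₀
    rw [sub_neg_eq_add, add_comm] at h2
    have h3 : ‖(1 + Γ.cTilde ζ (w t) μ) - (1 + Γ.cTilde ζ (w₀ t) μ₀)‖ ≤ E₀ * Q * α t := by
      rw [add_sub_add_left_eq_sub]
      exact h1
    refine ⟨h3, ?_, h2⟩
    have h4 := norm_sub_norm_le (1 + Γ.cTilde ζ (w₀ t) μ₀) (1 + Γ.cTilde ζ (w t) μ)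
    rw [norm_sub_rev] at h4
    linarith [hα3 t ht]
  refine ⟨T, hT, fun t ht => ?_, fun ε hε => ?_⟩
  · have ht' := hT.trans ht
    obtain ⟨μ, hμ⟩ := (hnear t ht' (hα2 t ht)).exists_isMuTilde hΓ hζ0 (hsol t ht')
    obtain ⟨μ₀, hμ₀⟩ := (hinvK t ht').exists_isMuTilde hΓ hζ0 (hsol t ht')
    obtain ⟨-, h1, h2⟩ := hconst t ht μ μ₀ hμ hμ₀
    have hne : ∀ c : ℂ, d / 2 ≤ ‖1 + c‖ → c ≠ -1 := by
      rintro c hc rfl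
      rw [add_neg_cancel, norm_zero] at hc
      linarith
    have hc := hne _ h1
    have hc₀ := hne _ ((half_le_self hd.le).trans h2)
    exact ⟨μ, μ₀, hμ, hc, OrientedContour.isRHPSolution_associatedSolution hΓ hζ0 hζ1
      (hγ t ht') (hw t ht') hμ hc, hμ₀, hc₀,
      OrientedContour.isRHPSolution_associatedSolution hΓ hζ0 hζ1 (hγ t ht') (hw₀ t ht') hμ₀ hc₀⟩
  · obtain ⟨E, hE, hpartE⟩ := hpart ε hε
    -- The first term comes from the change of the Cauchy integral, the second from the change of
    -- the normalizing factor times a bound for the unnormalized solution `m₀ + F₀`.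
    refine ⟨2 / d * (E * Q) + 2 / d ^ 2 * (E₀ * Q) *
      ((2 + (1 + |ζ - ζ⁻¹|) / ε) + E * M * (K * S)), fun t ht μ μ₀ hμ hμ₀ z hz => ?_⟩
    have ht' := hT.trans ht
    have hαt := hα₀ t ht'
    obtain ⟨h0, h1, h2⟩ := hconst t ht μ μ₀ hμ hμ₀
    obtain ⟨h3, h4⟩ := hpartE t ht' (hα1 t ht) (hα2 t ht) μ μ₀ hμ hμ₀ z fun s hs =>
      hz s (Or.inl hs)
    have h5 := norm_soliton_le hζ0 hζ1 (hγ t ht') hε (hz ζ (by simp)) (hz (ζ : ℂ)⁻¹ (by simp))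
    refine (norm_inv_smul_sub_inv_smul_le hd h1 h2).trans ?_
    rw [add_sub_add_left_eq_sub]
    calc _ ≤ 2 / d * (E * Q * α t) + 2 / d ^ 2 * (E₀ * Q * α t) *
          ((2 + (1 + |ζ - ζ⁻¹|) / ε) + E * M * (K * S)) := by
          gcongr
          exact (norm_add_le _ _).trans (add_le_add h5 h4)
      _ = _ := by ring
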